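/- **Setting.** For $n\ge 1$ let $J=(J_{jk})_{1\le j<k\le n}$ be independent standard normal variables and $C(z)=\frac1{\sqrt n}\sum_{j<k}J_{jk}z_jz_k$ for $z\in\{\pm1\}^n$ (the Sherrington–Kirkpatrick model), regarded also as a diagonal operator on $(\mathbb C^2)^{\otimes n}$. Let $B=\sum_j X_j$ be the sum of the Pauli $X$ operators, $|s\rangle=2^{-n/2}\sum_z|z\rangle$, and for $\gamma,\beta\in\mathbb R^p$ let $|\gamma,\beta\rangle=e^{-i\beta_pB}e^{-i\gamma_pC}\cdots e^{-i\beta_1B}e^{-i\gamma_1C}|s\rangle$ (the QAOA state). **Definitions.** Let $A=\{\pm1\}^{2p}$, with elements $a=(a_1,\dots,a_p,a_{-p},\dots,a_{-1})$ and entrywise product $ab$. Put $a^*_{r}=a_ra_{r+1}\cdots a_p$ and $a^*_{-r}=a_{-r}a_{-r-1}\cdots a_{-p}$ for $1\le r\le p$. Let $A_{p+1}=\{a: a_{-r}=a_r\text{ for all }r\}$ and $A_\ell=\{a: a_{-r}=a_r \text{ for } r>p-\ell+1,\ a_{-(p-\ell+1)}=-a_{p-\ell+1}\}$ for $1\le\ell\le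 p$; for $a\in A_\ell$, $\ell\le p$, let $\bar a$ be $a$ with the signs of $a_{\pm(p-\ell+1)}$ flipped. With $\theta(b)=(1+b)/2$ let $$Q_a=\prod_{j=1}^p(\cos\beta_j)^{\theta(a_j)+\theta(a_{-j})}(\sin\beta_j)^{\theta(-a_j)+\theta(-a_{-j})}\,i^{\,\theta(-a_j)-\theta(-a_{-j})},\qquad \Phi_a=\sum_{r=1}^p\gamma_r(a^*_r-a^*_{-r}),$$ $$F_b=\exp\Big[-\tfrac12\sum_{a\in A_{p+1}}Q_a\Phi_{ab}^2\Big],\qquad X_b=Q_bF_b,\qquad K_{b,c}=\tfrac12X_b(\Phi_{\bar bc}^2-\Phi_{bc}^2).$$ An *admissible indexing* is an enumeration $D=(d_1,\dots,d_{|D|})$ without repetition of a subset of $A\setminus A_{p+1}$ that contains exactly one of $b,\bar b$ for every $b\in A\setminus A_{p+1}$, such that $\Phi^2_{\bar d_id_j}=\Phi^2_{d_id_j}$ whenever $i\le j$. Given $D$, start with $R_j=1$ for all $1\le j\le |D|$; for $s=|D|,|D|-1,\dots,2$ replace $R_j$ by $R_j\exp(R_sK_{d_s,d_j})$ for all $j$;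 with the final values put $Y_u=\exp[\sum_jR_jK_{d_j,u}]$ and $W_u=X_uY_u$ for $u\in A$. Let $$V_p(\gamma,\beta)=\frac i2\sum_{r=1}^p\gamma_r\Big[\sum_{u\in A}(u^*_r+u^*_{-r})W_u\Big]\Big[\sum_{v\in A}(v^*_r-v^*_{-r})W_v\Big].$$ For $u,v,x,y\in A$ let, with sums over all $(n_a)_{a\in A}\in\mathbb Z_{\ge0}^A$ with $\sum_an_a=n$, $$S_{u,v}=\sum_{\{n_a\}}\binom n{\{n_a\}}\exp\Big[-\frac1{4n}\sum_{a,b\in A}\Phi_{ab}^2n_an_b\Big]\Big(\prod_{a\in A}Q_a^{n_a}\Big)\frac{n_un_v}{n^2},$$ and let $S_{u,v,x,y}$ be the same sum with $\frac{n_un_vn_xn_y}{n^4}$ in place of $\frac{n_un_v}{n^2}$. **Theorem.** For every $p$ there is an enumeration $D$ that is an admissible indexing for all $\gamma$. For every $p$, all $\gamma,\beta\in\mathbb R^p$ and every admissible indexing $D$: 1. $\lim_{n\to\infty}S_{u,v}=W_uW_v$ and $\lim_{n\to\infty}S_{u,v,x,y}=W_uW_vW_xW_y$ for all $u,v,x,y\in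 A$. 2. $\langle\gamma,\beta|C/n|\gamma,\beta\rangle$ is integrable in $J$, and $\lim_{n\to\infty}\mathbb E_J\langle\gamma,\beta|C/n|\gamma,\beta\rangle$ exists and equals $V_p(\gamma,\beta)$. 3. The procedure that, from the input $(\gamma,\beta)$, computes in this order $\cos\beta_r,\sin\beta_r$, all $Q_a$, all $\Phi_a^2$, all $X_b$, then the array $R$ by the iteration above (evaluating $K$ when it is needed), then $W_u=X_u$ for $u\in A_{p+1}$, $W_u=X_uY_u$ and $W_{\bar u}=-W_u$ for $u\in D$, and finally the formula for $V_p$, returns all $W_u$ and $V_p(\gamma,\beta)$ and uses at most $c\cdot16^p$ elementary operations (loading a rational constant or $i$, copying, negation, addition, subtraction, multiplication, $\exp$, $\cos$, $\sin$ of complex numbers), with an absolute constant $c$. -/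

import Mathlib

noncomputable section

namespace QAOASK

open MeasureTheory ProbabilityTheory Matrix

/-! ### The Sherrington-Kirkpatrick model and the QAOA -/

/-- Strings of `n` spins; a spin `±1` is an element of `ℤˣ`. -/
abbrev Spins (n : ℕ) := Fin n → ℤˣ

/-- The pairs `j < k`. -/
abbrev Pairs (n : ℕ) := {e : Fin n × Fin n // e.1 < e.2}

/-- `C(z) = n^{-1/2} ∑_{j<k} J_{jk} z_j z_k`. -/
def cost {n : ℕ} (J : Pairs n → ℝ) (z : Spins n) : ℝ :=
  (1 / Real.sqrt n) * ∑ e : Pairs n, J e * ((z e.1.1 : ℤ) : ℝ) * ((z e.1.2 : ℤ) : ℝ)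

/-- The operator `C`, diagonal in the computational basis. -/
def costOp {n : ℕ} (J : Pairs n → ℝ) : Matrix (Spins n) (Spins n) ℂ :=
  Matrix.diagonal fun z => (cost J z : ℂ)

/-- The Pauli operator `X_j`, which flips the spin `j`. -/
def pauliX {n : ℕ} (j : Fin n) : Matrix (Spins n) (Spins n) ℂ :=
  fun z z' => if z = Function.update z' j (-z' j) then 1 else 0

/-- `B = ∑_j X_j`. -/
def mixer (n : ℕ) : Matrix (Spins n) (Spins n) ℂ := ∑ j : Fin n, pauliX j

/-- `U(C,γ) = exp(-iγC)`. -/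
def phaseUnitary {n : ℕ} (J : Pairs n → ℝ) (γ : ℝ) : Matrix (Spins n) (Spins n) ℂ :=
  NormedSpace.exp ((-(Complex.I * (γ : ℂ))) • costOp J)

/-- `U(B,β) = exp(-iβB)`. -/
def mixerUnitary (n : ℕ) (β : ℝ) : Matrix (Spins n) (Spins n) ℂ :=
  NormedSpace.exp ((-(Complex.I * (β : ℂ))) • mixer n)

/-- The uniform superposition `|s⟩`. -/
def initialState (n : ℕ) : Spins n → ℂ := fun _ => ((1 / Real.sqrt (2 ^ n) : ℝ) : ℂ)

/-- `|γ,β⟩ = U(B,β_p) U(C,γ_p) ⋯ U(B,β_1) U(C,γ_1) |s⟩`. -/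
def qaoaState {n p : ℕ} (J : Pairs n → ℝ) (γ β : Fin p → ℝ) : Spins n → ℂ :=
  (List.finRange p).foldl
    (fun ψ r => mixerUnitary n (β r) *ᵥ (phaseUnitary J (γ r) *ᵥ ψ)) (initialState n)

/-- `⟨γ,β| C/n |γ,β⟩`. -/
def energyDensity {n p : ℕ} (γ β : Fin p → ℝ) (J : Pairs n → ℝ) : ℂ :=
  star (qaoaState J γ β) ⬝ᵥ (((1 / (n : ℂ)) • costOp J) *ᵥ qaoaState J γ β)

/-- The law of the couplings: independent standard normal variables. -/
def couplingLaw (n : ℕ) : Measure (Pairs n → ℝ) := Measure.pi fun _ => gaussianReal 0 1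

/-! ### Configurations -/

/-- The set `A` of configurations `(a_1,…,a_p,a_{-p},…,a_{-1})`. The entries `a_1,…,a_p` are
`a.1 0, …, a.1 (p-1)`, and `a_{-1},…,a_{-p}` are `a.2 0, …, a.2 (p-1)`. Multiplication is
entrywise. -/
abbrev Config (p : ℕ) := (Fin p → ℤˣ) × (Fin p → ℤˣ)

variable {p : ℕ}

/-- `a ∈ A_ℓ` with `1 ≤ ℓ ≤ p`, where `r` stands for the position `p - ℓ + 1` (counted from 1). -/
def HasPivot (a : Config p) (r : Fin p) : Prop :=
  a.2 r = -a.1 r ∧ ∀ s, r < s → a.2 s = a.1 s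

instance (a : Config p) (r : Fin p) : Decidable (HasPivot a r) := by
  unfold HasPivot; infer_instance

/-- `a ∈ A_{p+1}`. -/
def IsMirror (a : Config p) : Prop := ∀ r, a.2 r = a.1 r

instance (a : Config p) : Decidable (IsMirror a) := by
  unfold IsMirror; infer_instance

/-- The operation `a ↦ ā` (it fixes the elements of `A_{p+1}`, where it is never used). -/
def bar (a : Config p) : Config p :=
  (fun r => if HasPivot a r then -a.1 r else a.1 r,
   fun r => if HasPivot a r then -a.2 r else a.2 r)

/-- `a*_r = a_r a_{r+1} ⋯ a_p` and `a*_{-r} = a_{-r} a_{-r-1} ⋯ a_{-p}`. -/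
def starOp (a : Config p) : Config p :=
  (fun r => ∏ s ∈ Finset.Ici r, a.1 s, fun r => ∏ s ∈ Finset.Ici r, a.2 s)

/-- The integer `a*_r + a*_{-r}`. -/
def starSum (a : Config p) (r : Fin p) : ℤ := ((starOp a).1 r : ℤ) + ((starOp a).2 r : ℤ)

/-- The integer `a*_r - a*_{-r}`. -/
def starDiff (a : Config p) (r : Fin p) : ℤ := ((starOp a).1 r : ℤ) - ((starOp a).2 r : ℤ)

/-- `θ(b) = (1 + b) / 2`. -/
def theta (b : ℤˣ) : ℕ := if b = 1 then 1 else 0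

/-- `Φ_c = ∑_r γ_r (c*_r - c*_{-r})`. -/
def Phi (γ : Fin p → ℝ) (c : Config p) : ℝ := ∑ r, γ r * (starDiff c r : ℝ)

/-- `Q_a = ∏_j (cos β_j)^{θ(a_j)+θ(a_{-j})} (sin β_j)^{θ(-a_j)+θ(-a_{-j})}
i^{θ(-a_j)-θ(-a_{-j})}`. -/
def Q (β : Fin p → ℝ) (a : Config p) : ℂ :=
  ∏ j, (Real.cos (β j) : ℂ) ^ (theta (a.1 j) + theta (a.2 j)) *
    (Real.sin (β j) : ℂ) ^ (theta (-a.1 j) + theta (-a.2 j)) *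
    Complex.I ^ ((theta (-a.1 j) : ℤ) - (theta (-a.2 j) : ℤ))

/-- `F_b = exp[-½ ∑_{a ∈ A_{p+1}} Q_a Φ_{ab}²]`. -/
def F (γ β : Fin p → ℝ) (b : Config p) : ℂ :=
  Complex.exp (-(1 / 2) * ∑ a : Config p with IsMirror a, Q β a * (Phi γ (a * b) : ℂ) ^ 2)

/-- `X_b = Q_b F_b`. -/
def X (γ β : Fin p → ℝ) (b : Config p) : ℂ := Q β b * F γ β b

/-- `K_{b,c} = ½ X_b (Φ_{b̄c}² - Φ_{bc}²)`. -/
def K (γ β : Fin p → ℝ) (b c : Config p) : ℂ :=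
  1 / 2 * X γ β b * ((Phi γ (bar b * c) : ℂ) ^ 2 - (Phi γ (b * c) : ℂ) ^ 2)

/-- `b` plays well with `c`. -/
def PlaysWell (γ : Fin p → ℝ) (b c : Config p) : Prop :=
  Phi γ (bar b * c) ^ 2 = Phi γ (b * c) ^ 2

/-- The list `D` has no repetitions and contains exactly one of `b`, `b̄` for every
`b ∈ B = A ∖ A_{p+1}`, and nothing else. The position of `b` in `D` is its index. -/
def IsHalf (D : List (Config p)) : Prop :=
  D.Nodup ∧ (∀ b ∈ D, ¬ IsMirror b) ∧ ∀ b, ¬ IsMirror b → (b ∈ D ↔ bar b ∉ D)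

/-- The indexing of `D` is admissible: an element plays well with those of larger index. -/
def IsIndexing (γ : Fin p → ℝ) (D : List (Config p)) : Prop :=
  IsHalf D ∧ D.Pairwise (PlaysWell γ)

/-- The array `R` at the end of the iteration: it starts as `R_j = 1`, and for
`s = |D|, …, 3, 2` every `R_j` is replaced by `R_j exp(R_s K_{s,j})`. -/
def R (γ β : Fin p → ℝ) (D : List (Config p)) : Config p → ℂ :=
  D.tail.reverse.foldl (fun R s j => R j * Complex.exp (R s * K γ β s j)) (fun _ => 1)

/-- `Y_u = exp[∑_{j ∈ D} R_j K_{j,u}]`. -/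
def Y (γ β : Fin p → ℝ) (D : List (Config p)) (u : Config p) : ℂ :=
  Complex.exp (D.map fun j => R γ β D j * K γ β j u).sum

/-- `W_u = X_u Y_u`. -/
def W (γ β : Fin p → ℝ) (D : List (Config p)) (u : Config p) : ℂ := X γ β u * Y γ β D u

/-- `(i/2) ∑_r γ_r [∑_u (u*_r + u*_{-r}) W_u] [∑_v (v*_r - v*_{-r}) W_v]`. -/
def V (γ β : Fin p → ℝ) (D : List (Config p)) : ℂ :=
  Complex.I / 2 * ∑ r, (γ r : ℂ) *
    (∑ u, (starSum u r : ℂ) * W γ β D u) * (∑ v, (starDiff v r : ℂ) * W γ β D v)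

/-! ### Sums in the configuration basis -/

/-- The weight of the occupation numbers `(n_a)`:
`binom(n; {n_a}) exp[-(1/4n) ∑_{a,b} Φ_{ab}² n_a n_b] ∏_a Q_a^{n_a}`. -/
def weight (γ β : Fin p → ℝ) (n : ℕ) (N : Config p → ℕ) : ℂ :=
  (Nat.multinomial Finset.univ N : ℂ) *
    ((Real.exp (-(1 / (4 * n)) * ∑ a, ∑ b, Phi γ (a * b) ^ 2 * N a * N b) : ℝ) : ℂ) *
    ∏ a, Q β a ^ N a

/-- `S_{u,v}`, a sum over all `(n_a)` with `∑_a n_a = n`. -/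
def S₂ (γ β : Fin p → ℝ) (u v : Config p) (n : ℕ) : ℂ :=
  ∑ N ∈ Finset.piAntidiag (Finset.univ : Finset (Config p)) n,
    weight γ β n N * ((N u : ℂ) * N v / (n : ℂ) ^ 2)

/-- `S_{u,v,x,y}`. -/
def S₄ (γ β : Fin p → ℝ) (u v x y : Config p) (n : ℕ) : ℂ :=
  ∑ N ∈ Finset.piAntidiag (Finset.univ : Finset (Config p)) n,
    weight γ β n N * ((N u : ℂ) * N v * N x * N y / (n : ℂ) ^ 4)

/-! ### The evaluation procedure with its operation count

The machine has registers that hold complex numbers. An instruction performs one elementary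
operation and costs one step. -/

/-- One elementary operation; the first argument is the register that is overwritten. -/
inductive Instr (ι : Type) where
  | rat (d : ι) (q : ℚ)
  | imag (d : ι)
  | copy (d x : ι)
  | neg (d x : ι)
  | add (d x y : ι)
  | sub (d x y : ι)
  | mul (d x y : ι)
  | exp (d x : ι)
  | cos (d x : ι)
  | sin (d x : ι)

/-- The effect of one instruction on the memory. -/
def Instr.run {ι : Type} [DecidableEq ι] (m : ι → ℂ) : Instr ι → ι → ℂ
  | .rat d q => Function.update m d (q : ℂ)
  | .imag d => Function.update m d Complex.I
  | .copy d x => Function.update m d (m x)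
  | .neg d x => Function.update m d (-m x)
  | .add d x y => Function.update m d (m x + m y)
  | .sub d x y => Function.update m d (m x - m y)
  | .mul d x y => Function.update m d (m x * m y)
  | .exp d x => Function.update m d (Complex.exp (m x))
  | .cos d x => Function.update m d (Complex.cos (m x))
  | .sin d x => Function.update m d (Complex.sin (m x))

/-- Run the instructions one after the other; the number of steps is the length of the list. -/
def exec {ι : Type} [DecidableEq ι] (prog : List (Instr ι)) (m : ι → ℂ) : ι → ℂ :=
  prog.foldl Instr.run m

/-- The registers: `gamma` and `beta` hold the input, `w` and `v` the output. -/
inductive Reg (p : ℕ) where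
  | gamma (r : Fin p)
  | beta (r : Fin p)
  | cosBeta (r : Fin p)
  | sinBeta (r : Fin p)
  | phiSq (c : Config p)
  | q (a : Config p)
  | x (b : Config p)
  | r (j : Config p)
  | w (u : Config p)
  | v
  | tmp
  | acc
  | acc'
deriving DecidableEq

open Instr Reg

/-- The configurations of `A`, in some order. -/
def allConfigs (p : ℕ) : List (Config p) := (Finset.univ : Finset (Config p)).toList

/-- The configurations of `A_{p+1}`, in some order. -/
def symmConfigs (p : ℕ) : List (Config p) := (allConfigs p).filter fun a => IsMirror a

/-- `cos β_r` and `sin β_r` for all `r`. -/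
def progTrig (p : ℕ) : List (Instr (Reg p)) :=
  (List.finRange p).flatMap fun r => [cos (cosBeta r) (beta r), sin (sinBeta r) (beta r)]

/-- `acc := acc * ⟨z|e^{iβB}|1⟩` for one spin `z = b` (or its complex conjugate). -/
def progFactor (r : Fin p) (b : ℤˣ) (conj : Bool) : List (Instr (Reg p)) :=
  if b = 1 then [mul acc acc (cosBeta r)]
  else [mul acc acc (sinBeta r), imag tmp] ++
    (if conj then [neg tmp tmp] else []) ++ [mul acc acc tmp]

/-- `Q_a` for all `a ∈ A`. -/
def progQ (p : ℕ) : List (Instr (Reg p)) :=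
  (allConfigs p).flatMap fun a =>
    [rat acc 1] ++
    ((List.finRange p).flatMap fun r =>
      progFactor r (a.1 r) false ++ progFactor r (a.2 r) true) ++
    [copy (q a) acc]

/-- `Φ_c²` for all `c ∈ A`. -/
def progPhi (p : ℕ) : List (Instr (Reg p)) :=
  (allConfigs p).flatMap fun c =>
    [rat acc 0] ++
    ((List.finRange p).flatMap fun r =>
      [rat tmp (starDiff c r), mul tmp (gamma r) tmp, add acc acc tmp]) ++
    [mul (phiSq c) acc acc]

/-- `X_b = Q_b F_b` for all `b ∈ A`. -/
def progX (p : ℕ) : List (Instr (Reg p)) :=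
  (allConfigs p).flatMap fun b =>
    [rat acc 0] ++
    ((symmConfigs p).flatMap fun a => [mul tmp (q a) (phiSq (a * b)), add acc acc tmp]) ++
    [rat tmp (-1 / 2), mul tmp tmp acc, exp tmp tmp, mul (x b) (q b) tmp]

/-- `tmp := R_b K_{b,c}`; the register `acc'` is overwritten. -/
def progRK (b c : Config p) : List (Instr (Reg p)) :=
  [sub tmp (phiSq (bar b * c)) (phiSq (b * c)), mul tmp (x b) tmp, rat acc' (1 / 2),
    mul tmp acc' tmp, mul tmp (r b) tmp]

/-- Initialize `R_j := 1`; then, for `s = |D|, …, 2`, update `R_j := R_j exp(R_s K_{s,j})` for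
every `j`. -/
def progR (D : List (Config p)) : List (Instr (Reg p)) :=
  (D.map fun j => rat (r j) 1) ++
  D.tail.reverse.flatMap fun s =>
    D.flatMap fun j => progRK s j ++ [exp tmp tmp, mul (r j) (r j) tmp]

/-- `W_u = X_u` for `u ∈ A_{p+1}`; `W_u = X_u Y_u` and `W_ū = -W_u` for `u ∈ D`. -/
def progW (D : List (Config p)) : List (Instr (Reg p)) :=
  ((symmConfigs p).map fun u => copy (w u) (x u)) ++
  D.flatMap fun u =>
    [rat acc 0] ++ (D.flatMap fun j => progRK j u ++ [add acc acc tmp]) ++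
    [exp tmp acc, mul (w u) (x u) tmp, neg (w (bar u)) (w u)]

/-- The value of the formula for `V_p`, from the `W_u`. -/
def progV (p : ℕ) : List (Instr (Reg p)) :=
  [rat v 0] ++
  ((List.finRange p).flatMap fun r =>
    [rat acc 0, rat acc' 0] ++
    ((allConfigs p).flatMap fun u =>
      [rat tmp (starSum u r), mul tmp tmp (w u), add acc acc tmp,
        rat tmp (starDiff u r), mul tmp tmp (w u), add acc' acc' tmp]) ++
    [mul tmp acc acc', mul tmp (gamma r) tmp, add v v tmp]) ++
  [rat tmp (1 / 2), mul v tmp v, imag tmp, mul v tmp v]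

/-- The whole procedure, from the parameters to the `W_u` and `V_p`. -/
def procedure (D : List (Config p)) : List (Instr (Reg p)) :=
  progTrig p ++ progQ p ++ progPhi p ++ progX p ++ progR D ++ progW D ++ progV p

end QAOASK

end

noncomputable section
namespace QAOASK
open MeasureTheory ProbabilityTheory Matrix
variable {p : ℕ}

/-! ### Configurations: pivots, the bar operation and the phases -/

/-! The weights of `b` and `b̄` are opposite (`Q_bar`), while the weights of the mirror
configurations form a probability distribution (`sum_Q_isMirror`). An admissible indexing makes the
quadratic form triangular: in the interaction of two classes, the one of lower index may be
exchanged with its partner. A lower pair therefore acts on the higher classes only through its total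
occupation number `t_i`. Once all `t_i` are fixed, the exponent is linear in the `n_a`
(`PairedSystem.quad_add`), and the multinomial theorem sums every pair and the mirror classes
separately (`PairedSystem.bulkSum_eq`).

Pair `i` then contributes the `t_i`-th power of `q (e^{-x/2n} - e^{-y/2n})`, which is of order
`1/n`; the falling factorial left over from the multinomial coefficient restores the missing power
`n^{∑ t_i}`. The mirror classes give `(1 + O(1/n))^n`, whose limit produces the factors `F`. The
same estimates give a summable majorant independent of `n`, so dominated convergence
(`PairedSystem.tendsto_bulkSum`) leads to the series `∑_t ∏_i (κ_i + ∑_{j<i} K_{ij} t_j)^{t_i} /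
t_i!`, up to a prefactor. Summing over the last `t_s` gives an exponential that is linear in the
other `t_j`. It multiplies the base of the `j`-th power by `exp(R_s K_{s,j})`, and repeating this
from the last index downwards is exactly the iteration for `R` (`hasSum_layerTerm`).

A factor `n_u` is removed by taking one element of class `u` out of the multinomial coefficient. It
becomes part of a fixed background `c`, which enters the limiting exponent linearly; hence moments
converge to products of the `W_u` (`tendsto_momentSum`).

For the energy, bra and ket are expanded over paths of spin strings, so that each site carries one
configuration (`energyDensity_eq`). The Gaussian average of `J e^{itJ}` turns the energy into `∑
Φ_{uv} S_{u,v}` (`integral_energyDensity`), and `V_eq` is the matching identity for `V`. Admissible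
indexings arise by listing the pairs by decreasing pivot (`isIndexing_pivotIndexing`). The procedure
is verified phase by phase, keeping track of the registers that already hold their final value
(`eqOn_procedure`). -/

/-- The two halves of `a` agree at all positions after `r`. -/
def SymmAbove (r : Fin p) (a : Config p) : Prop := ∀ s, r < s → a.2 s = a.1 s

lemma SymmAbove.mul {r : Fin p} {a b : Config p} (ha : SymmAbove r a) (hb : SymmAbove r b) :
    SymmAbove r (a * b) := fun s hs => by
  simp [ha s hs, hb s hs]

lemma IsMirror.symmAbove {a : Config p} (ha : IsMirror a) (r : Fin p) : SymmAbove r a :=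
  fun s _ => ha s

lemma HasPivot.symmAbove {a : Config p} {r : Fin p} (ha : HasPivot a r) : SymmAbove r a := ha.2

lemma SymmAbove.mono {a : Config p} {r s : Fin p} (h : SymmAbove r a) (hrs : r ≤ s) :
    SymmAbove s a := fun t ht => h t (hrs.trans_lt ht)

lemma IsMirror.mul {a b : Config p} (ha : IsMirror a) (hb : IsMirror b) : IsMirror (a * b) :=
  fun s => by simp [ha s, hb s]

lemma isMirror_mul_self (a : Config p) : IsMirror (a * a) := fun s => by
  simp [Int.units_mul_self]

lemma HasPivot.not_isMirror {a : Config p} {r : Fin p} (h : HasPivot a r) : ¬ IsMirror a := by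
  intro hm
  have h1 := h.1
  rw [hm r] at h1
  rcases Int.units_eq_one_or (a.1 r) with h2 | h2 <;> rw [h2] at h1 <;> revert h1 <;> decide

lemma exists_hasPivot {a : Config p} (h : ¬ IsMirror a) : ∃ r, HasPivot a r := by
  classical
  have hne : (Finset.univ.filter fun r => a.2 r ≠ a.1 r).Nonempty := by
    simp only [IsMirror, not_forall] at h
    obtain ⟨r, hr⟩ := h
    exact ⟨r, by simpa using hr⟩
  refine ⟨Finset.max' _ hne, ?_, ?_⟩
  · have := Finset.max'_mem _ hne
    exact Int.units_ne_iff_eq_neg.1 (Finset.mem_filter.1 this).2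
  · intro s hs
    by_contra hc
    exact absurd (Finset.le_max' _ s (by simpa using hc)) (not_le.2 hs)

lemma HasPivot.unique {a : Config p} {r s : Fin p} (hr : HasPivot a r) (hs : HasPivot a s) :
    r = s := by
  have aux : ∀ {r s : Fin p}, HasPivot a r → HasPivot a s → ¬ r < s := by
    intro r s hr hs hlt
    have h1 := hr.2 s hlt
    rw [hs.1] at h1
    rcases Int.units_eq_one_or (a.1 s) with h2 | h2 <;> rw [h2] at h1 <;> revert h1 <;> decide
  exact le_antisymm (not_lt.1 (aux hs hr)) (not_lt.1 (aux hr hs))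

/-- The mirror configuration with entries `-1` exactly at `±r`. -/
def flipAt (r : Fin p) : Config p := (Function.update 1 r (-1), Function.update 1 r (-1))

lemma isMirror_flipAt (r : Fin p) : IsMirror (flipAt r) := fun _ => rfl

lemma flipAt_mul_flipAt (r : Fin p) : flipAt r * flipAt r = 1 := by
  ext s <;> by_cases h : s = r <;> simp [flipAt, h]

lemma bar_eq_flipAt_mul {a : Config p} {r : Fin p} (h : HasPivot a r) :
    bar a = flipAt r * a := by
  have key : ∀ s, HasPivot a s ↔ s = r := fun s => ⟨fun hs => hs.unique h, fun hs => hs ▸ h⟩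
  ext s <;> by_cases hs : s = r <;> simp [bar, flipAt, key, hs]

lemma HasPivot.flipAt_mul {a : Config p} {r : Fin p} (h : HasPivot a r) (s : Fin p) :
    HasPivot (flipAt s * a) r := by
  refine ⟨?_, fun t ht => ?_⟩
  · simp [flipAt, h.1]
  · simp [flipAt, h.2 t ht]

lemma HasPivot.bar {a : Config p} {r : Fin p} (h : HasPivot a r) : HasPivot (bar a) r := by
  rw [bar_eq_flipAt_mul h]; exact h.flipAt_mul r

lemma bar_of_isMirror {a : Config p} (h : IsMirror a) : bar a = a := by
  have key : ∀ s, ¬ HasPivot a s := fun s hs => hs.not_isMirror h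
  ext s <;> simp [QAOASK.bar, key]

lemma bar_bar (a : Config p) : bar (bar a) = a := by
  by_cases h : IsMirror a
  · rw [bar_of_isMirror h, bar_of_isMirror h]
  · obtain ⟨r, hr⟩ := exists_hasPivot h
    rw [bar_eq_flipAt_mul hr.bar, bar_eq_flipAt_mul hr, ← mul_assoc, flipAt_mul_flipAt, one_mul]

lemma not_isMirror_bar {a : Config p} (h : ¬ IsMirror a) : ¬ IsMirror (bar a) := by
  obtain ⟨r, hr⟩ := exists_hasPivot h
  exact hr.bar.not_isMirror

lemma HasPivot.bar_fst {a : Config p} {r : Fin p} (h : HasPivot a r) :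
    (QAOASK.bar a).1 r = -a.1 r := by
  simp [QAOASK.bar, h]

lemma bar_ne_self {a : Config p} (h : ¬ IsMirror a) : bar a ≠ a := by
  obtain ⟨r, hr⟩ := exists_hasPivot h
  intro he
  have h1 := hr.bar_fst
  rw [he] at h1
  rcases Int.units_eq_one_or (a.1 r) with h2 | h2 <;> rw [h2] at h1 <;> revert h1 <;> decide

lemma starOp_mul (a b : Config p) : starOp (a * b) = starOp a * starOp b := by
  ext s <;> simp [starOp, Finset.prod_mul_distrib]

lemma starDiff_eq_zero {r s : Fin p} {a : Config p} (h : SymmAbove r a) (hs : r < s) :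
    starDiff a s = 0 := by
  have : ∏ t ∈ Finset.Ici s, a.2 t = ∏ t ∈ Finset.Ici s, a.1 t :=
    Finset.prod_congr rfl fun t ht => h t (hs.trans_le (Finset.mem_Ici.1 ht))
  simp [starDiff, starOp, this]

lemma IsMirror.starDiff {a : Config p} (h : IsMirror a) (s : Fin p) : starDiff a s = 0 := by
  have : ∏ t ∈ Finset.Ici s, a.2 t = ∏ t ∈ Finset.Ici s, a.1 t :=
    Finset.prod_congr rfl fun t _ => h t
  simp [QAOASK.starDiff, starOp, this]

lemma starDiff_flipAt_mul {r s : Fin p} (hs : s ≤ r) (a : Config p) :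
    starDiff (flipAt r * a) s = -starDiff a s := by
  have h : ∏ t ∈ Finset.Ici s, (Function.update 1 r (-1) : Fin p → ℤˣ) t = -1 := by
    rw [Finset.prod_update_of_mem (by simpa using hs)]
    simp
  simp [starDiff, starOp, flipAt, Finset.prod_mul_distrib, h]
  ring

lemma IsMirror.Phi {a : Config p} (h : IsMirror a) (γ : Fin p → ℝ) : Phi γ a = 0 := by
  simp [QAOASK.Phi, h.starDiff]

/-- The partial products starting at or before `r` contain the position `r` exactly once and change
sign; those starting after `r` agree on the two halves and contribute zero before and after the
flip. -/
lemma Phi_flipAt_mul (γ : Fin p → ℝ) {r : Fin p} {a : Config p} (h : SymmAbove r a) :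
    Phi γ (flipAt r * a) = -Phi γ a := by
  simp only [Phi, ← Finset.sum_neg_distrib]
  refine Finset.sum_congr rfl fun s _ => ?_
  rcases le_or_gt s r with hs | hs
  · rw [starDiff_flipAt_mul hs]; push_cast; ring
  · rw [starDiff_eq_zero h hs, starDiff_eq_zero (((isMirror_flipAt r).symmAbove r).mul h) hs]
    simp

lemma HasPivot.Phi_bar_mul (γ : Fin p → ℝ) {r : Fin p} {b c : Config p} (hb : HasPivot b r)
    (hc : SymmAbove r c) : Phi γ (QAOASK.bar b * c) = -Phi γ (b * c) := by
  rw [bar_eq_flipAt_mul hb, mul_assoc, Phi_flipAt_mul γ (hb.symmAbove.mul hc)]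

/-- The source of all well-played pairs: passing from `b` to `b̄` only changes the sign of the phase
if `c` is symmetric beyond the pivot of `b`. -/
lemma HasPivot.playsWell (γ : Fin p → ℝ) {r : Fin p} {b c : Config p} (hb : HasPivot b r)
    (hc : SymmAbove r c) : PlaysWell γ b c := by
  rw [PlaysWell, hb.Phi_bar_mul γ hc, neg_sq]

lemma playsWell_of_isMirror (γ : Fin p → ℝ) {b c : Config p} (hc : IsMirror c) :
    PlaysWell γ b c := by
  by_cases hb : IsMirror b
  · rw [PlaysWell, bar_of_isMirror hb]
  · obtain ⟨r, hr⟩ := exists_hasPivot hb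
    exact hr.playsWell γ (hc.symmAbove r)

lemma playsWell_self (γ : Fin p → ℝ) (b : Config p) : PlaysWell γ b b := by
  by_cases hb : IsMirror b
  · exact playsWell_of_isMirror γ hb
  · obtain ⟨r, hr⟩ := exists_hasPivot hb
    exact hr.playsWell γ hr.symmAbove

lemma Phi_mul_self (γ : Fin p → ℝ) (b : Config p) : Phi γ (b * b) = 0 :=
  (isMirror_mul_self b).Phi γ

lemma Phi_bar_mul_self (γ : Fin p → ℝ) (b : Config p) : Phi γ (bar b * b) = 0 := by
  have := playsWell_self γ b
  rw [PlaysWell, Phi_mul_self] at this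
  simpa using this

/-- Replacing `c` by `c̄` changes the phases of `bc` and of `b̄c` only in a common way that does
not affect the difference of their squares. -/
lemma Phi_sq_bar_sub (γ : Fin p → ℝ) (b c : Config p) :
    Phi γ (bar b * bar c) ^ 2 - Phi γ (b * bar c) ^ 2 =
      Phi γ (bar b * c) ^ 2 - Phi γ (b * c) ^ 2 := by
  by_cases hb : IsMirror b
  · simp [bar_of_isMirror hb]
  by_cases hc : IsMirror c
  · simp [bar_of_isMirror hc]
  obtain ⟨r, hr⟩ := exists_hasPivot hb
  obtain ⟨s, hs⟩ := exists_hasPivot hc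
  -- If the pivot of `c` is not after that of `b`, then `b` plays well with both `c` and `c̄` and
  -- both sides vanish. Otherwise passing to `c̄` negates the phases of `bc` and of `b̄c`, so all
  -- squares are unchanged.
  rcases le_total s r with h | h
  · have h1 := hr.playsWell γ (hs.symmAbove.mono h)
    have h2 := hr.playsWell γ (hs.bar.symmAbove.mono h)
    rw [PlaysWell] at h1 h2
    rw [h1, h2]; ring
  · rw [mul_comm, mul_comm b, hs.Phi_bar_mul γ (hr.bar.symmAbove.mono h),
      hs.Phi_bar_mul γ (hr.symmAbove.mono h), mul_comm c, mul_comm c]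
    ring

lemma PlaysWell.bar_right {γ : Fin p → ℝ} {b c : Config p} (h : PlaysWell γ b c) :
    PlaysWell γ b (bar c) := by
  have := Phi_sq_bar_sub γ b c
  rw [PlaysWell] at h ⊢
  rw [h] at this
  linarith

/-- At a position with opposite entries there is one cosine, one sine and a factor `i` or `i⁻¹`;
flipping both entries exchanges the latter two, which differ by a sign. -/
lemma prod_theta_bar (x y : ℂ) (b c : ℤˣ) (h : c = -b) :
    x ^ (theta (-b) + theta (-c)) * y ^ (theta (- -b) + theta (- -c)) *
      Complex.I ^ ((theta (- -b) : ℤ) - (theta (- -c) : ℤ)) =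
    -(x ^ (theta b + theta c) * y ^ (theta (-b) + theta (-c)) *
      Complex.I ^ ((theta (-b) : ℤ) - (theta (-c) : ℤ))) := by
  subst h
  have h1 : (-1 : ℤˣ) ≠ 1 := by decide
  rcases Int.units_eq_one_or b with rfl | rfl <;> simp [theta, h1]

lemma Q_bar (β : Fin p → ℝ) {a : Config p} (h : ¬ IsMirror a) : Q β (bar a) = -Q β a := by
  obtain ⟨r, hr⟩ := exists_hasPivot h
  have key : ∀ s, s ≠ r → ¬ HasPivot a s := fun s hs hp => hs (hp.unique hr)
  rw [Q, Q, ← Finset.mul_prod_erase _ _ (Finset.mem_univ r),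
    ← Finset.mul_prod_erase _ _ (Finset.mem_univ r), ← neg_mul]
  congr 1
  · have := prod_theta_bar (Real.cos (β r)) (Real.sin (β r)) (a.1 r) (a.2 r) hr.1
    simpa [bar, hr] using this
  · refine Finset.prod_congr rfl fun s hs => ?_
    simp [bar, key s (Finset.ne_of_mem_erase hs)]

/-- The weight `∏_j |⟨a_j|e^{iβ_jX}|1⟩|²` of one half of a mirror configuration. -/
def mirrorWeight (β : Fin p → ℝ) (b : Fin p → ℤˣ) : ℝ :=
  ∏ j, if b j = 1 then Real.cos (β j) ^ 2 else Real.sin (β j) ^ 2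

lemma mirrorWeight_nonneg (β : Fin p → ℝ) (b : Fin p → ℤˣ) : 0 ≤ mirrorWeight β b :=
  Finset.prod_nonneg fun j _ => by split_ifs <;> positivity

lemma IsMirror.Q_eq {a : Config p} (h : IsMirror a) (β : Fin p → ℝ) :
    Q β a = (mirrorWeight β a.1 : ℂ) := by
  have h1 : (-1 : ℤˣ) ≠ 1 := by decide
  rw [Q, mirrorWeight, Complex.ofReal_prod]
  refine Finset.prod_congr rfl fun j _ => ?_
  rw [h j]
  rcases Int.units_eq_one_or (a.1 j) with h2 | h2 <;> simp [theta, h1, h2]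

lemma sum_mirrorWeight (β : Fin p → ℝ) : ∑ b, mirrorWeight β b = 1 := by
  have h1 : (-1 : ℤˣ) ≠ 1 := by decide
  unfold mirrorWeight
  rw [← Fintype.prod_sum
    (fun (j : Fin p) (b : ℤˣ) => if b = 1 then Real.cos (β j) ^ 2 else Real.sin (β j) ^ 2)]
  refine Finset.prod_eq_one fun j _ => ?_
  rw [show (Finset.univ : Finset ℤˣ) = {1, -1} from rfl, Finset.sum_pair h1.symm]
  simp [h1]

/-- A mirror weight is a product of `cos²` and `sin²`, so the sum factors over the positions. This
normalization is what keeps the `n`-th power of the mirror part bounded. -/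
lemma sum_Q_isMirror (β : Fin p → ℝ) : ∑ a : Config p with IsMirror a, Q β a = 1 := by
  rw [← Complex.ofReal_one, ← sum_mirrorWeight β, Complex.ofReal_sum]
  refine Finset.sum_bij' (fun a _ => a.1) (fun b _ => (b, b)) (by simp) ?_ ?_ (by simp) ?_
  · intro b _
    rw [Finset.mem_filter]
    exact ⟨Finset.mem_univ _, fun _ => rfl⟩
  · intro a ha
    have ha : IsMirror a := by simpa using ha
    ext s <;> simp [ha s]
  · intro a ha
    have ha : IsMirror a := by simpa using ha
    exact ha.Q_eq β

/-! ### Behaviour of `F`, `X`, `K`, `Y`, `W` under the bar operation -/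

lemma F_bar (γ β : Fin p → ℝ) (b : Config p) : F γ β (bar b) = F γ β b := by
  unfold F
  congr 2
  refine Finset.sum_congr rfl fun a ha => ?_
  have h := playsWell_of_isMirror γ (b := b) (c := a) (by simpa using ha)
  rw [PlaysWell] at h
  rw [mul_comm a, mul_comm a]
  norm_cast
  rw [h]

lemma X_bar (γ β : Fin p → ℝ) {b : Config p} (h : ¬ IsMirror b) :
    X γ β (bar b) = -X γ β b := by
  rw [X, X, F_bar, Q_bar β h, neg_mul]

lemma PlaysWell.K_eq_zero {γ : Fin p → ℝ} (β : Fin p → ℝ) {b c : Config p}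
    (h : PlaysWell γ b c) : K γ β b c = 0 := by
  rw [PlaysWell] at h
  rw [K]
  norm_cast
  rw [h]; simp

lemma K_bar_right (γ β : Fin p → ℝ) (b c : Config p) : K γ β b (bar c) = K γ β b c := by
  rw [K, K]
  congr 1
  exact_mod_cast Phi_sq_bar_sub γ b c

lemma Y_of_isMirror (γ β : Fin p → ℝ) (D : List (Config p)) {u : Config p} (h : IsMirror u) :
    Y γ β D u = 1 := by
  simp [Y, (playsWell_of_isMirror γ h).K_eq_zero β]

lemma W_of_isMirror (γ β : Fin p → ℝ) (D : List (Config p)) {u : Config p} (h : IsMirror u) :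
    W γ β D u = X γ β u := by
  rw [W, Y_of_isMirror γ β D h, mul_one]

/-- The sign comes from `X` alone: `Y` sees `u` only through `K` in its second argument, where the
bar is invisible. -/
lemma W_bar (γ β : Fin p → ℝ) (D : List (Config p)) {u : Config p} (h : ¬ IsMirror u) :
    W γ β D (bar u) = -W γ β D u := by
  simp only [W, Y, K_bar_right, X_bar γ β h, neg_mul]

/-! ### Existence of admissible indexings -/

/-- The configurations with pivot `r` and entry `1` there. -/
def pivotLayer (r : Fin p) : List (Config p) :=
  (allConfigs p).filter fun a => HasPivot a r ∧ a.1 r = 1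

lemma mem_allConfigs (a : Config p) : a ∈ allConfigs p := by simp [allConfigs]

lemma mem_pivotLayer {r : Fin p} {a : Config p} :
    a ∈ pivotLayer r ↔ HasPivot a r ∧ a.1 r = 1 := by
  simp [pivotLayer, mem_allConfigs]

/-- One configuration of each pair `b, b̄`, by decreasing pivot. -/
def pivotIndexing (p : ℕ) : List (Config p) :=
  (List.finRange p).reverse.flatMap pivotLayer

lemma HasPivot.mem_pivotIndexing {r : Fin p} {a : Config p} (h : HasPivot a r) :
    a ∈ pivotIndexing p ↔ a.1 r = 1 := by
  simp only [pivotIndexing, List.mem_flatMap, List.mem_reverse, List.mem_finRange, true_and,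
    mem_pivotLayer]
  constructor
  · rintro ⟨s, hs, h1⟩
    rwa [h.unique hs]
  · exact fun h1 => ⟨r, h, h1⟩

/-- With decreasing pivots, every later element has its pivot at or before that of an earlier one
and is therefore symmetric beyond it. This involves no property of `γ`. -/
lemma isIndexing_pivotIndexing (γ : Fin p → ℝ) : IsIndexing γ (pivotIndexing p) := by
  have hrev : (List.finRange p).reverse.Pairwise (fun r s => s < r) := by
    rw [List.pairwise_reverse]
    exact List.pairwise_lt_finRange p
  refine ⟨⟨?_, ?_, ?_⟩, ?_⟩
  · refine List.nodup_flatMap.2 ⟨fun r _ => (Finset.nodup_toList _).filter _, hrev.imp ?_⟩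
    intro r s hrs a ha hb
    rw [mem_pivotLayer] at ha hb
    exact hrs.ne (hb.1.unique ha.1)
  · intro b hb
    obtain ⟨r, -, hr⟩ := List.mem_flatMap.1 hb
    exact (mem_pivotLayer.1 hr).1.not_isMirror
  · intro b hb
    obtain ⟨r, hr⟩ := exists_hasPivot hb
    rw [hr.mem_pivotIndexing, hr.bar.mem_pivotIndexing, hr.bar_fst]
    rcases Int.units_eq_one_or (b.1 r) with h2 | h2 <;> rw [h2] <;> decide
  · rw [pivotIndexing, List.pairwise_flatMap]
    refine ⟨fun r _ => ?_, hrev.imp fun {r s} hsr a ha b hb => ?_⟩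
    · refine List.pairwise_of_forall_mem_list fun a ha b hb => ?_
      rw [mem_pivotLayer] at ha hb
      exact ha.1.playsWell γ hb.1.symmAbove
    · rw [mem_pivotLayer] at ha hb
      exact ha.1.playsWell γ (hb.1.symmAbove.mono hsr.le)

/-! ### Multinomial sums -/

section Multinomial

set_option linter.unusedSectionVars false

variable {A B : Type*} [Fintype A] [DecidableEq A] [Fintype B] [DecidableEq B]

/-- The occupation numbers of the fibres of `π`. -/
def fiberCount (π : A → B) (N : A → ℕ) (b : B) : ℕ := ∑ a with π a = b, N a

lemma sum_fiberCount (π : A → B) (N : A → ℕ) : ∑ b, fiberCount π N b = ∑ a, N a :=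
  Finset.sum_fiberwise _ _ _

lemma mem_piAntidiag_univ {n : ℕ} {N : A → ℕ} :
    N ∈ Finset.piAntidiag Finset.univ n ↔ ∑ a, N a = n := by simp

/-- Identities resolved by occupation numbers are obtained below by comparing coefficients of
polynomials with one indeterminate per class. -/
lemma coeff_C_mul_prod_X_pow (S T : B → ℕ) (c : ℂ) :
    MvPolynomial.coeff (Finsupp.equivFunOnFinite.symm T)
      (MvPolynomial.C c * ∏ b, MvPolynomial.X b ^ S b) = if S = T then c else 0 := by
  have h : MvPolynomial.C c * ∏ b, (MvPolynomial.X b : MvPolynomial B ℂ) ^ S b =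
      MvPolynomial.monomial (Finsupp.equivFunOnFinite.symm S) c := by
    rw [MvPolynomial.monomial_eq, Finsupp.prod_fintype _ _ (by simp)]
    simp
  rw [h, MvPolynomial.coeff_monomial]
  simp

/-- The multinomial theorem, resolved according to the occupation numbers of the fibres. -/
lemma sum_multinomial_of_fiberCount_eq (π : A → B) (y : A → ℂ) (n : ℕ) (T : B → ℕ) :
    ∑ N ∈ Finset.piAntidiag Finset.univ n,
      (if fiberCount π N = T then (Nat.multinomial Finset.univ N : ℂ) * ∏ a, y a ^ N a else 0) =
    if ∑ b, T b = n then
      (Nat.multinomial Finset.univ T : ℂ) * ∏ b, (∑ a with π a = b, y a) ^ T b else 0 := by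
  have h1 : (∑ a, MvPolynomial.C (y a) * (MvPolynomial.X (π a) : MvPolynomial B ℂ)) =
      ∑ b, MvPolynomial.C (∑ a with π a = b, y a) * MvPolynomial.X b := by
    rw [← Finset.sum_fiberwise _ π]
    refine Finset.sum_congr rfl fun b _ => ?_
    rw [map_sum, Finset.sum_mul]
    refine Finset.sum_congr rfl fun a ha => ?_
    rw [(Finset.mem_filter.1 ha).2]
  have h2 := congrArg (fun f => MvPolynomial.coeff (Finsupp.equivFunOnFinite.symm T) (f ^ n)) h1
  simp only [Finset.sum_pow_eq_sum_piAntidiag, MvPolynomial.coeff_sum] at h2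
  have h3 : ∀ N : A → ℕ, (Nat.multinomial Finset.univ N : MvPolynomial B ℂ) *
      ∏ a, (MvPolynomial.C (y a) * (MvPolynomial.X (π a) : MvPolynomial B ℂ)) ^ N a =
      MvPolynomial.C ((Nat.multinomial Finset.univ N : ℂ) * ∏ a, y a ^ N a) *
        ∏ b, MvPolynomial.X b ^ fiberCount π N b := by
    intro N
    have : ∏ a, (MvPolynomial.X (π a) : MvPolynomial B ℂ) ^ N a =
        ∏ b, MvPolynomial.X b ^ fiberCount π N b := by
      rw [← Finset.prod_fiberwise _ π]
      refine Finset.prod_congr rfl fun b _ => ?_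
      rw [fiberCount, ← Finset.prod_pow_eq_pow_sum]
      refine Finset.prod_congr rfl fun a ha => ?_
      rw [(Finset.mem_filter.1 ha).2]
    rw [← this]
    simp only [mul_pow, Finset.prod_mul_distrib, map_mul, map_prod, map_pow, map_natCast, mul_assoc]
  have h4 : ∀ S : B → ℕ, (Nat.multinomial Finset.univ S : MvPolynomial B ℂ) *
      ∏ b, (MvPolynomial.C (∑ a with π a = b, y a) * (MvPolynomial.X b : MvPolynomial B ℂ)) ^ S b =
      MvPolynomial.C ((Nat.multinomial Finset.univ S : ℂ) *
        ∏ b, (∑ a with π a = b, y a) ^ S b) * ∏ b, MvPolynomial.X b ^ S b := by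
    intro S
    simp only [mul_pow, Finset.prod_mul_distrib, map_mul, map_prod, map_pow, map_natCast, mul_assoc]
  simp only [h3, h4, coeff_C_mul_prod_X_pow] at h2
  rw [h2, Finset.sum_ite_eq']
  simp only [mem_piAntidiag_univ]

/-- The weights may depend on the fibre counts, since these are fixed before the multinomial theorem
is applied. This is what later permits exponents that are quadratic in the occupation numbers. -/
lemma sum_multinomial_fiberCount (π : A → B) (y : (B → ℕ) → A → ℂ) (n : ℕ) :
    ∑ N ∈ Finset.piAntidiag Finset.univ n,
      (Nat.multinomial Finset.univ N : ℂ) * ∏ a, y (fiberCount π N) a ^ N a =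
    ∑ T ∈ Finset.piAntidiag Finset.univ n,
      (Nat.multinomial Finset.univ T : ℂ) * ∏ b, (∑ a with π a = b, y T a) ^ T b := by
  have h : ∀ N ∈ Finset.piAntidiag (Finset.univ : Finset A) n,
      (Nat.multinomial Finset.univ N : ℂ) * ∏ a, y (fiberCount π N) a ^ N a =
      ∑ T ∈ Finset.piAntidiag Finset.univ n, if fiberCount π N = T then
        (Nat.multinomial Finset.univ N : ℂ) * ∏ a, y T a ^ N a else 0 := by
    intro N hN
    rw [Finset.sum_ite_eq, if_pos]
    rw [mem_piAntidiag_univ] at hN ⊢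
    rw [sum_fiberCount, hN]
  rw [Finset.sum_congr rfl h, Finset.sum_comm]
  refine Finset.sum_congr rfl fun T hT => ?_
  rw [sum_multinomial_of_fiberCount_eq, if_pos (mem_piAntidiag_univ.1 hT)]

/-! ### Words and their occupation numbers -/

/-- The number of times that `f` takes the value `a`. -/
def valueCount {n : ℕ} (f : Fin n → A) (a : A) : ℕ := (Finset.univ.filter fun i => f i = a).card

lemma prod_valueCount {n : ℕ} {M : Type*} [CommMonoid M] (f : Fin n → A) (y : A → M) :
    ∏ i, y (f i) = ∏ a, y a ^ valueCount f a := by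
  rw [← Finset.prod_fiberwise _ f]
  refine Finset.prod_congr rfl fun a _ => ?_
  rw [valueCount, ← Finset.prod_const]
  refine Finset.prod_congr rfl fun i hi => ?_
  rw [(Finset.mem_filter.1 hi).2]

lemma sum_valueCount_mul {n : ℕ} {M : Type*} [CommSemiring M] (f : Fin n → A) (y : A → M) :
    ∑ i, y (f i) = ∑ a, valueCount f a * y a := by
  rw [← Finset.sum_fiberwise _ f]
  refine Finset.sum_congr rfl fun a _ => ?_
  rw [valueCount, ← nsmul_eq_mul, ← Finset.sum_const]
  refine Finset.sum_congr rfl fun i hi => ?_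
  rw [(Finset.mem_filter.1 hi).2]

/-- Coefficient comparison in `(∑ X_a)^n`, expanded over words and by the multinomial theorem. -/
lemma card_valueCount_eq (n : ℕ) (N : A → ℕ) :
    ∑ f : Fin n → A, (if valueCount f = N then (1 : ℂ) else 0) =
      if ∑ a, N a = n then (Nat.multinomial Finset.univ N : ℂ) else 0 := by
  have h1 := Finset.sum_pow_eq_sum_piAntidiag Finset.univ
    (fun a => (MvPolynomial.X a : MvPolynomial A ℂ)) n
  rw [Fintype.sum_pow] at h1
  have h2 := congrArg (fun f => MvPolynomial.coeff (Finsupp.equivFunOnFinite.symm N) f) h1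
  have h3 : ∀ f : Fin n → A, ∏ i, (MvPolynomial.X (f i) : MvPolynomial A ℂ) =
      MvPolynomial.C 1 * ∏ a, MvPolynomial.X a ^ valueCount f a := by
    intro f
    rw [prod_valueCount f (fun a => (MvPolynomial.X a : MvPolynomial A ℂ))]
    simp
  have h4 : ∀ S : A → ℕ, (Nat.multinomial Finset.univ S : MvPolynomial A ℂ) =
      MvPolynomial.C (Nat.multinomial Finset.univ S : ℂ) := by simp
  simp only [MvPolynomial.coeff_sum, h3, h4, coeff_C_mul_prod_X_pow] at h2
  rw [h2, Finset.sum_ite_eq']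
  simp only [mem_piAntidiag_univ]

/-- A sum over words that depends only on the occupation numbers. -/
lemma sum_valueCount (n : ℕ) (G : (A → ℕ) → ℂ) :
    ∑ f : Fin n → A, G (valueCount f) =
      ∑ N ∈ Finset.piAntidiag Finset.univ n, (Nat.multinomial Finset.univ N : ℂ) * G N := by
  have h : ∀ f : Fin n → A, G (valueCount f) =
      ∑ N ∈ Finset.piAntidiag Finset.univ n, (if valueCount f = N then (1 : ℂ) else 0) * G N := by
    intro f
    simp only [ite_mul, one_mul, zero_mul]
    rw [Finset.sum_ite_eq, if_pos]
    rw [mem_piAntidiag_univ]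
    simpa using (sum_valueCount_mul f (fun _ => (1 : ℕ))).symm
  rw [Finset.sum_congr rfl fun f _ => h f, Finset.sum_comm]
  refine Finset.sum_congr rfl fun N hN => ?_
  rw [← Finset.sum_mul, card_valueCount_eq, if_pos (mem_piAntidiag_univ.1 hN)]

/-- Removing one element from the class `u`. -/
lemma sum_multinomial_mul_apply (n : ℕ) (u : A) (g : (A → ℕ) → ℂ) :
    ∑ N ∈ Finset.piAntidiag Finset.univ (n + 1),
      (Nat.multinomial Finset.univ N : ℂ) * ((N u : ℂ) * g N) =
    (n + 1) * ∑ N ∈ Finset.piAntidiag Finset.univ n,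
      (Nat.multinomial Finset.univ N : ℂ) * g (N + Pi.single u 1) := by
  have hm : ∀ N : A → ℕ, ∑ a, N a = n →
      (Nat.multinomial Finset.univ (N + Pi.single u 1) : ℂ) * ((N + Pi.single u 1 : A → ℕ) u : ℕ) =
        (n + 1) * (Nat.multinomial Finset.univ N : ℂ) := by
    intro N hN
    have e1 := Nat.multinomial_spec Finset.univ N
    have e2 := Nat.multinomial_spec Finset.univ (N + Pi.single u 1)
    have e3 : ∏ a, ((N + Pi.single u 1 : A → ℕ) a).factorial = (N u + 1) * ∏ a, (N a).factorial := by
      rw [← Finset.mul_prod_erase _ _ (Finset.mem_univ u),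
        ← Finset.mul_prod_erase _ (fun a => (N a).factorial) (Finset.mem_univ u), ← mul_assoc]
      congr 1
      · simp [Nat.factorial_succ]
      · refine Finset.prod_congr rfl fun a ha => ?_
        simp [Finset.ne_of_mem_erase ha]
    have e4 : ∑ a, (N + Pi.single u 1 : A → ℕ) a = n + 1 := by
      simp [Finset.sum_add_distrib, hN]
    rw [e4, e3, Nat.factorial_succ] at e2
    rw [hN] at e1
    have e5 : 0 < ∏ a, (N a).factorial := Finset.prod_pos fun a _ => Nat.factorial_pos _
    have : Nat.multinomial Finset.univ (N + Pi.single u 1) * (N u + 1) =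
        (n + 1) * Nat.multinomial Finset.univ N := by
      apply Nat.eq_of_mul_eq_mul_left e5
      rw [← e1] at e2
      linarith
    have h2 : (N + Pi.single u 1 : A → ℕ) u = N u + 1 := by simp
    rw [h2]
    exact_mod_cast this
  rw [Finset.mul_sum]
  symm
  -- Summands with `N u = 0` vanish, so the shift by one element of class `u` only has to reach the
  -- others.
  refine Finset.sum_bij_ne_zero (fun N _ _ => N + Pi.single u 1) ?_ ?_ ?_ ?_
  · intro N hN _
    rw [mem_piAntidiag_univ] at hN ⊢
    simp [Finset.sum_add_distrib, hN]
  · intro N _ _ N' _ _ h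
    exact add_right_cancel h
  · intro N hN h0
    have hu : N u ≠ 0 := by
      rintro h
      simp [h] at h0
    have hs : (N - Pi.single u 1 : A → ℕ) + Pi.single u 1 = N := by
      funext a
      by_cases ha : a = u
      · subst ha; simp; omega
      · simp [ha]
    have hn : ∑ a, (N - Pi.single u 1 : A → ℕ) a = n := by
      rw [mem_piAntidiag_univ, ← hs] at hN
      simpa [Finset.sum_add_distrib] using hN
    refine ⟨N - Pi.single u 1, mem_piAntidiag_univ.2 hn, ?_, hs⟩
    rw [← mul_assoc, ← hm _ hn, hs, mul_assoc]
    exact h0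
  · intro N hN _
    rw [← mul_assoc, ← hm _ (mem_piAntidiag_univ.1 hN), mul_assoc]

end Multinomial

/-! ### A series that is summed layer by layer -/

section Series

variable {α : Type*}

/-- One step of the iteration that computes `R`. -/
def sweepStep (k : α → α → ℂ) (ρ : α → ℂ) (s : α) : α → ℂ :=
  fun j => ρ j * Complex.exp (ρ s * k s j)

lemma foldl_sweepStep_apply (k : α → α → ℂ) (L : List α) (j : α) (h : ∀ s ∈ L, k s j = 0)
    (ρ : α → ℂ) : L.foldl (sweepStep k) ρ j = ρ j := by
  induction L generalizing ρ with
  | nil => rfl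
  | cons s L ih =>
    rw [List.foldl_cons, ih (fun t ht => h t (by simp [ht]))]
    simp [sweepStep, h s (by simp)]

/-- The summand for the occupation numbers `t`. -/
def layerTerm {m : ℕ} (k : Fin m → Fin m → ℂ) (ρ κ : Fin m → ℂ) (t : Fin m → ℕ) : ℂ :=
  ∏ s, (ρ s * (κ s + ∑ j with j < s, k s j * t j)) ^ t s / (t s).factorial

/-- An index couples only to strictly smaller ones, so the last occupation number appears in its own
factor and nowhere else. -/
lemma layerTerm_snoc {m : ℕ} (k : Fin (m + 1) → Fin (m + 1) → ℂ) (ρ κ : Fin (m + 1) → ℂ)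
    (t : Fin m → ℕ) (x : ℕ) :
    layerTerm k ρ κ (Fin.snoc (α := fun _ => ℕ) t x) =
      layerTerm (fun i j => k i.castSucc j.castSucc) (fun i => ρ i.castSucc)
        (fun i => κ i.castSucc) t *
      ((ρ (Fin.last m) * (κ (Fin.last m) + ∑ j : Fin m, k (Fin.last m) j.castSucc * t j)) ^ x /
        x.factorial) := by
  unfold layerTerm
  rw [Fin.prod_univ_castSucc]
  have h1 : ∀ s : Fin m, ∑ j with j < s.castSucc, k s.castSucc j *
      ((Fin.snoc (α := fun _ => ℕ) t x j : ℕ) : ℂ) =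
      ∑ j with j < s, k s.castSucc j.castSucc * t j := by
    intro s
    rw [Finset.sum_filter, Fin.sum_univ_castSucc, Finset.sum_filter]
    simp [Fin.le_last]
  have h2 : ∑ j with j < Fin.last m, k (Fin.last m) j *
      ((Fin.snoc (α := fun _ => ℕ) t x j : ℕ) : ℂ) =
      ∑ j : Fin m, k (Fin.last m) j.castSucc * t j := by
    rw [Finset.sum_filter, Fin.sum_univ_castSucc]
    simp [Fin.castSucc_lt_last]
  simp only [Fin.snoc_castSucc, Fin.snoc_last, h1, h2]

/-- An exponential linear in `t` is absorbed into the bases of the powers; each step of the `R`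
iteration is one such absorption. -/
lemma layerTerm_mul_exp {m : ℕ} (k : Fin m → Fin m → ℂ) (ρ κ l : Fin m → ℂ) (t : Fin m → ℕ) :
    layerTerm k ρ κ t * Complex.exp (∑ j, l j * t j) =
      layerTerm k (fun s => ρ s * Complex.exp (l s)) κ t := by
  unfold layerTerm
  rw [Complex.exp_sum, ← Finset.prod_mul_distrib]
  refine Finset.prod_congr rfl fun s _ => ?_
  rw [mul_comm (l s), Complex.exp_nat_mul]
  simp only [mul_pow]
  ring

/-- The equivalence that splits off the last occupation number. -/
def snocEquivProd (m : ℕ) : (Fin m → ℕ) × ℕ ≃ (Fin (m + 1) → ℕ) :=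
  (Equiv.prodComm _ _).trans (Fin.snocEquiv fun _ => ℕ)

lemma snocEquivProd_apply {m : ℕ} (x : (Fin m → ℕ) × ℕ) :
    snocEquivProd m x = Fin.snoc (α := fun _ => ℕ) x.1 x.2 := rfl

lemma hasSum_pow_div_factorial (z : ℂ) :
    HasSum (fun n : ℕ => z ^ n / (n.factorial : ℂ)) (Complex.exp z) := by
  rw [Complex.exp_eq_exp_ℂ]
  exact NormedSpace.expSeries_div_hasSum_exp z

/-- For nonnegative data, summability of the iterated sums suffices. The innermost sum, over the
last occupation number, is an exponential series, and what remains has the same form with one index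
fewer and new `ρ`. -/
lemma summable_layerTerm_real {m : ℕ} (k : Fin m → Fin m → ℝ) (ρ κ : Fin m → ℝ)
    (hk : ∀ i j, 0 ≤ k i j) (hρ : ∀ i, 0 ≤ ρ i) (hκ : ∀ i, 0 ≤ κ i) :
    Summable fun t : Fin m → ℕ =>
      ∏ s, (ρ s * (κ s + ∑ j with j < s, k s j * t j)) ^ t s / ((t s).factorial : ℝ) := by
  induction m with
  | zero => exact Summable.of_finite
  | succ m ih =>
    -- The terms are viewed as complex so that the identities for `layerTerm` apply.
    have hc : ∀ t : Fin (m + 1) → ℕ, layerTerm (fun i j => (k i j : ℂ)) (fun i => (ρ i : ℂ))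
        (fun i => (κ i : ℂ)) t = ((∏ s, (ρ s * (κ s + ∑ j with j < s, k s j * t j)) ^ t s /
          ((t s).factorial : ℝ) : ℝ) : ℂ) := by
      intro t; simp [layerTerm]
    have hnn : ∀ t : Fin (m + 1) → ℕ, 0 ≤ ∏ s, (ρ s * (κ s + ∑ j with j < s, k s j * t j)) ^
        t s / ((t s).factorial : ℝ) := fun t => Finset.prod_nonneg fun s _ => by
      have := hρ s
      have := hκ s
      have : 0 ≤ ∑ j with j < s, k s j * (t j : ℝ) :=
        Finset.sum_nonneg fun j _ => mul_nonneg (hk _ _) (Nat.cast_nonneg _)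
      positivity
    refine (snocEquivProd m).summable_iff.1 ((summable_prod_of_nonneg fun x => hnn _).2 ?_)
    have key : ∀ t : Fin m → ℕ, HasSum (fun x : ℕ => ((∏ s, (ρ s * (κ s + ∑ j with j < s,
        k s j * snocEquivProd m (t, x) j)) ^ snocEquivProd m (t, x) s /
          ((snocEquivProd m (t, x) s).factorial : ℝ) : ℝ) : ℂ))
        ((Real.exp (ρ (Fin.last m) * κ (Fin.last m)) * ∏ s : Fin m, (ρ s.castSucc *
          Real.exp (ρ (Fin.last m) * k (Fin.last m) s.castSucc) *
          (κ s.castSucc + ∑ j with j < s, k s.castSucc j.castSucc * t j)) ^ t s /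
          ((t s).factorial : ℝ) : ℝ) : ℂ) := by
      intro t
      have h1 := (hasSum_pow_div_factorial ((ρ (Fin.last m) : ℂ) * (κ (Fin.last m) +
        ∑ j : Fin m, (k (Fin.last m) j.castSucc : ℂ) * t j))).mul_left
        (layerTerm (fun i j : Fin m => (k i.castSucc j.castSucc : ℂ))
          (fun i => (ρ i.castSucc : ℂ)) (fun i => (κ i.castSucc : ℂ)) t)
      have h2 : layerTerm (fun i j : Fin m => (k i.castSucc j.castSucc : ℂ))
          (fun i => (ρ i.castSucc : ℂ)) (fun i => (κ i.castSucc : ℂ)) t *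
          Complex.exp ((ρ (Fin.last m) : ℂ) * (κ (Fin.last m) +
            ∑ j : Fin m, (k (Fin.last m) j.castSucc : ℂ) * t j)) =
          Complex.exp ((ρ (Fin.last m) : ℂ) * κ (Fin.last m)) *
          layerTerm (fun i j : Fin m => (k i.castSucc j.castSucc : ℂ)) (fun i =>
            (ρ i.castSucc : ℂ) * Complex.exp ((ρ (Fin.last m) : ℂ) * k (Fin.last m) i.castSucc))
            (fun i => (κ i.castSucc : ℂ)) t := by
        rw [mul_add, Complex.exp_add, Finset.mul_sum, mul_left_comm]
        simp only [← mul_assoc (ρ (Fin.last m) : ℂ)]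
        rw [layerTerm_mul_exp]
      rw [h2] at h1
      simp only [← hc, snocEquivProd_apply, layerTerm_snoc]
      simpa [layerTerm] using h1
    refine ⟨fun t => ?_, ?_⟩
    · exact (Complex.hasSum_ofReal.1 (key t)).summable
    · simp only [fun t => (Complex.hasSum_ofReal.1 (key t)).tsum_eq]
      exact (ih _ _ _ (fun i j => hk _ _) (fun i => mul_nonneg (hρ _) (Real.exp_nonneg _))
        (fun i => hκ _)).mul_left _

lemma summable_layerTerm {m : ℕ} (k : Fin m → Fin m → ℂ) (ρ κ : Fin m → ℂ) :
    Summable fun t : Fin m → ℕ => layerTerm k ρ κ t := by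
  refine Summable.of_norm_bounded (summable_layerTerm_real (fun i j => ‖k i j‖) (fun i => ‖ρ i‖)
    (fun i => ‖κ i‖) (fun _ _ => norm_nonneg _) (fun _ => norm_nonneg _)
    (fun _ => norm_nonneg _)) fun t => ?_
  rw [layerTerm, norm_prod]
  refine Finset.prod_le_prod (fun _ _ => norm_nonneg _) fun s _ => ?_
  rw [norm_div, norm_pow, norm_mul, Complex.norm_natCast]
  gcongr
  refine (norm_add_le _ _).trans ?_
  gcongr
  refine (norm_sum_le _ _).trans (Finset.sum_le_sum fun j _ => ?_)
  simp

lemma tsum_snocEquivProd {m : ℕ} {f : (Fin (m + 1) → ℕ) → ℂ} (hf : Summable f) :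
    ∑' t, f t = ∑' t, ∑' x, f (snocEquivProd m (t, x)) := by
  rw [← (snocEquivProd m).tsum_eq]
  have h : Summable (f ∘ snocEquivProd m) := (snocEquivProd m).summable_iff.2 hf
  exact h.tsum_prod

/-- The value of the series. -/
lemma hasSum_layerTerm {m : ℕ} (d : Fin m → α) (k : α → α → ℂ)
    (hk : ∀ i j, i ≤ j → k (d i) (d j) = 0) (ρ : α → ℂ) (κ : Fin m → ℂ) :
    HasSum (layerTerm (fun i j => k (d i) (d j)) (fun i => ρ (d i)) κ)
      (Complex.exp (∑ s, (List.ofFn d).reverse.foldl (sweepStep k) ρ (d s) * κ s)) := by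
  refine (summable_layerTerm _ _ _).hasSum_iff.2 ?_
  induction m generalizing ρ with
  | zero => simp [layerTerm, tsum_fintype]
  | succ m ih =>
    rw [tsum_snocEquivProd (summable_layerTerm _ _ _)]
    -- Summing out the last index performs one sweep with that index as source.
    have h1 : ∀ t : Fin m → ℕ, ∑' x, layerTerm (fun i j => k (d i) (d j)) (fun i => ρ (d i)) κ
        (snocEquivProd m (t, x)) = Complex.exp (ρ (d (Fin.last m)) * κ (Fin.last m)) *
        layerTerm (fun i j : Fin m => k (d i.castSucc) (d j.castSucc))
          (fun i => sweepStep k ρ (d (Fin.last m)) (d i.castSucc)) (fun i => κ i.castSucc) t := by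
      intro t
      simp only [snocEquivProd_apply, layerTerm_snoc]
      rw [tsum_mul_left, (hasSum_pow_div_factorial _).tsum_eq, mul_add, Complex.exp_add,
        Finset.mul_sum, mul_left_comm]
      simp only [← mul_assoc (ρ (d (Fin.last m)))]
      rw [layerTerm_mul_exp]
      rfl
    rw [tsum_congr h1, tsum_mul_left, ih (fun i => d i.castSucc)
      (fun i j hij => hk _ _ (Fin.castSucc_le_castSucc_iff.2 hij)), ← Complex.exp_add,
      Fin.sum_univ_castSucc, add_comm]
    have h2 : (List.ofFn d).reverse =
        d (Fin.last m) :: (List.ofFn fun i : Fin m => d i.castSucc).reverse := by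
      rw [List.ofFn_succ']; simp
    -- All remaining sources have smaller index and do not couple to the last element, whose entry
    -- is thus final.
    rw [h2, List.foldl_cons, foldl_sweepStep_apply k _ (d (Fin.last m))]
    · simp [sweepStep, hk (Fin.last m) (Fin.last m) le_rfl]
    · intro s hs
      obtain ⟨i, rfl⟩ : ∃ i : Fin m, d i.castSucc = s := by simpa [List.mem_ofFn] using hs
      exact hk _ _ (Fin.le_last _)

end Series

/-! ### Elementary limits -/

section Limits

open Filter Topology

/-- The natural subtraction is truncated only for `n < a`, which does not affect the limit. -/
lemma tendsto_natCast_sub_div (a : ℕ) :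
    Tendsto (fun n : ℕ => ((n - a : ℕ) : ℂ) / n) atTop (𝓝 1) := by
  have h : Tendsto (fun n : ℕ => 1 - (a : ℂ) / n) atTop (𝓝 (1 - 0)) :=
    tendsto_const_nhds.sub (tendsto_const_div_atTop_nhds_zero_nat (a : ℂ))
  rw [sub_zero] at h
  refine h.congr' ?_
  filter_upwards [eventually_ge_atTop (a + 1)] with n hn
  have : (n : ℂ) ≠ 0 := by exact_mod_cast (by omega : n ≠ 0)
  rw [Nat.cast_sub (by omega)]
  field_simp

lemma tendsto_descFactorial_div_pow (a s : ℕ) :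
    Tendsto (fun n : ℕ => ((n - a).descFactorial s : ℂ) / (n : ℂ) ^ s) atTop (𝓝 1) := by
  induction s with
  | zero => simp
  | succ s ih =>
    have := (tendsto_natCast_sub_div (a + s)).mul ih
    rw [one_mul] at this
    refine this.congr fun n => ?_
    rw [Nat.descFactorial_succ, pow_succ', Nat.cast_mul, mul_div_mul_comm, Nat.sub_sub]

/-- The derivative of `s ↦ exp (z s)` at `0`, sampled at `s = 1/n`. -/
lemma tendsto_mul_exp_div_sub_one (z : ℂ) :
    Tendsto (fun n : ℕ => (n : ℂ) * (Complex.exp (z / n) - 1)) atTop (𝓝 z) := by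
  have h1 : HasDerivAt (fun s : ℂ => Complex.exp (z * s)) z 0 := by
    have := ((hasDerivAt_id (0 : ℂ)).const_mul z).cexp
    simpa using this
  have h2 := h1.tendsto_slope_zero
  have h3 : Tendsto (fun n : ℕ => ((n : ℂ))⁻¹) atTop (𝓝[≠] 0) := by
    refine tendsto_nhdsWithin_iff.2 ⟨tendsto_inv_atTop_nhds_zero_nat, ?_⟩
    filter_upwards [eventually_ge_atTop 1] with n hn
    simp; omega
  refine (h2.comp h3).congr fun n => ?_
  simp [div_eq_mul_inv]

lemma tendsto_pow_sub_of_tendsto_pow {z : ℕ → ℂ} {l : ℂ} (a : ℕ) (h1 : Tendsto z atTop (𝓝 1))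
    (h : Tendsto (fun n => z n ^ n) atTop (𝓝 l)) :
    Tendsto (fun n => z n ^ (n - a)) atTop (𝓝 l) := by
  have h2 : Tendsto (fun n => z n ^ n / z n ^ a) atTop (𝓝 (l / 1 ^ a)) :=
    h.div (h1.pow a) (by simp)
  rw [one_pow, div_one] at h2
  refine h2.congr' ?_
  filter_upwards [eventually_ge_atTop a, h1.eventually_ne one_ne_zero] with n hn hz
  rw [div_eq_iff (pow_ne_zero _ hz), ← pow_add, Nat.sub_add_cancel hn]

/-- This Lipschitz bound makes the cancellation within a pair quantitative, uniformly in `n`. -/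
lemma abs_exp_neg_sub_exp_neg_le {x y : ℝ} (hx : 0 ≤ x) (hy : 0 ≤ y) :
    |Real.exp (-x) - Real.exp (-y)| ≤ |x - y| := by
  have aux : ∀ {x y : ℝ}, 0 ≤ x → x ≤ y → |Real.exp (-x) - Real.exp (-y)| ≤ |x - y| := by
    intro x y hx hxy
    have h1 : Real.exp (-y) ≤ Real.exp (-x) := Real.exp_le_exp.2 (by linarith)
    have h2 : 1 - (y - x) ≤ Real.exp (-(y - x)) := Real.one_sub_le_exp_neg _
    have h3 : Real.exp (-y) = Real.exp (-x) * Real.exp (-(y - x)) := by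
      rw [← Real.exp_add]; ring_nf
    have h4 : Real.exp (-x) ≤ 1 := Real.exp_le_one_iff.2 (by linarith)
    rw [abs_of_nonneg (by linarith), abs_of_nonpos (by linarith), h3]
    nlinarith [Real.exp_pos (-x)]
  rcases le_total x y with h | h
  · exact aux hx h
  · rw [abs_sub_comm, abs_sub_comm x]; exact aux hy h

end Limits

/-! ### Oscillating multinomial sums with paired classes -/

/-- A finite set of classes with complex weights `q` and a quadratic form `P`. The classes are
partitioned into pairs `rep i`, `opp i` with opposite weights and a rest (of level `⊤`) that carries
a probability. The members of a pair cannot be distinguished by the classes of higher level. -/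
structure PairedSystem (A : Type*) [Fintype A] [DecidableEq A] (m : ℕ) where
  level : A → WithTop (Fin m)
  P : A → A → ℝ
  q : A → ℂ
  wt : A → ℝ
  rep : Fin m → A
  opp : Fin m → A
  P_comm : ∀ a b, P a b = P b a
  P_nonneg : ∀ a b, 0 ≤ P a b
  P_eq_zero : ∀ a b, level a = level b → P a b = 0
  P_congr : ∀ a a' b, level a = level a' → level a ≤ level b → P a b = P a' b
  rep_ne_opp : ∀ i, rep i ≠ opp i
  level_eq_iff : ∀ a (i : Fin m), level a = (i : WithTop (Fin m)) ↔ a = rep i ∨ a = opp i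
  q_opp : ∀ i, q (opp i) = -q (rep i)
  wt_nonneg : ∀ a, 0 ≤ wt a
  q_eq : ∀ a, level a = ⊤ → q a = wt a
  sum_wt : ∑ a with level a = ⊤, wt a = 1

lemma sum_withTop {m : ℕ} {M : Type*} [AddCommMonoid M] (h : WithTop (Fin m) → M) :
    ∑ o, h o = h ⊤ + ∑ i : Fin m, h i :=
  Fintype.sum_option h

lemma prod_withTop {m : ℕ} {M : Type*} [CommMonoid M] (h : WithTop (Fin m) → M) :
    ∏ o, h o = h ⊤ * ∏ i : Fin m, h i :=
  Fintype.prod_option h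

/-- A multinomial sum as a series over the occupation numbers of the classes other than `⊤`. -/
lemma sum_multinomial_withTop {m : ℕ} (g : (Fin m → ℕ) → WithTop (Fin m) → ℂ) (k : ℕ) :
    ∑ T ∈ Finset.piAntidiag (Finset.univ : Finset (WithTop (Fin m))) k,
      (Nat.multinomial Finset.univ T : ℂ) * ∏ o, g (fun i : Fin m => T i) o ^ T o =
    ∑' t : Fin m → ℕ, (k.descFactorial (∑ i, t i) : ℂ) * g t ⊤ ^ (k - ∑ i, t i) *
      ∏ i : Fin m, (g t i ^ t i / (t i).factorial) := by
  classical
  have hT : ∀ T : WithTop (Fin m) → ℕ, T ∈ Finset.piAntidiag Finset.univ k ↔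
      T ⊤ + ∑ i : Fin m, T i = k := by
    intro T
    rw [mem_piAntidiag_univ, sum_withTop]
  -- The restriction of `T` to the pairs determines `T ⊤` as the remainder of `k`. Any `t` that does
  -- not occur has total above `k`, and its falling factorial is zero.
  rw [tsum_eq_sum (s := (Finset.piAntidiag Finset.univ k).image
    fun (T : WithTop (Fin m) → ℕ) (i : Fin m) => T i), Finset.sum_image]
  · refine Finset.sum_congr rfl fun T hTk => ?_
    rw [hT] at hTk
    have hk : k - ∑ i : Fin m, T i = T ⊤ := by omega
    have e1 := Nat.multinomial_spec Finset.univ T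
    rw [prod_withTop, sum_withTop, hTk] at e1
    have e2 := Nat.factorial_mul_descFactorial (n := k) (k := ∑ i : Fin m, T i) (by omega)
    rw [hk, ← e1, mul_assoc] at e2
    have e3 := Nat.eq_of_mul_eq_mul_left (Nat.factorial_pos _) e2
    rw [hk, e3, prod_withTop, Finset.prod_div_distrib]
    have : (∏ i : Fin m, ((T i).factorial : ℂ)) ≠ 0 :=
      Finset.prod_ne_zero_iff.2 fun i _ => by exact_mod_cast Nat.factorial_ne_zero _
    push_cast
    field_simp
  · intro T hTk T' hTk' h
    rw [Finset.mem_coe, hT] at hTk hTk'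
    have h' : ∀ i : Fin m, T i = T' i := fun i => congrFun h i
    have h2 : ∑ i : Fin m, T i = ∑ i : Fin m, T' i := Finset.sum_congr rfl fun i _ => h' i
    funext o
    induction o with
    | top => omega
    | coe i => exact h' i
  · intro t ht
    have : k < ∑ i, t i := by
      by_contra hc
      refine ht (Finset.mem_image.2 ⟨fun o => WithTop.recTopCoe (k - ∑ i, t i) t o, ?_, rfl⟩)
      rw [hT]
      change k - ∑ i, t i + ∑ i, t i = k
      omega
    rw [Nat.descFactorial_of_lt this]
    simp

namespace PairedSystem

open Filter Topology

variable {A : Type*} [Fintype A] [DecidableEq A] {m : ℕ} (S : PairedSystem A m)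

/-- The quadratic form of the occupation numbers `N`. -/
def quad (N : A → ℕ) : ℝ := ∑ a, ∑ b, S.P a b * N a * N b

/-- The linear form `∑_a c_a P_{ab}`. -/
def lin (c : A → ℕ) (b : A) : ℝ := ∑ a, c a * S.P a b

/-- The total coefficient of the occupation number of `b`, when `t` are the occupation numbers of
the pairs and `c` is a fixed background. -/
def load (c : A → ℕ) (t : Fin m → ℕ) (b : A) : ℝ :=
  S.lin c b + ∑ i : Fin m, if (i : WithTop (Fin m)) < S.level b then t i * S.P (S.rep i) b else 0

lemma level_rep (i : Fin m) : S.level (S.rep i) = i := (S.level_eq_iff _ _).2 (Or.inl rfl)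

lemma level_opp (i : Fin m) : S.level (S.opp i) = i := (S.level_eq_iff _ _).2 (Or.inr rfl)

lemma lin_nonneg (c : A → ℕ) (b : A) : 0 ≤ S.lin c b :=
  Finset.sum_nonneg fun a _ => mul_nonneg (Nat.cast_nonneg _) (S.P_nonneg a b)

lemma load_nonneg (c : A → ℕ) (t : Fin m → ℕ) (b : A) : 0 ≤ S.load c t b :=
  add_nonneg (S.lin_nonneg c b) <| Finset.sum_nonneg fun i _ => by
    split_ifs
    · exact mul_nonneg (Nat.cast_nonneg _) (S.P_nonneg _ _)
    · exact le_rfl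

/-- Each interaction is attributed to its class of higher level, for which the two members of a
lower pair are indistinguishable; only their total count remains. Classes of equal level do not
interact. -/
lemma quad_eq (N : A → ℕ) :
    S.quad N = 2 * ∑ b, N b * ∑ i : Fin m, if (i : WithTop (Fin m)) < S.level b then
      (fiberCount S.level N i : ℝ) * S.P (S.rep i) b else 0 := by
  have h1 : ∀ b, (∑ a, if S.level a < S.level b then S.P a b * N a * N b else 0) =
      N b * ∑ i : Fin m, if (i : WithTop (Fin m)) < S.level b then
        (fiberCount S.level N i : ℝ) * S.P (S.rep i) b else 0 := by
    intro b
    rw [← Finset.sum_fiberwise _ S.level, sum_withTop, Finset.mul_sum]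
    have h0 : (∑ a with S.level a = ⊤,
        if S.level a < S.level b then S.P a b * N a * N b else 0) = 0 := by
      refine Finset.sum_eq_zero fun a ha => ?_
      rw [(Finset.mem_filter.1 ha).2]
      simp
    rw [h0, zero_add]
    refine Finset.sum_congr rfl fun i _ => ?_
    by_cases h : (i : WithTop (Fin m)) < S.level b
    · rw [if_pos h, fiberCount, Nat.cast_sum, Finset.sum_mul, Finset.mul_sum]
      refine Finset.sum_congr rfl fun a ha => ?_
      have ha := (Finset.mem_filter.1 ha).2
      rw [if_pos (ha ▸ h), S.P_congr a (S.rep i) b (by rw [ha, level_rep]) (ha ▸ h.le)]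
      ring
    · rw [if_neg h, mul_zero]
      refine Finset.sum_eq_zero fun a ha => ?_
      rw [(Finset.mem_filter.1 ha).2, if_neg h]
  rw [← Finset.sum_congr rfl fun b _ => h1 b, quad]
  have h2 : ∀ a b, S.P a b * N a * N b =
      (if S.level a < S.level b then S.P a b * N a * N b else 0) +
      (if S.level b < S.level a then S.P b a * N b * N a else 0) := by
    intro a b
    rcases lt_trichotomy (S.level a) (S.level b) with h | h | h
    · simp [h, h.not_gt]
    · simp [h, S.P_eq_zero a b h]
    · simp [h, h.not_gt, S.P_comm a b]; ring
  rw [Finset.sum_congr rfl fun a _ => Finset.sum_congr rfl fun b _ => h2 a b]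
  simp only [Finset.sum_add_distrib]
  rw [two_mul, Finset.sum_comm]

/-- For fixed totals of the pairs this is affine in `N`, so the exponential factors over the
individual elements. -/
lemma quad_add (N c : A → ℕ) :
    S.quad (N + c) = S.quad c + 2 * ∑ b, N b * S.load c (fun i => fiberCount S.level N i) b := by
  have h1 : S.quad (N + c) = S.quad N + S.quad c + 2 * ∑ b, N b * S.lin c b := by
    have h2 : ∑ b, N b * S.lin c b = ∑ a, ∑ b, S.P a b * c a * N b := by
      rw [Finset.sum_comm]
      refine Finset.sum_congr rfl fun b _ => ?_
      rw [lin, Finset.mul_sum]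
      exact Finset.sum_congr rfl fun a _ => by ring
    have h3 : ∑ b, N b * S.lin c b = ∑ a, ∑ b, S.P a b * N a * c b := by
      refine Finset.sum_congr rfl fun b _ => ?_
      rw [lin, Finset.mul_sum]
      exact Finset.sum_congr rfl fun a _ => by rw [S.P_comm]; ring
    rw [two_mul]
    nth_rw 1 [h2]
    rw [h3]
    simp only [quad, ← Finset.sum_add_distrib]
    refine Finset.sum_congr rfl fun a _ => Finset.sum_congr rfl fun b _ => ?_
    simp only [Pi.add_apply]
    push_cast
    ring
  rw [h1, quad_eq]
  simp only [load, mul_add, Finset.sum_add_distrib]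
  ring

/-! ### Summation over the members of each level -/

/-- The weighted sum over the occupation numbers `N + c` of total number `n`, with the multinomial
coefficient and the weights of `N`. -/
def bulkSum (n : ℕ) (c : A → ℕ) : ℂ :=
  ∑ N ∈ Finset.piAntidiag Finset.univ (n - ∑ a, c a),
    (Nat.multinomial Finset.univ N : ℂ) *
      ((Real.exp (-(1 / (4 * n)) * S.quad (N + c)) : ℝ) * ∏ a, S.q a ^ N a)

/-- The weight of `b` in the presence of the occupation numbers `t`. -/
def dressed (n : ℕ) (c : A → ℕ) (t : Fin m → ℕ) (b : A) : ℂ :=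
  S.q b * Complex.exp (-(S.load c t b / 2 : ℝ) / n)

/-- The contribution of the occupation numbers `t` of the pairs. -/
def bulkTerm (n : ℕ) (c : A → ℕ) (t : Fin m → ℕ) : ℂ :=
  ((n - ∑ a, c a).descFactorial (∑ i, t i) : ℂ) *
    (∑ b with S.level b = ⊤, S.dressed n c t b) ^ (n - ∑ a, c a - ∑ i, t i) *
    ∏ i : Fin m, ((∑ b with S.level b = i, S.dressed n c t b) ^ t i / (t i).factorial)

/-- With the affine exponent of `quad_add`, every element of class `b` carries the weight `dressed`,
which depends on `N` only through the fibre counts of `level`. The multinomial theorem by fibres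
then applies. -/
lemma bulkSum_eq (n : ℕ) (c : A → ℕ) :
    S.bulkSum n c = (Real.exp (-(1 / (4 * n)) * S.quad c) : ℝ) * ∑' t, S.bulkTerm n c t := by
  have h := sum_multinomial_fiberCount S.level
    (fun T a => S.dressed n c (fun i => T i) a) (n - ∑ a, c a)
  rw [sum_multinomial_withTop
    (fun t o => ∑ b with S.level b = o, S.dressed n c t b)] at h
  unfold bulkTerm
  rw [← h, bulkSum, Finset.mul_sum]
  refine Finset.sum_congr rfl fun N _ => ?_
  refine Eq.trans ?_ (mul_left_comm _ _ _)
  congr 1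
  rw [quad_add, mul_add, Real.exp_add, Complex.ofReal_mul, mul_assoc]
  congr 1
  simp only [dressed, mul_pow, Finset.prod_mul_distrib]
  rw [mul_comm]
  congr 1
  rw [Complex.ofReal_exp, Finset.mul_sum, Finset.mul_sum, Complex.ofReal_sum, Complex.exp_sum]
  refine Finset.prod_congr rfl fun b _ => ?_
  rw [← Complex.exp_nat_mul]
  congr 1
  push_cast
  ring

lemma sum_level_eq (i : Fin m) (f : A → ℂ) :
    ∑ b with S.level b = i, f b = f (S.rep i) + f (S.opp i) := by
  have : (Finset.univ.filter fun b => S.level b = i) = {S.rep i, S.opp i} := by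
    ext b; simp [S.level_eq_iff]
  rw [this, Finset.sum_pair (S.rep_ne_opp i)]

/-- The factor that the classes of level `⊤` contribute to a class `u`. -/
def damping (u : A) : ℂ :=
  Complex.exp (-(1 / 2) * ∑ b with S.level b = ⊤, S.q b * (S.P b u : ℂ))

/-- The coupling of the pair `i` to the class `u`. -/
def coupling (i : Fin m) (u : A) : ℂ :=
  1 / 2 * (S.q (S.rep i) * S.damping (S.rep i)) * ((S.P (S.opp i) u : ℂ) - S.P (S.rep i) u)

/-- Both members lie on the same level and feel the same lower pairs; this difference is all that
survives the cancellation of their opposite weights. -/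
lemma load_opp_sub_load_rep (c : A → ℕ) (t : Fin m → ℕ) (i : Fin m) :
    S.load c t (S.opp i) - S.load c t (S.rep i) =
      (S.lin c (S.opp i) - S.lin c (S.rep i)) +
        ∑ j with j < i, (S.P (S.opp i) (S.rep j) - S.P (S.rep i) (S.rep j)) * t j := by
  simp only [load, level_rep, level_opp, WithTop.coe_lt_coe]
  rw [add_sub_add_comm, ← Finset.sum_sub_distrib, Finset.sum_filter]
  congr 1
  refine Finset.sum_congr rfl fun j _ => ?_
  split_ifs
  · rw [S.P_comm (S.opp i), S.P_comm (S.rep i)]; ring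
  · simp

lemma dressed_rep_add_dressed_opp (n : ℕ) (c : A → ℕ) (t : Fin m → ℕ) (i : Fin m) :
    ∑ b with S.level b = i, S.dressed n c t b =
      S.q (S.rep i) * (Complex.exp (-(S.load c t (S.rep i) / 2 : ℝ) / n) -
        Complex.exp (-(S.load c t (S.opp i) / 2 : ℝ) / n)) := by
  rw [sum_level_eq, dressed, dressed, q_opp]; ring

/-! ### Limits of the individual terms -/

lemma tendsto_mul_pair (c : A → ℕ) (t : Fin m → ℕ) (i : Fin m) :
    Tendsto (fun n : ℕ => (n : ℂ) * ∑ b with S.level b = i, S.dressed n c t b) atTop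
      (𝓝 (S.q (S.rep i) * ((S.load c t (S.opp i) - S.load c t (S.rep i)) / 2))) := by
  have h := ((tendsto_mul_exp_div_sub_one (-(S.load c t (S.rep i) / 2 : ℝ))).sub
    (tendsto_mul_exp_div_sub_one (-(S.load c t (S.opp i) / 2 : ℝ)))).const_mul (S.q (S.rep i))
  convert h using 2
  · rw [dressed_rep_add_dressed_opp]; ring
  · push_cast; ring

lemma sum_q : ∑ b with S.level b = ⊤, S.q b = 1 := by
  rw [Finset.sum_congr rfl fun b hb => S.q_eq b (Finset.mem_filter.1 hb).2]
  exact_mod_cast S.sum_wt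

/-- The bare weights of level `⊤` add up to `1`, so the base is `1 + z/n` up to a smaller error, and
the removal of `k` factors is harmless. -/
lemma tendsto_top_pow (c : A → ℕ) (t : Fin m → ℕ) (k : ℕ) :
    Tendsto (fun n : ℕ => (∑ b with S.level b = ⊤, S.dressed n c t b) ^ (n - k)) atTop
      (𝓝 (Complex.exp (-(1 / 2) * ∑ b with S.level b = ⊤, S.q b * S.load c t b))) := by
  have h1 : Tendsto (fun n : ℕ => (n : ℂ) * (∑ b with S.level b = ⊤, S.dressed n c t b - 1)) atTop
      (𝓝 (-(1 / 2) * ∑ b with S.level b = ⊤, S.q b * S.load c t b)) := by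
    have h2 : Tendsto (fun n : ℕ => ∑ b with S.level b = ⊤, S.q b *
        ((n : ℂ) * (Complex.exp (-(S.load c t b / 2 : ℝ) / n) - 1))) atTop
        (𝓝 (∑ b with S.level b = ⊤, S.q b * (-(S.load c t b / 2 : ℝ)))) :=
      tendsto_finsetSum _ fun b _ => (tendsto_mul_exp_div_sub_one _).const_mul _
    convert h2 using 2
    · nth_rw 1 [← S.sum_q]
      rw [← Finset.sum_sub_distrib, Finset.mul_sum]
      refine Finset.sum_congr rfl fun b _ => ?_
      rw [dressed]; ring
    · rw [Finset.mul_sum]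
      refine Finset.sum_congr rfl fun b _ => ?_
      push_cast; ring
  have h3 := Complex.tendsto_one_add_pow_exp_of_tendsto h1
  simp only [add_sub_cancel] at h3
  refine tendsto_pow_sub_of_tendsto_pow k ?_ h3
  have h4 := (h1.mul (tendsto_inv_atTop_nhds_zero_nat (𝕜 := ℂ))).const_add 1
  rw [mul_zero, add_zero] at h4
  refine h4.congr' ?_
  filter_upwards [eventually_ge_atTop 1] with n hn
  have : (n : ℂ) ≠ 0 := by exact_mod_cast (by omega : n ≠ 0)
  field_simp
  ring

/-- All pairs lie below `⊤`, so every `t_i` contributes to these loads. By symmetry of `P` the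
mirror average can be charged to the background and to the pairs instead. -/
lemma exp_load_top (c : A → ℕ) (t : Fin m → ℕ) :
    Complex.exp (-(1 / 2) * ∑ b with S.level b = ⊤, S.q b * S.load c t b) =
      (∏ u, S.damping u ^ c u) * ∏ i, S.damping (S.rep i) ^ t i := by
  simp only [damping, ← Complex.exp_nat_mul, ← Complex.exp_sum, ← Complex.exp_add]
  congr 1
  have h1 : ∀ b ∈ Finset.univ.filter (fun b => S.level b = ⊤), S.q b * (S.load c t b : ℂ) =
      (∑ u, (c u : ℂ) * (S.q b * S.P b u)) + ∑ i, (t i : ℂ) * (S.q b * S.P b (S.rep i)) := by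
    intro b hb
    have hb := (Finset.mem_filter.1 hb).2
    simp only [load, lin, hb, WithTop.coe_lt_top, if_true]
    push_cast
    rw [mul_add, Finset.mul_sum, Finset.mul_sum]
    congr 1
    · exact Finset.sum_congr rfl fun u _ => by rw [S.P_comm]; ring
    · exact Finset.sum_congr rfl fun u _ => by rw [S.P_comm]; ring
  rw [Finset.sum_congr rfl h1, Finset.sum_add_distrib, mul_add]
  congr 1 <;>
  · rw [Finset.sum_comm, Finset.mul_sum]
    refine Finset.sum_congr rfl fun u _ => ?_
    rw [← Finset.mul_sum]; ring

lemma tendsto_bulkTerm (c : A → ℕ) (t : Fin m → ℕ) :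
    Tendsto (fun n => S.bulkTerm n c t) atTop (𝓝 ((∏ u, S.damping u ^ c u) *
      layerTerm (fun i j => S.coupling i (S.rep j)) (fun _ => 1)
        (fun i => ∑ u, c u * S.coupling i u) t)) := by
  -- The power `n^{∑ t_i}` divided out of the falling factorial is given to the pairs, one factor
  -- `n` for each of their elements.
  have h := ((tendsto_descFactorial_div_pow (∑ a, c a) (∑ i, t i)).mul
    (S.tendsto_top_pow c t (∑ a, c a + ∑ i, t i))).mul
    (tendsto_finsetProd Finset.univ fun i _ =>
      ((S.tendsto_mul_pair c t i).pow (t i)).div_const ((t i).factorial : ℂ))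
  -- The factor `damping (rep i)` comes from the level `⊤`; with it, half the load difference
  -- becomes the coupling.
  have e : ∀ i, S.q (S.rep i) * (((S.load c t (S.opp i) : ℂ) - S.load c t (S.rep i)) / 2) *
      S.damping (S.rep i) = ∑ u, c u * S.coupling i u +
        ∑ j with j < i, S.coupling i (S.rep j) * t j := by
    intro i
    have h1 := congrArg (fun x : ℝ => (x : ℂ)) (S.load_opp_sub_load_rep c t i)
    simp only [Complex.ofReal_sub, Complex.ofReal_add, Complex.ofReal_sum, Complex.ofReal_mul,
      Complex.ofReal_natCast, lin] at h1
    rw [h1, ← Finset.sum_sub_distrib, add_div, mul_add, add_mul, Finset.sum_div, Finset.sum_div,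
      Finset.mul_sum, Finset.mul_sum, Finset.sum_mul, Finset.sum_mul]
    congr 1
    · refine Finset.sum_congr rfl fun u _ => ?_
      rw [coupling, S.P_comm (S.opp i), S.P_comm (S.rep i)]; ring
    · refine Finset.sum_congr rfl fun u _ => ?_
      rw [coupling]; ring
  convert h.congr' ?_ using 2
  · rw [exp_load_top, one_mul, mul_assoc, ← Finset.prod_mul_distrib, layerTerm]
    congr 1
    refine Finset.prod_congr rfl fun i _ => ?_
    rw [one_mul, ← e, mul_pow _ (S.damping (S.rep i))]
    ring
  · filter_upwards [eventually_ge_atTop 1] with n hn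
    have hn : (n : ℂ) ≠ 0 := by exact_mod_cast (by omega : n ≠ 0)
    simp only [bulkTerm, mul_pow, mul_div_assoc, Finset.prod_mul_distrib, Nat.sub_sub,
      Finset.prod_pow_eq_pow_sum]
    field_simp

/-! ### A majorant independent of `n` -/

lemma norm_top_le (n : ℕ) (c : A → ℕ) (t : Fin m → ℕ) :
    ‖∑ b with S.level b = ⊤, S.dressed n c t b‖ ≤ 1 := by
  refine (norm_sum_le _ _).trans ?_
  rw [← S.sum_wt]
  refine Finset.sum_le_sum fun b hb => ?_
  rw [dressed, S.q_eq b (Finset.mem_filter.1 hb).2, norm_mul, Complex.norm_real, Real.norm_eq_abs,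
    abs_of_nonneg (S.wt_nonneg b), Complex.norm_exp]
  refine mul_le_of_le_one_right (S.wt_nonneg b) (Real.exp_le_one_iff.2 ?_)
  have : (-((S.load c t b / 2 : ℝ) : ℂ) / n).re = -(S.load c t b / 2 / n) := by
    rw [← Complex.ofReal_neg, ← Complex.ofReal_natCast, ← Complex.ofReal_div, Complex.ofReal_re]
    ring
  rw [this]
  have := S.load_nonneg c t b
  have : 0 ≤ S.load c t b / 2 / n := by positivity
  linarith

lemma norm_mul_pair_le {n : ℕ} (hn : 1 ≤ n) (c : A → ℕ) (t : Fin m → ℕ) (i : Fin m) :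
    n * ‖∑ b with S.level b = i, S.dressed n c t b‖ ≤ ‖S.q (S.rep i)‖ *
      (|S.lin c (S.opp i) - S.lin c (S.rep i)| / 2 +
        ∑ j with j < i, |S.P (S.opp i) (S.rep j) - S.P (S.rep i) (S.rep j)| / 2 * t j) := by
  have hn' : (0 : ℝ) < n := by exact_mod_cast hn
  have e : Complex.exp (-(S.load c t (S.rep i) / 2 : ℝ) / n) -
        Complex.exp (-(S.load c t (S.opp i) / 2 : ℝ) / n) =
      ((Real.exp (-(S.load c t (S.rep i) / 2 / n)) -
        Real.exp (-(S.load c t (S.opp i) / 2 / n)) : ℝ) : ℂ) := by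
    push_cast; ring_nf
  rw [dressed_rep_add_dressed_opp, norm_mul, mul_left_comm, e, Complex.norm_real, Real.norm_eq_abs]
  have h1 := S.load_nonneg c t (S.rep i)
  have h2 := S.load_nonneg c t (S.opp i)
  refine mul_le_mul_of_nonneg_left ?_ (norm_nonneg _)
  calc _ ≤ n * |S.load c t (S.rep i) / 2 / n - S.load c t (S.opp i) / 2 / n| := by
        exact mul_le_mul_of_nonneg_left
          (abs_exp_neg_sub_exp_neg_le (by positivity) (by positivity)) hn'.le
    _ = |S.load c t (S.opp i) - S.load c t (S.rep i)| / 2 := by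
        rw [abs_sub_comm, ← sub_div, ← sub_div, abs_div, abs_div, abs_of_pos hn', abs_two]
        field_simp
    _ ≤ _ := by
        rw [load_opp_sub_load_rep]
        refine (div_le_div_of_nonneg_right (abs_add_le _ _) zero_le_two).trans ?_
        rw [add_div]
        gcongr
        refine (div_le_div_of_nonneg_right (Finset.abs_sum_le_sum_abs _ _) zero_le_two).trans ?_
        rw [Finset.sum_div]
        refine Finset.sum_le_sum fun j _ => le_of_eq ?_
        rw [abs_mul, Nat.abs_cast]; ring

/-- The bound has the shape of the layered series with nonnegative data, so
`summable_layerTerm_real` makes it an admissible majorant for dominated convergence. -/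
lemma norm_bulkTerm_le {n : ℕ} (hn : 1 ≤ n) (c : A → ℕ) (t : Fin m → ℕ) :
    ‖S.bulkTerm n c t‖ ≤ ∏ i, (‖S.q (S.rep i)‖ *
      (|S.lin c (S.opp i) - S.lin c (S.rep i)| / 2 +
        ∑ j with j < i, |S.P (S.opp i) (S.rep j) - S.P (S.rep i) (S.rep j)| / 2 * t j)) ^ t i /
        ((t i).factorial : ℝ) := by
  have h1 : ‖((n - ∑ a, c a).descFactorial (∑ i, t i) : ℂ)‖ ≤ (n : ℝ) ^ (∑ i, t i) := by
    rw [Complex.norm_natCast]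
    exact_mod_cast (Nat.descFactorial_le_pow _ _).trans (Nat.pow_le_pow_left (Nat.sub_le _ _) _)
  have h2 : ‖(∑ b with S.level b = ⊤, S.dressed n c t b) ^ (n - ∑ a, c a - ∑ i, t i)‖ ≤ 1 := by
    rw [norm_pow]
    exact pow_le_one₀ (norm_nonneg _) (S.norm_top_le n c t)
  rw [bulkTerm, norm_mul, norm_mul, norm_prod]
  calc _ ≤ (n : ℝ) ^ (∑ i, t i) * 1 * ∏ i : Fin m,
        ‖(∑ b with S.level b = i, S.dressed n c t b) ^ t i / ((t i).factorial : ℂ)‖ := by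
        gcongr
    _ = ∏ i : Fin m, (n * ‖∑ b with S.level b = i, S.dressed n c t b‖) ^ t i /
        ((t i).factorial : ℝ) := by
        rw [mul_one, ← Finset.prod_pow_eq_pow_sum, ← Finset.prod_mul_distrib]
        refine Finset.prod_congr rfl fun i _ => ?_
        rw [norm_div, norm_pow, Complex.norm_natCast, mul_pow, mul_div_assoc]
    _ ≤ _ := by
        refine Finset.prod_le_prod (fun i _ => by positivity) fun i _ => ?_
        exact div_le_div_of_nonneg_right
          (pow_le_pow_left₀ (by positivity) (S.norm_mul_pair_le hn c t i) _) (by positivity)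

theorem tendsto_bulkSum (c : A → ℕ) :
    Tendsto (fun n => S.bulkSum n c) atTop (𝓝 ((∏ u, S.damping u ^ c u) *
      ∑' t, layerTerm (fun i j => S.coupling i (S.rep j)) (fun _ => 1)
        (fun i => ∑ u, c u * S.coupling i u) t)) := by
  have h1 : Tendsto (fun n => ∑' t, S.bulkTerm n c t) atTop (𝓝 ((∏ u, S.damping u ^ c u) *
      ∑' t, layerTerm (fun i j => S.coupling i (S.rep j)) (fun _ => 1)
        (fun i => ∑ u, c u * S.coupling i u) t)) := by
    rw [← tsum_mul_left]
    refine tendsto_tsum_of_dominated_convergence (summable_layerTerm_real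
      (fun i j => |S.P (S.opp i) (S.rep j) - S.P (S.rep i) (S.rep j)| / 2)
      (fun i => ‖S.q (S.rep i)‖) (fun i => |S.lin c (S.opp i) - S.lin c (S.rep i)| / 2)
      (fun _ _ => by positivity) (fun _ => norm_nonneg _) (fun _ => by positivity))
      (fun t => S.tendsto_bulkTerm c t) ?_
    filter_upwards [eventually_ge_atTop 1] with n hn t
    exact S.norm_bulkTerm_le hn c t
  have h2 : Tendsto (fun n : ℕ => ((Real.exp (-(1 / (4 * n)) * S.quad c) : ℝ) : ℂ)) atTop
      (𝓝 1) := by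
    have h3 : Tendsto (fun n : ℕ => (-(1 / 4) * S.quad c) * (n : ℝ)⁻¹) atTop (𝓝 0) := by
      simpa using (tendsto_inv_atTop_nhds_zero_nat (𝕜 := ℝ)).const_mul (-(1 / 4) * S.quad c)
    have h4 := (Complex.continuous_ofReal.comp Real.continuous_exp).tendsto 0 |>.comp h3
    simp only [Function.comp_apply, Real.exp_zero, Complex.ofReal_one] at h4
    refine h4.congr fun n => ?_
    simp only [Function.comp_apply]
    congr 2
    ring
  have h5 := h2.mul h1
  rw [one_mul] at h5
  exact h5.congr fun n => (S.bulkSum_eq n c).symm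

end PairedSystem

/-! ### The limits of the sums in the configuration basis -/

section ConfigurationLimits

open Filter Topology

/-- The index in `D` of the pair `{a, ā}`, and `⊤` for mirror configurations. -/
def levelOf (D : List (Config p)) (a : Config p) : WithTop (Fin D.length) :=
  if h : a ∈ D then (⟨D.idxOf a, List.idxOf_lt_length_of_mem h⟩ : Fin D.length)
  else if h : bar a ∈ D then (⟨D.idxOf (bar a), List.idxOf_lt_length_of_mem h⟩ : Fin D.length)
  else ⊤

lemma IsHalf.levelOf_eq_top_iff {D : List (Config p)} (hD : IsHalf D) (a : Config p) :
    levelOf D a = ⊤ ↔ IsMirror a := by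
  unfold levelOf
  by_cases ha : IsMirror a
  · have h1 : a ∉ D := fun h => hD.2.1 a h ha
    have h2 : bar a ∉ D := by rwa [bar_of_isMirror ha]
    simp [h1, h2, ha]
  · have h := hD.2.2 a ha
    by_cases h1 : a ∈ D
    · simp [h1, ha]
    · have h2 : bar a ∈ D := by tauto
      simp [h1, h2, ha]

lemma IsHalf.levelOf_eq_coe_iff {D : List (Config p)} (hD : IsHalf D) (a : Config p)
    (i : Fin D.length) : levelOf D a = i ↔ a = D.get i ∨ a = bar (D.get i) := by
  have hi : D.get i ∈ D := List.get_mem D i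
  have hmi : ¬ IsMirror (D.get i) := hD.2.1 _ hi
  have hidx : D.idxOf (D.get i) = i := List.get_idxOf hD.1 i
  constructor
  · intro h
    unfold levelOf at h
    split_ifs at h with h1 h2
    · left
      rw [WithTop.coe_inj] at h
      rw [← h]
      exact (List.idxOf_get _).symm
    · right
      rw [WithTop.coe_inj] at h
      rw [← h, List.idxOf_get, bar_bar]
    · exact absurd h (WithTop.coe_ne_top (a := i)).symm
  · rintro (rfl | rfl)
    · unfold levelOf
      rw [dif_pos hi, WithTop.coe_inj]
      exact Fin.ext hidx
    · have h1 : bar (D.get i) ∉ D := (hD.2.2 _ hmi).1 hi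
      have h2 : bar (bar (D.get i)) ∈ D := by rwa [bar_bar]
      unfold levelOf
      rw [dif_neg h1, dif_pos h2, WithTop.coe_inj]
      refine Fin.ext ?_
      simp only [bar_bar]
      exact hidx

lemma IsIndexing.playsWell_get {γ : Fin p → ℝ} {D : List (Config p)} (hD : IsIndexing γ D)
    {i j : Fin D.length} (hij : i ≤ j) : PlaysWell γ (D.get i) (D.get j) := by
  rcases hij.eq_or_lt with rfl | h
  · exact playsWell_self γ _
  · exact List.pairwise_iff_get.1 hD.2 i j h

lemma IsIndexing.playsWell_of_le_levelOf {γ : Fin p → ℝ} {D : List (Config p)}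
    (hD : IsIndexing γ D) {i : Fin D.length} {b : Config p} (h : i ≤ levelOf D b) :
    PlaysWell γ (D.get i) b := by
  cases hb : levelOf D b with
  | top => exact playsWell_of_isMirror γ ((hD.1.levelOf_eq_top_iff b).1 hb)
  | coe j =>
    rw [hb, WithTop.coe_le_coe] at h
    rcases (hD.1.levelOf_eq_coe_iff b j).1 hb with rfl | rfl
    · exact hD.playsWell_get h
    · exact (hD.playsWell_get h).bar_right

/-- The paired system of the configurations with an admissible indexing. -/
def configSystem (γ β : Fin p → ℝ) (D : List (Config p)) (hD : IsIndexing γ D) :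
    PairedSystem (Config p) D.length where
  level := levelOf D
  P a b := Phi γ (a * b) ^ 2
  q := Q β
  wt a := mirrorWeight β a.1
  rep := D.get
  opp i := bar (D.get i)
  P_comm a b := by rw [mul_comm]
  P_nonneg a b := sq_nonneg _
  P_eq_zero a b h := by
    cases ha : levelOf D a with
    | top =>
      rw [((IsMirror.mul ((hD.1.levelOf_eq_top_iff a).1 ha)
        ((hD.1.levelOf_eq_top_iff b).1 (h ▸ ha))).Phi γ)]
      simp
    | coe i =>
      rcases (hD.1.levelOf_eq_coe_iff a i).1 ha with rfl | rfl <;>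
      rcases (hD.1.levelOf_eq_coe_iff b i).1 (h ▸ ha) with rfl | rfl
      · simp [Phi_mul_self]
      · rw [mul_comm]; simp [Phi_bar_mul_self]
      · simp [Phi_bar_mul_self]
      · simp [Phi_mul_self]
  P_congr a a' b h hb := by
    cases ha : levelOf D a with
    | top =>
      have hbt := (hD.1.levelOf_eq_top_iff b).1 (top_le_iff.1 (ha ▸ hb))
      rw [((hD.1.levelOf_eq_top_iff a).1 ha |>.mul hbt).Phi,
        ((hD.1.levelOf_eq_top_iff a').1 (h ▸ ha) |>.mul hbt).Phi]
    | coe i =>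
      have hw := hD.playsWell_of_le_levelOf (ha ▸ hb)
      rw [PlaysWell] at hw
      rcases (hD.1.levelOf_eq_coe_iff a i).1 ha with rfl | rfl <;>
      rcases (hD.1.levelOf_eq_coe_iff a' i).1 (h ▸ ha) with rfl | rfl <;>
      simp only [hw]
  rep_ne_opp i := (bar_ne_self (hD.1.2.1 _ (List.get_mem D i))).symm
  level_eq_iff a i := hD.1.levelOf_eq_coe_iff a i
  q_opp i := Q_bar β (hD.1.2.1 _ (List.get_mem D i))
  wt_nonneg a := mirrorWeight_nonneg β a.1
  q_eq a h := ((hD.1.levelOf_eq_top_iff a).1 h).Q_eq β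
  sum_wt := by
    have h := sum_Q_isMirror β
    rw [Finset.sum_congr rfl fun a ha => (Finset.mem_filter.1 ha).2.Q_eq β,
      ← Complex.ofReal_sum, Complex.ofReal_eq_one] at h
    rw [← h]
    exact Finset.sum_congr (by ext a; simp [hD.1.levelOf_eq_top_iff]) fun _ _ => rfl

variable {γ : Fin p → ℝ} (β : Fin p → ℝ) {D : List (Config p)}

lemma configSystem_damping (hD : IsIndexing γ D) (u : Config p) :
    (configSystem γ β D hD).damping u = F γ β u := by
  rw [PairedSystem.damping, F]
  congr 2
  refine Finset.sum_congr ?_ fun a _ => ?_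
  · ext a; simp [configSystem, hD.1.levelOf_eq_top_iff]
  · simp [configSystem]

lemma configSystem_coupling (hD : IsIndexing γ D) (i : Fin D.length) (u : Config p) :
    (configSystem γ β D hD).coupling i u = K γ β (D.get i) u := by
  rw [PairedSystem.coupling, configSystem_damping, K, X]
  simp [configSystem]

/-- The values of `R` on `D` do not change if the iteration is continued to the first index. -/
lemma IsIndexing.R_get (hD : IsIndexing γ D) (i : Fin D.length) :
    D.reverse.foldl (sweepStep (K γ β)) (fun _ => 1) (D.get i) = R γ β D (D.get i) := by
  have hR : R γ β D = D.tail.reverse.foldl (sweepStep (K γ β)) (fun _ => 1) := rfl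
  rw [hR]
  cases D with
  | nil => exact i.elim0
  | cons a L =>
    rw [List.reverse_cons, List.foldl_append, List.tail_cons, List.foldl_cons, List.foldl_nil]
    -- The first element of `D` plays well with all of `D`, so the extra sweep multiplies by `exp
    -- 0`.
    have h0 := (hD.playsWell_get (i := ⟨0, by simp⟩) (j := i) (Fin.mk_le_of_le_val (by simp)))
      |>.K_eq_zero β
    rw [sweepStep, show K γ β a ((a :: L).get i) = 0 from h0]
    simp

lemma Y_eq_exp_sum (u : Config p) :
    Y γ β D u = Complex.exp (∑ i, R γ β D (D.get i) * K γ β (D.get i) u) := by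
  rw [Y]
  congr 1
  rw [← List.sum_ofFn]
  congr 1
  generalize R γ β D = ρ
  conv_lhs => rw [← List.ofFn_get D, List.map_ofFn]
  rfl

/-- The inhomogeneity of the series, and with it the exponent of its value, is linear in `c`; hence
the limit is multiplicative in the background. -/
theorem tendsto_bulkSum_configSystem (hD : IsIndexing γ D) (c : Config p → ℕ) :
    Tendsto (fun n => (configSystem γ β D hD).bulkSum n c) atTop
      (𝓝 (∏ u, (F γ β u * Y γ β D u) ^ c u)) := by
  have h := (configSystem γ β D hD).tendsto_bulkSum c
  have h2 := (hasSum_layerTerm D.get (K γ β) (fun i j hij => (hD.playsWell_get hij).K_eq_zero β)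
    (fun _ => 1) (fun i => ∑ u, c u * K γ β (D.get i) u)).tsum_eq
  simp only [configSystem_damping, configSystem_coupling] at h
  rw [List.ofFn_get] at h2
  have h3 : ∀ j, (configSystem γ β D hD).rep j = D.get j := fun _ => rfl
  simp only [h3, h2, hD.R_get β] at h
  convert h using 2
  simp only [mul_pow, Finset.prod_mul_distrib]
  congr 1
  simp only [Y_eq_exp_sum, ← Complex.exp_nat_mul, ← Complex.exp_sum, Finset.mul_sum]
  rw [Finset.sum_comm]
  congr 1
  exact Finset.sum_congr rfl fun i _ => Finset.sum_congr rfl fun u _ => by ring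

/-- The moment `∏_{u ∈ L} n_u/n` of the occupation numbers `n = N + c`, where only `N` carries a
multinomial coefficient. -/
def momentSum (γ β : Fin p → ℝ) (n : ℕ) (L : List (Config p)) (c : Config p → ℕ) : ℂ :=
  ∑ N ∈ Finset.piAntidiag (Finset.univ : Finset (Config p)) (n - ∑ a, c a),
    (Nat.multinomial Finset.univ N : ℂ) *
      ((L.map fun u => (((N + c) u : ℕ) : ℂ) / n).prod *
        (((Real.exp (-(1 / (4 * n)) * ∑ a, ∑ b, Phi γ (a * b) ^ 2 * ((N + c) a : ℕ) *
          ((N + c) b : ℕ)) : ℝ) : ℂ) * ∏ a, Q β a ^ (N + c) a))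

lemma momentSum_nil (hD : IsIndexing γ D) (n : ℕ) (c : Config p → ℕ) :
    momentSum γ β n [] c = (∏ a, Q β a ^ c a) * (configSystem γ β D hD).bulkSum n c := by
  rw [momentSum, PairedSystem.bulkSum, Finset.mul_sum]
  refine Finset.sum_congr rfl fun N _ => ?_
  simp only [Pi.add_apply, pow_add, Finset.prod_mul_distrib, List.map_nil, List.prod_nil, one_mul,
    PairedSystem.quad, configSystem]
  ring

/-- The factor for `u` splits into the contributions of `N` and of `c`. The first moves one element
of class `u` from `N` to the background, at the price of the factor `n - ∑ c`. -/
lemma momentSum_cons {n : ℕ} (u : Config p) (L : List (Config p)) (c : Config p → ℕ)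
    (hn : ∑ a, c a < n) :
    momentSum γ β n (u :: L) c =
      ((n - ∑ a, c a : ℕ) : ℂ) / n * momentSum γ β n L (c + Pi.single u 1) +
        c u / n * momentSum γ β n L c := by
  obtain ⟨k, hk⟩ : ∃ k, n - ∑ a, c a = k + 1 := ⟨n - ∑ a, c a - 1, by omega⟩
  have hs : n - ∑ a, (c + Pi.single u 1 : Config p → ℕ) a = k := by
    simp only [Pi.add_apply, Finset.sum_add_distrib, Finset.sum_pi_single', Finset.mem_univ,
      if_true]
    omega
  have h := sum_multinomial_mul_apply k u fun N : Config p → ℕ =>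
    (L.map fun u => (((N + c) u : ℕ) : ℂ) / n).prod *
        (((Real.exp (-(1 / (4 * n)) * ∑ a, ∑ b, Phi γ (a * b) ^ 2 * ((N + c) a : ℕ) *
          ((N + c) b : ℕ)) : ℝ) : ℂ) * ∏ a, Q β a ^ (N + c) a)
  have hc : ∀ N : Config p → ℕ, N + Pi.single u 1 + c = N + (c + Pi.single u 1) := by
    intro N; abel
  simp only [hc] at h
  unfold momentSum
  rw [hs, hk, Nat.cast_add_one]
  rw [div_mul_eq_mul_div, ← h, Finset.sum_div, Finset.mul_sum, ← Finset.sum_add_distrib]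
  refine Finset.sum_congr rfl fun N _ => ?_
  simp only [List.map_cons, List.prod_cons, Pi.add_apply, Nat.cast_add]
  ring

/-- The background has to be arbitrary because the induction on `L` enlarges it. The term with `c u
/ n` disappears in the limit. -/
theorem tendsto_momentSum (hD : IsIndexing γ D) (L : List (Config p)) (c : Config p → ℕ) :
    Tendsto (fun n => momentSum γ β n L c) atTop
      (𝓝 ((L.map (W γ β D)).prod * ∏ a, W γ β D a ^ c a)) := by
  induction L generalizing c with
  | nil =>
    have h := (tendsto_bulkSum_configSystem β hD c).const_mul (∏ a, Q β a ^ c a)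
    simp only [momentSum_nil β hD]
    convert h using 2
    simp only [List.map_nil, List.prod_nil, one_mul, ← Finset.prod_mul_distrib, ← mul_pow, W, X,
      mul_assoc]
  | cons u L ih =>
    have h1 := (tendsto_natCast_sub_div (∑ a, c a)).mul (ih (c + Pi.single u 1))
    have h2 := (tendsto_const_div_atTop_nhds_zero_nat (c u : ℂ)).mul (ih c)
    have h3 := h1.add h2
    rw [zero_mul, add_zero, one_mul] at h3
    have e : ∏ a, W γ β D a ^ (c + Pi.single u 1 : Config p → ℕ) a =
        W γ β D u * ∏ a, W γ β D a ^ c a := by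
      simp only [Pi.add_apply, pow_add, Finset.prod_mul_distrib]
      rw [mul_comm, Finset.prod_eq_single u]
      · simp
      · intro b _ hb; simp [hb]
      · simp
    rw [e] at h3
    rw [List.map_cons, List.prod_cons, mul_comm (W γ β D u), mul_assoc]
    refine h3.congr' ?_
    filter_upwards [eventually_gt_atTop (∑ a, c a)] with n hn
    rw [momentSum_cons β u L c hn]

theorem tendsto_S₂ (hD : IsIndexing γ D) (u v : Config p) :
    Tendsto (S₂ γ β u v) atTop (𝓝 (W γ β D u * W γ β D v)) := by
  have h := tendsto_momentSum β hD [u, v] 0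
  simp only [Pi.zero_apply, pow_zero, Finset.prod_const_one, mul_one, List.map_cons, List.map_nil,
    List.prod_cons, List.prod_nil] at h
  refine h.congr fun n => ?_
  rw [momentSum, S₂]
  simp only [add_zero, Pi.zero_apply, Finset.sum_const_zero, Nat.sub_zero, weight]
  refine Finset.sum_congr rfl fun N _ => ?_
  simp only [List.map_cons, List.map_nil, List.prod_cons, List.prod_nil]
  ring

theorem tendsto_S₄ (hD : IsIndexing γ D) (u v x y : Config p) :
    Tendsto (S₄ γ β u v x y) atTop
      (𝓝 (W γ β D u * W γ β D v * W γ β D x * W γ β D y)) := by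
  have h := tendsto_momentSum β hD [u, v, x, y] 0
  simp only [Pi.zero_apply, pow_zero, Finset.prod_const_one, mul_one, List.map_cons, List.map_nil,
    List.prod_cons, List.prod_nil, ← mul_assoc] at h
  refine h.congr fun n => ?_
  rw [momentSum, S₄]
  simp only [add_zero, Pi.zero_apply, Finset.sum_const_zero, Nat.sub_zero, weight]
  refine Finset.sum_congr rfl fun N _ => ?_
  simp only [List.map_cons, List.map_nil, List.prod_cons, List.prod_nil]
  ring

end ConfigurationLimits

/-! ### The unitaries of the QAOA -/

section Unitaries

variable {n : ℕ}

lemma exp_smul_of_mul_self_eq_one {𝔸 : Type*} [NormedRing 𝔸] [NormedAlgebra ℂ 𝔸]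
    [CompleteSpace 𝔸] {x : 𝔸} (hx : x * x = 1) (z : ℂ) :
    NormedSpace.exp (z • x) = Complex.cosh z • 1 + Complex.sinh z • x := by
  have h1 : HasSum (fun k : ℕ => ((k.factorial : ℂ)⁻¹) • (z • x) ^ k) (NormedSpace.exp (z • x)) :=
    NormedSpace.exp_series_hasSum_exp' (𝕂 := ℂ) (z • x)
  have h2 := ((hasSum_pow_div_factorial z).smul_const ((1 / 2 : ℂ) • (1 + x))).add
    ((hasSum_pow_div_factorial (-z)).smul_const ((1 / 2 : ℂ) • (1 - x)))
  -- The elements `(1 ± x)/2` are complementary idempotents on which `x` acts as `±1`.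
  have h3 : ∀ k : ℕ, x ^ k = (1 / 2 : ℂ) • (1 + x) + ((-1 : ℂ) ^ k) • ((1 / 2 : ℂ) • (1 - x)) := by
    intro k
    induction k with
    | zero => simp only [pow_zero]; module
    | succ k ih =>
      rw [pow_succ, ih, add_mul, smul_mul_assoc, smul_mul_assoc, smul_mul_assoc, add_mul, sub_mul,
        hx, one_mul, pow_succ]
      module
  have h4 : (fun k : ℕ => ((k.factorial : ℂ)⁻¹) • (z • x) ^ k) = fun k : ℕ =>
      (z ^ k / (k.factorial : ℂ)) • ((1 / 2 : ℂ) • (1 + x)) +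
      ((-z) ^ k / (k.factorial : ℂ)) • ((1 / 2 : ℂ) • (1 - x)) := by
    funext k
    rw [smul_pow, h3, neg_pow z, smul_add, smul_add, smul_smul, smul_smul, smul_smul, smul_smul,
      smul_smul, smul_smul, smul_smul]
    congr 2 <;> ring
  rw [h4] at h1
  rw [h1.unique h2, Complex.cosh, Complex.sinh]
  module

/-- The amplitude `⟨z|e^{-iβX}|z'⟩` of one spin, as a function of `z z'`. -/
def mixerAmp (β : ℝ) (b : ℤˣ) : ℂ :=
  if b = 1 then (Real.cos β : ℂ) else -(Complex.I * Real.sin β)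

/-- The string with a single entry `-1`, at `j`. -/
def flipSpin (j : Fin n) : Spins n := Function.update 1 j (-1)

lemma flipSpin_mul_self (j : Fin n) : flipSpin j * flipSpin j = 1 := by
  funext k; by_cases h : k = j <;> simp [flipSpin, h]

lemma update_neg_eq_mul_flipSpin (z : Spins n) (j : Fin n) :
    Function.update z j (-z j) = z * flipSpin j := by
  funext k; by_cases h : k = j
  · subst h; simp [flipSpin]
  · simp [flipSpin, h]

lemma pauliX_apply (j : Fin n) (z z' : Spins n) :
    pauliX j z z' = if z' = z * flipSpin j then 1 else 0 := by
  rw [pauliX, update_neg_eq_mul_flipSpin]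
  congr 1
  refine propext ⟨fun h => ?_, fun h => ?_⟩ <;> rw [h, mul_assoc, flipSpin_mul_self, mul_one]

lemma pauliX_mul_apply (j : Fin n) (M : Matrix (Spins n) (Spins n) ℂ) (z z' : Spins n) :
    (pauliX j * M) z z' = M (z * flipSpin j) z' := by
  rw [Matrix.mul_apply]
  simp [pauliX_apply]

lemma pauliX_mul_self (j : Fin n) : pauliX j * pauliX j = 1 := by
  ext z z'
  rw [pauliX_mul_apply, pauliX_apply, mul_assoc, flipSpin_mul_self, mul_one, Matrix.one_apply]
  simp [eq_comm]

lemma commute_pauliX (i j : Fin n) : Commute (pauliX i) (pauliX j) := by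
  rw [Commute, SemiconjBy]
  ext z z'
  rw [pauliX_mul_apply, pauliX_mul_apply, pauliX_apply, pauliX_apply, mul_right_comm]

lemma exp_smul_pauliX (β : ℝ) (j : Fin n) :
    NormedSpace.exp ((-(Complex.I * (β : ℂ))) • pauliX j) =
      (Real.cos β : ℂ) • (1 : Matrix (Spins n) (Spins n) ℂ) +
        (-(Complex.I * Real.sin β)) • pauliX j := by
  have h : NormedSpace.exp ((-(Complex.I * (β : ℂ))) • pauliX j) =
      Complex.cosh (-(Complex.I * (β : ℂ))) • (1 : Matrix (Spins n) (Spins n) ℂ) +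
        Complex.sinh (-(Complex.I * (β : ℂ))) • pauliX j :=
    open scoped Matrix.Norms.Operator in
      exp_smul_of_mul_self_eq_one (pauliX_mul_self j) _
  rw [h, Complex.cosh_neg, Complex.sinh_neg, mul_comm Complex.I, Complex.cosh_mul_I,
    Complex.sinh_mul_I, Complex.ofReal_cos, Complex.ofReal_sin, mul_comm Complex.I]

/-- The Pauli operators commute, so the exponential is a product over sites and the sites can be
added one at a time; the indicator keeps the untouched sites equal. -/
lemma exp_smul_sum_pauliX_apply (β : ℝ) (s : Finset (Fin n)) (z z' : Spins n) :
    NormedSpace.exp ((-(Complex.I * (β : ℂ))) • ∑ j ∈ s, pauliX j) z z' =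
      (∏ j ∈ s, mixerAmp β (z j * z' j)) * if ∀ j, j ∉ s → z j = z' j then 1 else 0 := by
  induction s using Finset.induction_on generalizing z with
  | empty =>
    simp [Matrix.one_apply, funext_iff]
  | insert a s ha ih =>
    have hc : Commute ((-(Complex.I * (β : ℂ))) • pauliX a)
        ((-(Complex.I * (β : ℂ))) • ∑ j ∈ s, pauliX j) :=
      ((Commute.sum_right _ _ _ fun j _ => commute_pauliX a j).smul_left _).smul_right _
    rw [Finset.sum_insert ha, smul_add, Matrix.exp_add_of_commute _ _ hc, exp_smul_pauliX, add_mul,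
      smul_mul_assoc, smul_mul_assoc, one_mul, Matrix.add_apply, Matrix.smul_apply,
      Matrix.smul_apply, pauliX_mul_apply, ih, ih, Finset.prod_insert ha]
    have h1 : ∏ j ∈ s, mixerAmp β ((z * flipSpin a) j * z' j) =
        ∏ j ∈ s, mixerAmp β (z j * z' j) := by
      refine Finset.prod_congr rfl fun j hj => ?_
      have : j ≠ a := fun h => ha (h ▸ hj)
      simp [flipSpin, this]
    rw [h1]
    have hne : (-1 : ℤˣ) ≠ 1 := by decide
    -- At the site `a` exactly one of the identity and the flip can connect `z` to `z'`.
    by_cases hza : z a = z' a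
    · have e1 : (∀ j, j ∉ s → z j = z' j) ↔ ∀ j, j ∉ insert a s → z j = z' j := by
        refine ⟨fun h j hj => h j fun hs => hj (Finset.mem_insert_of_mem hs), fun h j hj => ?_⟩
        by_cases hja : j = a
        · rw [hja, hza]
        · exact h j (by simp [hja, hj])
      have e2 : ¬ ∀ j, j ∉ s → (z * flipSpin a) j = z' j := by
        intro h
        have := h a ha
        simp only [Pi.mul_apply, flipSpin, Function.update_self, hza] at this
        rcases Int.units_eq_one_or (z' a) with h2 | h2 <;> rw [h2] at this <;> revert this <;>
          decide
      rw [if_neg e2, hza, Int.units_mul_self]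
      simp only [e1, mixerAmp, if_true, smul_eq_mul]
      ring
    · have hza' : z a = -z' a := Int.units_ne_iff_eq_neg.1 hza
      have e1 : (∀ j, j ∉ s → (z * flipSpin a) j = z' j) ↔
          ∀ j, j ∉ insert a s → z j = z' j := by
        refine ⟨fun h j hj => ?_, fun h j hj => ?_⟩
        · have := h j fun hs => hj (Finset.mem_insert_of_mem hs)
          have hja : j ≠ a := fun h => hj (by simp [h])
          simpa [flipSpin, hja] using this
        · by_cases hja : j = a
          · subst hja; simp [flipSpin, hza']
          · simpa [flipSpin, hja] using h j (by simp [hja, hj])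
      have e2 : ¬ ∀ j, j ∉ s → z j = z' j := fun h => hza (h a ha)
      rw [if_neg e2, hza', neg_mul, Int.units_mul_self]
      simp only [e1, mixerAmp, hne, if_false, smul_eq_mul]
      ring

lemma mixerUnitary_apply (β : ℝ) (z z' : Spins n) :
    mixerUnitary n β z z' = ∏ j, mixerAmp β (z j * z' j) := by
  rw [mixerUnitary, mixer, exp_smul_sum_pauliX_apply]
  simp

lemma phaseUnitary_eq (J : Pairs n → ℝ) (γ : ℝ) :
    phaseUnitary J γ =
      Matrix.diagonal fun z => Complex.exp (-(Complex.I * (γ : ℂ)) * cost J z) := by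
  rw [phaseUnitary, costOp, ← Matrix.diagonal_smul, Matrix.exp_diagonal]
  congr 1
  funext z
  rw [Pi.coe_exp, ← Complex.exp_eq_exp_ℂ]
  rfl

end Unitaries

/-! ### The energy as a sum over configurations -/

section Energy

variable {n : ℕ}

/-- The string `z` moved backwards along the steps `b` to the time `r`. -/
def pathPoint (z : Spins n) (b : Fin n → Fin p → ℤˣ) (r : Fin p) : Spins n :=
  fun j => z j * ∏ s ∈ Finset.Ici r, b j s

/-- Splitting off the last step of each path. -/
def snocPaths (n p : ℕ) :
    (Fin n → ℤˣ) × (Fin n → Fin p → ℤˣ) ≃ (Fin n → Fin (p + 1) → ℤˣ) where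
  toFun x := fun j => Fin.snoc (α := fun _ => ℤˣ) (x.2 j) (x.1 j)
  invFun b := (fun j => b j (Fin.last p), fun j r => b j r.castSucc)
  left_inv x := by ext <;> simp
  right_inv b := by
    funext j r
    refine Fin.lastCases ?_ (fun i => ?_) r <;> simp

lemma prod_Ici_snoc_castSucc (b : Fin p → ℤˣ) (w : ℤˣ) (r : Fin p) :
    ∏ s ∈ Finset.Ici r.castSucc, Fin.snoc (α := fun _ => ℤˣ) b w s =
      w * ∏ s ∈ Finset.Ici r, b s := by
  have h : ∀ {q : ℕ} (r : Fin q) (f : Fin q → ℤˣ), ∏ s ∈ Finset.Ici r, f s =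
      ∏ s, if r ≤ s then f s else 1 := by
    intro q r f
    rw [← Finset.prod_filter]
    congr 1
    ext s; simp
  rw [h, h, Fin.prod_univ_castSucc]
  simp [Fin.le_last, mul_comm]

lemma prod_Ici_snoc_last (b : Fin p → ℤˣ) (w : ℤˣ) :
    ∏ s ∈ Finset.Ici (Fin.last p), Fin.snoc (α := fun _ => ℤˣ) b w s = w := by
  have : Finset.Ici (Fin.last p) = {Fin.last p} := by
    ext s; simp [Fin.last_le_iff]
  rw [this, Finset.prod_singleton, Fin.snoc_last]

/-- The QAOA state as a sum over paths. -/
lemma qaoaState_apply (J : Pairs n → ℝ) (γ β : Fin p → ℝ) (z : Spins n) :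
    qaoaState J γ β z = ((1 / Real.sqrt (2 ^ n) : ℝ) : ℂ) * ∑ b : Fin n → Fin p → ℤˣ,
      (∏ j, ∏ r, mixerAmp (β r) (b j r)) *
        Complex.exp (-(Complex.I * ∑ r, (γ r : ℂ) * cost J (pathPoint z b r))) := by
  induction p generalizing z with
  | zero => simp [qaoaState, initialState]
  | succ p ih =>
    have h1 : qaoaState J γ β = mixerUnitary n (β (Fin.last p)) *ᵥ
        (phaseUnitary J (γ (Fin.last p)) *ᵥ
          qaoaState J (fun r => γ r.castSucc) (fun r => β r.castSucc)) := by
      unfold qaoaState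
      rw [List.finRange_succ_last, List.foldl_append, List.foldl_map]
      rfl
    rw [h1, phaseUnitary_eq, Matrix.mulVec, dotProduct]
    simp only [mixerUnitary_apply, Matrix.mulVec_diagonal, ih]
    -- The intermediate string is written as `z * w`, so that `w` is the last step of the path.
    rw [← (snocPaths n p).sum_comp, Fintype.sum_prod_type, Finset.mul_sum,
      ← Equiv.sum_comp (Equiv.mulLeft z)]
    refine Finset.sum_congr rfl fun w _ => ?_
    rw [Equiv.coe_mulLeft, show ∀ x y s t : ℂ, x * (y * (s * t)) = s * (x * y * t) by
      intros; ring, Finset.mul_sum]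
    congr 1
    refine Finset.sum_congr rfl fun b _ => ?_
    have e1 : ∀ r : Fin p, pathPoint z (snocPaths n p (w, b)) r.castSucc =
        pathPoint (z * w) b r := by
      intro r; funext j
      simp only [pathPoint, snocPaths, Equiv.coe_fn_mk, prod_Ici_snoc_castSucc, Pi.mul_apply,
        mul_assoc]
    have e2 : pathPoint z (snocPaths n p (w, b)) (Fin.last p) = z * w := by
      funext j
      simp only [pathPoint, snocPaths, Equiv.coe_fn_mk, prod_Ici_snoc_last, Pi.mul_apply]
    have e3 : ∏ j, ∏ r, mixerAmp (β r) (snocPaths n p (w, b) j r) =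
        (∏ j, mixerAmp (β (Fin.last p)) (w j)) *
          ∏ j, ∏ r : Fin p, mixerAmp (β r.castSucc) (b j r) := by
      rw [← Finset.prod_mul_distrib]
      refine Finset.prod_congr rfl fun j _ => ?_
      rw [Fin.prod_univ_castSucc, mul_comm]
      simp [snocPaths]
    have e4 : ∀ j, z j * (z * w) j = w j := by
      intro j
      rw [Pi.mul_apply, ← mul_assoc, Int.units_mul_self, one_mul]
    rw [Fin.sum_univ_castSucc, e2, e3, mul_add, neg_add, Complex.exp_add]
    simp only [e1, e4]
    ring_nf

/-- The conjugated amplitude belongs to the bra, so the entries of positive index are the steps of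
the bra path and those of negative index the steps of the ket path. -/
lemma star_mixerAmp_mul_mixerAmp (β : ℝ) (b c : ℤˣ) :
    star (mixerAmp β b) * mixerAmp β c =
      (Real.cos β : ℂ) ^ (theta b + theta c) * (Real.sin β : ℂ) ^ (theta (-b) + theta (-c)) *
        Complex.I ^ ((theta (-b) : ℤ) - (theta (-c) : ℤ)) := by
  have h1 : (-1 : ℤˣ) ≠ 1 := by decide
  rcases Int.units_eq_one_or b with rfl | rfl <;> rcases Int.units_eq_one_or c with rfl | rfl <;>
    simp [mixerAmp, theta, h1, -Complex.ofReal_cos, -Complex.ofReal_sin, pow_two] <;>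
    ring_nf <;> simp

/-- The coefficient of `J_e` in the phase of the configurations `a` at the end point `z`. -/
def phaseCoeff (γ : Fin p → ℝ) (z : Spins n) (a : Fin n → Config p) (e : Pairs n) : ℝ :=
  ((z e.1.1 : ℤ) : ℝ) * ((z e.1.2 : ℤ) : ℝ) * Phi γ (a e.1.1 * a e.1.2) / Real.sqrt n

/-- The end point `z` is common to both paths and factors out. Multiplicativity of `starOp` combines
the steps at the sites `j` and `k` into those of the product configuration. -/
lemma sum_cost_pathPoint_sub (γ : Fin p → ℝ) (J : Pairs n → ℝ) (z : Spins n)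
    (a : Fin n → Config p) :
    ∑ r, γ r * cost J (pathPoint z (fun j => (a j).1) r) -
      ∑ r, γ r * cost J (pathPoint z (fun j => (a j).2) r) =
    ∑ e, phaseCoeff γ z a e * J e := by
  simp only [cost, phaseCoeff, Phi, Finset.mul_sum, Finset.sum_mul, Finset.sum_div,
    ← Finset.sum_sub_distrib]
  rw [Finset.sum_comm]
  refine Finset.sum_congr rfl fun e _ => Finset.sum_congr rfl fun r _ => ?_
  simp only [pathPoint, starDiff, starOp_mul, Prod.fst_mul, Prod.snd_mul, Pi.mul_apply]
  simp only [starOp]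
  push_cast
  ring

/-- The operator `C` is diagonal, so bra and ket paths end at the same string `z`, and at each site
their steps form one configuration. -/
lemma energyDensity_eq (γ β : Fin p → ℝ) (J : Pairs n → ℝ) :
    energyDensity γ β J = (1 / 2 ^ n : ℂ) * ∑ z : Spins n, ∑ a : Fin n → Config p,
      (∏ j, Q β (a j)) * ((1 / (n : ℂ)) * cost J z *
        Complex.exp (Complex.I * ∑ e, (phaseCoeff γ z a e : ℂ) * J e)) := by
  have h0 : ((1 / Real.sqrt (2 ^ n) : ℝ) : ℂ) * ((1 / Real.sqrt (2 ^ n) : ℝ) : ℂ) = 1 / 2 ^ n := by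
    rw [← Complex.ofReal_mul, div_mul_div_comm, Real.mul_self_sqrt (by positivity)]
    push_cast; ring
  rw [energyDensity, dotProduct, Finset.mul_sum]
  refine Finset.sum_congr rfl fun z _ => ?_
  rw [Matrix.smul_mulVec, costOp, Pi.smul_apply, Matrix.mulVec_diagonal, Pi.star_apply,
    qaoaState_apply, ← h0, star_mul', star_sum]
  have h1 : star ((1 / Real.sqrt (2 ^ n) : ℝ) : ℂ) = ((1 / Real.sqrt (2 ^ n) : ℝ) : ℂ) :=
    Complex.conj_ofReal _
  rw [h1, ← (Equiv.arrowProdEquivProdArrow (Fin n) (fun _ => Fin p → ℤˣ)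
    (fun _ => Fin p → ℤˣ)).symm.sum_comp, Fintype.sum_prod_type]
  simp only [smul_eq_mul]
  rw [show ∀ s t u v w : ℂ, s * t * (u * (v * (s * w))) = s * s * (u * v * (t * w)) by
    intros; ring, Finset.sum_mul_sum, Finset.mul_sum]
  congr 1
  refine Finset.sum_congr rfl fun b _ => ?_
  rw [Finset.mul_sum]
  refine Finset.sum_congr rfl fun b' _ => ?_
  rw [show (Equiv.arrowProdEquivProdArrow (Fin n) (fun _ => Fin p → ℤˣ)
    (fun _ => Fin p → ℤˣ)).symm (b, b') = fun j => (b j, b' j) from rfl]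
  have h2 : star (∏ j, ∏ r, mixerAmp (β r) (b j r)) * ∏ j, ∏ r, mixerAmp (β r) (b' j r) =
      ∏ j, Q β (b j, b' j) := by
    rw [star_prod, ← Finset.prod_mul_distrib]
    refine Finset.prod_congr rfl fun j _ => ?_
    rw [star_prod, ← Finset.prod_mul_distrib, Q]
    exact Finset.prod_congr rfl fun r _ => star_mixerAmp_mul_mixerAmp _ _ _
  have h3 : star (Complex.exp (-(Complex.I * ∑ r, (γ r : ℂ) * cost J (pathPoint z b r)))) *
      Complex.exp (-(Complex.I * ∑ r, (γ r : ℂ) * cost J (pathPoint z b' r))) =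
      Complex.exp (Complex.I *
        ∑ e, (phaseCoeff γ z (fun j => (b j, b' j)) e : ℂ) * J e) := by
    have h4 := congrArg (fun x : ℝ => (x : ℂ))
      (sum_cost_pathPoint_sub γ J z (fun j => (b j, b' j)))
    simp only [Complex.ofReal_sub, Complex.ofReal_sum, Complex.ofReal_mul] at h4
    rw [← h4, Complex.star_def, ← Complex.exp_conj, ← Complex.exp_add]
    congr 1
    simp only [map_neg, map_mul, map_sum, Complex.conj_I, Complex.conj_ofReal]
    ring
  rw [← h2, ← h3, star_mul']
  ring

/-! ### Averaging over the couplings -/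

lemma integral_exp_I_mul_gaussianReal (t : ℝ) :
    ∫ x, Complex.exp (Complex.I * t * x) ∂(gaussianReal 0 1) = Complex.exp (-(t : ℂ) ^ 2 / 2) := by
  have h := complexMGF_id_gaussianReal (μ := 0) (v := 1) (Complex.I * t)
  rw [complexMGF] at h
  simp only [id] at h
  rw [h]
  congr 1
  rw [mul_pow, Complex.I_sq]
  simp

/-- The derivative of the moment generating function `exp (z² / 2)` at `z = it`. -/
lemma integral_mul_exp_I_mul_gaussianReal (t : ℝ) :
    ∫ x, (x : ℂ) * Complex.exp (Complex.I * t * x) ∂(gaussianReal 0 1) =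
      Complex.I * t * Complex.exp (-(t : ℂ) ^ 2 / 2) := by
  have h1 := hasDerivAt_complexMGF (X := id) (μ := gaussianReal 0 1) (z := Complex.I * t)
    (by simp [integrableExpSet_id_gaussianReal])
  have h2 : complexMGF id (gaussianReal 0 1) = fun z => Complex.exp (z ^ 2 / 2) := by
    funext z
    rw [complexMGF_id_gaussianReal]
    simp
  rw [h2] at h1
  have h3 : HasDerivAt (fun z : ℂ => Complex.exp (z ^ 2 / 2))
      (Complex.exp ((Complex.I * t) ^ 2 / 2) * (Complex.I * t)) (Complex.I * t) := by
    refine ((hasDerivAt_pow 2 (Complex.I * (t : ℂ))).div_const 2).cexp.congr_deriv ?_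
    push_cast
    ring
  have h4 : ∫ x : ℝ, (x : ℂ) * Complex.exp (Complex.I * t * x) ∂(gaussianReal 0 1) = _ :=
    h1.unique h3
  rw [h4, mul_pow, Complex.I_sq, mul_comm]
  congr 2
  ring

lemma norm_exp_I_mul_real (x : ℝ) : ‖Complex.exp (Complex.I * x)‖ = 1 := by
  rw [mul_comm]; exact Complex.norm_exp_ofReal_mul_I x

/-- Written as a product of functions of single couplings, the integrand can be averaged coupling by
coupling. -/
lemma mul_exp_sum_eq_prod {ι : Type*} [Fintype ι] [DecidableEq ι] (τ J : ι → ℝ) (e : ι) :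
    (J e : ℂ) * Complex.exp (Complex.I * ∑ f, (τ f : ℂ) * J f) =
      ∏ f, (if f = e then (J f : ℂ) else 1) * Complex.exp (Complex.I * τ f * J f) := by
  rw [Finset.prod_mul_distrib, Finset.prod_ite_eq' Finset.univ e, if_pos (Finset.mem_univ e),
    Finset.mul_sum, Complex.exp_sum]
  simp only [mul_assoc]

lemma integrable_factor (t : ℝ) (P : Prop) [Decidable P] :
    Integrable (fun x : ℝ => (if P then (x : ℂ) else 1) * Complex.exp (Complex.I * t * x))
      (gaussianReal 0 1) := by
  have h1 : Integrable (fun x : ℝ => if P then (x : ℂ) else 1) (gaussianReal 0 1) := by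
    by_cases h : P
    · simp only [h, if_true]
      exact (memLp_id_gaussianReal (μ := 0) (v := 1) 1).integrable le_rfl |>.ofReal
    · simp only [h, if_false]
      exact integrable_const 1
  refine h1.mul_of_top_left ?_
  refine memLp_top_of_bound (by fun_prop) 1 (Filter.Eventually.of_forall fun x => ?_)
  have := norm_exp_I_mul_real (t * x)
  rw [← this]
  push_cast
  rw [mul_assoc]

lemma integrable_mul_exp (τ : Pairs n → ℝ) (e : Pairs n) :
    Integrable (fun J : Pairs n → ℝ => (J e : ℂ) *
      Complex.exp (Complex.I * ∑ f, (τ f : ℂ) * J f)) (couplingLaw n) := by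
  simp only [mul_exp_sum_eq_prod]
  exact Integrable.fintype_prod_dep
    (f := fun f (x : ℝ) => (if f = e then (x : ℂ) else 1) * Complex.exp (Complex.I * τ f * x))
    fun f => integrable_factor (τ f) (f = e)

lemma integral_mul_exp (τ : Pairs n → ℝ) (e : Pairs n) :
    ∫ J : Pairs n → ℝ, (J e : ℂ) * Complex.exp (Complex.I * ∑ f, (τ f : ℂ) * J f) ∂(couplingLaw n) =
      Complex.I * τ e * Complex.exp (-(1 / 2) * ∑ f, (τ f : ℂ) ^ 2) := by
  simp only [mul_exp_sum_eq_prod, couplingLaw]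
  rw [integral_fintype_prod_eq_prod
    (f := fun f (x : ℝ) => (if f = e then (x : ℂ) else 1) * Complex.exp (Complex.I * τ f * x))]
  have h : ∀ f, ∫ x : ℝ, (if f = e then (x : ℂ) else 1) * Complex.exp (Complex.I * τ f * x)
      ∂(gaussianReal 0 1) = (if f = e then Complex.I * τ f else 1) *
        Complex.exp (-(1 / 2) * (τ f : ℂ) ^ 2) := by
    intro f
    by_cases hf : f = e
    · simp only [hf, if_true]
      rw [integral_mul_exp_I_mul_gaussianReal]
      congr 2; ring
    · simp only [hf, if_false, one_mul]
      rw [integral_exp_I_mul_gaussianReal]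
      congr 1; ring
  rw [Finset.prod_congr rfl fun f _ => h f, Finset.prod_mul_distrib,
    Finset.prod_ite_eq' Finset.univ e, if_pos (Finset.mem_univ e), Finset.mul_sum, Complex.exp_sum]

lemma cost_mul (J : Pairs n → ℝ) (z : Spins n) (w : ℂ) :
    (cost J z : ℂ) * w = ∑ e : Pairs n,
      ((1 / Real.sqrt n * (((z e.1.1 : ℤ) : ℝ) * ((z e.1.2 : ℤ) : ℝ)) : ℝ) : ℂ) * (J e * w) := by
  rw [cost, Finset.mul_sum, Complex.ofReal_sum, Finset.sum_mul]
  refine Finset.sum_congr rfl fun e _ => ?_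
  push_cast
  ring

lemma integrable_cost_mul_exp (z : Spins n) (τ : Pairs n → ℝ) :
    Integrable (fun J : Pairs n → ℝ => (cost J z : ℂ) *
      Complex.exp (Complex.I * ∑ f, (τ f : ℂ) * J f)) (couplingLaw n) := by
  simp only [cost_mul]
  exact integrable_finsetSum _ fun e _ => (integrable_mul_exp τ e).const_mul _

theorem integrable_energyDensity (γ β : Fin p → ℝ) :
    Integrable (energyDensity (n := n) γ β) (couplingLaw n) := by
  have h : energyDensity (n := n) γ β = fun J => (1 / 2 ^ n : ℂ) * ∑ z : Spins n,
      ∑ a : Fin n → Config p, (∏ j, Q β (a j)) * ((1 / (n : ℂ)) * (cost J z *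
        Complex.exp (Complex.I * ∑ e, (phaseCoeff γ z a e : ℂ) * J e))) := by
    funext J
    rw [energyDensity_eq]
    simp only [mul_assoc]
  rw [h]
  refine Integrable.const_mul ?_ _
  exact integrable_finsetSum _ fun z _ => integrable_finsetSum _ fun a _ =>
    ((integrable_cost_mul_exp z _).const_mul _).const_mul _

lemma sum_pairs {M : Type*} [AddCommMonoid M] (f : Fin n → Fin n → M)
    (hf : ∀ j k, f j k = f k j) (h0 : ∀ j, f j j = 0) :
    ∑ j, ∑ k, f j k = ∑ e : Pairs n, f e.1.1 e.1.2 + ∑ e : Pairs n, f e.1.1 e.1.2 := by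
  have h1 : ∑ e : Pairs n, f e.1.1 e.1.2 = ∑ j, ∑ k, if j < k then f j k else 0 := by
    rw [← Fintype.sum_prod_type' (f := fun j k => if j < k then f j k else 0),
      ← Finset.sum_filter]
    exact (Finset.sum_subtype (p := fun e : Fin n × Fin n => e.1 < e.2) _ (by simp)
      (fun e => f e.1 e.2)).symm
  rw [h1]
  nth_rw 3 [Finset.sum_comm]
  simp only [← Finset.sum_add_distrib]
  refine Finset.sum_congr rfl fun j _ => Finset.sum_congr rfl fun k _ => ?_
  rcases lt_trichotomy j k with h | h | h
  · simp [h, h.not_gt]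
  · simp [h, h0]
  · simp [h, h.not_gt, hf j k]

lemma sum_pairs_valueCount (f : Config p → Config p → ℝ) (hf : ∀ b c, f b c = f c b)
    (h0 : ∀ b, f b b = 0) (a : Fin n → Config p) :
    ∑ e : Pairs n, f (a e.1.1) (a e.1.2) =
      1 / 2 * ∑ b, ∑ c, f b c * valueCount a b * valueCount a c := by
  have h := sum_pairs (fun j k => f (a j) (a k)) (fun j k => hf _ _) (fun j => h0 _)
  have h2 : ∑ j, ∑ k, f (a j) (a k) = ∑ b, ∑ c, f b c * valueCount a b * valueCount a c := by
    rw [sum_valueCount_mul a (fun b => ∑ k, f b (a k))]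
    refine Finset.sum_congr rfl fun b _ => ?_
    rw [sum_valueCount_mul a (fun c => f b c), Finset.mul_sum]
    exact Finset.sum_congr rfl fun c _ => by ring
  rw [← h2, h]
  ring

/-- The spins of `z` occur only squared and drop out. What remains is a sum over pairs of sites,
determined by how often each configuration occurs. -/
lemma integral_cost_mul_exp (hn : n ≠ 0) (γ : Fin p → ℝ) (z : Spins n) (a : Fin n → Config p) :
    ∫ J : Pairs n → ℝ, (cost J z : ℂ) *
      Complex.exp (Complex.I * ∑ e, (phaseCoeff γ z a e : ℂ) * J e) ∂(couplingLaw n) =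
    Complex.I / n * ((1 / 2 * ∑ u, ∑ v, Phi γ (u * v) * valueCount a u * valueCount a v : ℝ) : ℂ) *
      ((Real.exp (-(1 / (4 * n)) * ∑ u, ∑ v, Phi γ (u * v) ^ 2 * valueCount a u *
        valueCount a v) : ℝ) : ℂ) := by
  have hn' : (n : ℝ) ≠ 0 := by exact_mod_cast hn
  have hs : Real.sqrt n ≠ 0 := by positivity
  have hss : Real.sqrt n * Real.sqrt n = n := Real.mul_self_sqrt (Nat.cast_nonneg n)
  have hz : ∀ x : ℤˣ, (((x : ℤ) : ℝ)) ^ 2 = 1 := by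
    intro x
    rcases Int.units_eq_one_or x with rfl | rfl <;> simp
  have e1 : ∀ e : Pairs n, phaseCoeff γ z a e ^ 2 = 1 / n * Phi γ (a e.1.1 * a e.1.2) ^ 2 := by
    intro e
    rw [phaseCoeff, div_pow, mul_pow, mul_pow, hz, hz, pow_two (Real.sqrt n), hss]
    ring
  have e2 : ∀ e : Pairs n, 1 / Real.sqrt n * (((z e.1.1 : ℤ) : ℝ) * ((z e.1.2 : ℤ) : ℝ)) *
      phaseCoeff γ z a e = 1 / n * Phi γ (a e.1.1 * a e.1.2) := by
    intro e
    have : 1 / Real.sqrt n * (((z e.1.1 : ℤ) : ℝ) * ((z e.1.2 : ℤ) : ℝ)) * phaseCoeff γ z a e =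
        ((z e.1.1 : ℤ) : ℝ) ^ 2 * ((z e.1.2 : ℤ) : ℝ) ^ 2 * Phi γ (a e.1.1 * a e.1.2) /
          (Real.sqrt n * Real.sqrt n) := by
      rw [phaseCoeff]; field_simp
    rw [this, hz, hz, hss]; ring
  simp only [cost_mul]
  rw [integral_finsetSum _ fun e _ => (integrable_mul_exp _ e).const_mul _]
  simp only [integral_const_mul, integral_mul_exp]
  have e3 : (-(1 / 2) * ∑ f, (phaseCoeff γ z a f : ℂ) ^ 2) =
      ((-(1 / (4 * n)) * ∑ u, ∑ v, Phi γ (u * v) ^ 2 * valueCount a u * valueCount a v : ℝ) :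
        ℂ) := by
    rw [← mul_div_cancel_left₀ (-(1 / (4 * (n : ℝ))) * _) (two_ne_zero' ℝ)]
    rw [show -(1 / 2) * ∑ f, (phaseCoeff γ z a f : ℂ) ^ 2 =
      ((-(1 / 2) * ∑ f, phaseCoeff γ z a f ^ 2 : ℝ) : ℂ) by push_cast; rfl]
    congr 1
    simp only [e1]
    rw [← Finset.mul_sum, sum_pairs_valueCount (fun u v => Phi γ (u * v) ^ 2)
      (fun u v => by rw [mul_comm]) (fun u => by simp [Phi_mul_self]) a]
    ring
  rw [e3, ← Complex.ofReal_exp]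
  have e4 : ∀ e : Pairs n,
      ((1 / Real.sqrt n * (((z e.1.1 : ℤ) : ℝ) * ((z e.1.2 : ℤ) : ℝ)) : ℝ) : ℂ) *
        (Complex.I * (phaseCoeff γ z a e : ℂ)) =
      Complex.I / n * (Phi γ (a e.1.1 * a e.1.2) : ℂ) := by
    intro e
    have := congrArg (fun x : ℝ => Complex.I * (x : ℂ)) (e2 e)
    simp only [Complex.ofReal_mul] at this ⊢
    rw [mul_left_comm, this]
    push_cast
    ring
  simp only [← mul_assoc _ (Complex.I * _), e4]
  rw [← Finset.sum_mul, ← Finset.mul_sum, ← Complex.ofReal_sum,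
    sum_pairs_valueCount (fun u v => Phi γ (u * v)) (fun u v => by rw [mul_comm])
      (fun u => Phi_mul_self γ u) a]

/-- The disorder average of the energy density in the configuration basis. -/
theorem integral_energyDensity (hn : n ≠ 0) (γ β : Fin p → ℝ) :
    ∫ J, energyDensity (n := n) γ β J ∂(couplingLaw n) =
      Complex.I / 2 * ∑ u, ∑ v, (Phi γ (u * v) : ℂ) * S₂ γ β u v n := by
  have h : energyDensity (n := n) γ β = fun J => (1 / 2 ^ n : ℂ) * ∑ z : Spins n,
      ∑ a : Fin n → Config p, (∏ j, Q β (a j)) * ((1 / (n : ℂ)) * (cost J z *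
        Complex.exp (Complex.I * ∑ e, (phaseCoeff γ z a e : ℂ) * J e))) := by
    funext J
    rw [energyDensity_eq]
    simp only [mul_assoc]
  have hi : ∀ (z : Spins n) (a : Fin n → Config p), Integrable (fun J : Pairs n → ℝ =>
      (∏ j, Q β (a j)) * ((1 / (n : ℂ)) * (cost J z *
        Complex.exp (Complex.I * ∑ e, (phaseCoeff γ z a e : ℂ) * J e)))) (couplingLaw n) :=
    fun z a => ((integrable_cost_mul_exp z _).const_mul _).const_mul _
  rw [h, integral_const_mul, integral_finsetSum _ fun z _ => integrable_finsetSum _ fun a _ =>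
    hi z a]
  simp only [fun z : Spins n => integral_finsetSum (μ := couplingLaw n) Finset.univ
    fun a _ => hi z a, integral_const_mul, integral_cost_mul_exp hn]
  -- No summand depends on `z` any more; the number `2^n` of strings cancels the normalization of
  -- the state.
  rw [Finset.sum_const, Finset.card_univ, nsmul_eq_mul, ← mul_assoc]
  have hc : (1 / 2 ^ n : ℂ) * (Fintype.card (Spins n) : ℂ) = 1 := by
    simp [Fintype.card_units_int]
  rw [hc, one_mul]
  simp only [prod_valueCount _ (Q β)]
  rw [sum_valueCount n fun N => (∏ a, Q β a ^ N a) * (1 / (n : ℂ) * (Complex.I / n *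
    ((1 / 2 * ∑ u, ∑ v, Phi γ (u * v) * N u * N v : ℝ) : ℂ) *
      ((Real.exp (-(1 / (4 * n)) * ∑ u, ∑ v, Phi γ (u * v) ^ 2 * N u * N v) : ℝ) : ℂ)))]
  simp only [S₂, Finset.mul_sum]
  rw [Finset.sum_congr rfl fun u _ => Finset.sum_comm, Finset.sum_comm]
  refine Finset.sum_congr rfl fun N _ => ?_
  rw [Complex.ofReal_sum]
  simp only [Complex.ofReal_sum, Finset.mul_sum, Finset.sum_mul, weight]
  refine Finset.sum_congr rfl fun u _ => Finset.sum_congr rfl fun v _ => ?_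
  push_cast
  ring

/-- Symmetrization of `xy - x'y' = ½ [(x + x')(y - y') + (y + y')(x - x')]`: after summation against
`W_u W_v` both terms on the right give the same value. -/
lemma V_eq (γ β : Fin p → ℝ) (D : List (Config p)) :
    V γ β D = Complex.I / 2 *
      ∑ u, ∑ v, (Phi γ (u * v) : ℂ) * (W γ β D u * W γ β D v) := by
  have h1 : ∀ u v : Config p, ∀ r, (starDiff (u * v) r : ℂ) =
      ((starSum u r : ℂ) * starDiff v r + (starSum v r : ℂ) * starDiff u r) / 2 := by
    intro u v r
    simp only [starDiff, starSum, starOp_mul, Prod.fst_mul, Prod.snd_mul, Pi.mul_apply]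
    push_cast
    ring
  rw [V]
  congr 1
  have h2 : ∀ r, (γ r : ℂ) * (∑ u, (starSum u r : ℂ) * W γ β D u) *
      (∑ v, (starDiff v r : ℂ) * W γ β D v) =
      ∑ u, ∑ v, (γ r : ℂ) * starDiff (u * v) r * (W γ β D u * W γ β D v) := by
    intro r
    have e1 : (∑ u, (starSum u r : ℂ) * W γ β D u) * (∑ v, (starDiff v r : ℂ) * W γ β D v) =
        ∑ u, ∑ v, (starSum u r : ℂ) * starDiff v r * (W γ β D u * W γ β D v) := by
      rw [Finset.sum_mul_sum]
      exact Finset.sum_congr rfl fun u _ => Finset.sum_congr rfl fun v _ => by ring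
    have e2 : (∑ u, (starSum u r : ℂ) * W γ β D u) * (∑ v, (starDiff v r : ℂ) * W γ β D v) =
        ∑ u, ∑ v, (starSum v r : ℂ) * starDiff u r * (W γ β D u * W γ β D v) := by
      rw [e1, Finset.sum_comm]
      exact Finset.sum_congr rfl fun u _ => Finset.sum_congr rfl fun v _ => by ring
    have e3 : (∑ u, (starSum u r : ℂ) * W γ β D u) * (∑ v, (starDiff v r : ℂ) * W γ β D v) =
        ∑ u, ∑ v, (starDiff (u * v) r : ℂ) * (W γ β D u * W γ β D v) := by
      have e4 : ∀ x a b : ℂ, x = a → x = b → x = (a + b) / 2 := by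
        rintro x a b rfl rfl; ring
      rw [e4 _ _ _ e1 e2, ← Finset.sum_add_distrib, Finset.sum_div]
      refine Finset.sum_congr rfl fun u _ => ?_
      rw [← Finset.sum_add_distrib, Finset.sum_div]
      refine Finset.sum_congr rfl fun v _ => ?_
      rw [h1]; ring
    rw [mul_assoc, e3, Finset.mul_sum]
    refine Finset.sum_congr rfl fun u _ => ?_
    rw [Finset.mul_sum]
    exact Finset.sum_congr rfl fun v _ => by ring
  rw [Finset.sum_congr rfl fun r _ => h2 r, Finset.sum_comm]
  refine Finset.sum_congr rfl fun u _ => ?_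
  rw [Finset.sum_comm]
  refine Finset.sum_congr rfl fun v _ => ?_
  rw [← Finset.sum_mul, Phi]
  push_cast
  rfl

theorem tendsto_integral_energyDensity {γ : Fin p → ℝ} (β : Fin p → ℝ) {D : List (Config p)}
    (hD : IsIndexing γ D) :
    Filter.Tendsto (fun n : ℕ => ∫ J, energyDensity (n := n) γ β J ∂(couplingLaw n))
      Filter.atTop (nhds (V γ β D)) := by
  rw [V_eq]
  have h : Filter.Tendsto (fun n : ℕ => Complex.I / 2 *
      ∑ u, ∑ v, (Phi γ (u * v) : ℂ) * S₂ γ β u v n) Filter.atTop (nhds (Complex.I / 2 *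
      ∑ u, ∑ v, (Phi γ (u * v) : ℂ) * (W γ β D u * W γ β D v))) :=
    Filter.Tendsto.const_mul _ (tendsto_finsetSum _ fun u _ => tendsto_finsetSum _ fun v _ =>
      (tendsto_S₂ β hD u v).const_mul _)
  refine h.congr' ?_
  filter_upwards [Filter.eventually_ge_atTop 1] with n hn
  rw [integral_energyDensity (by omega)]

end Energy

/-! ### The operation count of the procedure -/

section OperationCount

lemma length_flatMap_le {α β : Type*} (l : List α) (f : α → List β) (k : ℕ)
    (h : ∀ a ∈ l, (f a).length ≤ k) : (l.flatMap f).length ≤ l.length * k := by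
  induction l with
  | nil => simp
  | cons a l ih =>
    rw [List.flatMap_cons, List.length_append, List.length_cons, Nat.add_mul, one_mul, add_comm]
    exact add_le_add (ih fun b hb => h b (by simp [hb])) (h a (by simp))

lemma card_config (p : ℕ) : Fintype.card (Config p) = 4 ^ p := by
  simp [← mul_pow]

lemma length_allConfigs (p : ℕ) : (allConfigs p).length = 4 ^ p := by
  rw [allConfigs, Finset.length_toList, Finset.card_univ, card_config]

lemma length_symmConfigs_le (p : ℕ) : (symmConfigs p).length ≤ 4 ^ p :=
  (List.length_filter_le _ _).trans (length_allConfigs p).le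

lemma length_le_of_nodup {D : List (Config p)} (hD : D.Nodup) : D.length ≤ 4 ^ p := by
  rw [← card_config p]; exact hD.length_le_card

lemma length_progFactor_le (r : Fin p) (b : ℤˣ) (c : Bool) : (progFactor r b c).length ≤ 4 := by
  unfold progFactor
  split_ifs <;> simp

/-- The double loops over configurations cost a constant times `4^p * 4^p`. The loops over positions
contribute factors `p`, absorbed by `p ≤ 4^p`; with these crude bounds the constants add up to less
than `64`. -/
lemma length_procedure_le (D : List (Config p)) (hD : D.Nodup) :
    (procedure D).length ≤ 64 * 16 ^ p := by
  have hd := length_le_of_nodup hD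
  have hs := length_symmConfigs_le p
  have ha := length_allConfigs p
  have hp : p ≤ 4 ^ p := (Nat.lt_pow_self (by norm_num)).le
  have h1 : 1 ≤ 4 ^ p := Nat.one_le_pow _ _ (by norm_num)
  have h16 : 16 ^ p = 4 ^ p * 4 ^ p := by rw [← mul_pow]; norm_num
  have lT : (progTrig p).length ≤ p * 2 := by
    refine (length_flatMap_le _ _ 2 ?_).trans (by simp)
    simp
  have lQ : (progQ p).length ≤ 4 ^ p * (1 + p * 8 + 1) := by
    rw [← ha]
    refine length_flatMap_le _ _ _ fun a _ => ?_
    simp only [List.length_append, List.length_singleton]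
    gcongr
    simpa using length_flatMap_le (List.finRange p)
      (fun r => progFactor r (a.1 r) false ++ progFactor r (a.2 r) true) 8 fun r _ => by
        rw [List.length_append]
        exact add_le_add (length_progFactor_le _ _ _) (length_progFactor_le _ _ _)
  have lP : (progPhi p).length ≤ 4 ^ p * (1 + p * 3 + 1) := by
    rw [← ha]
    refine length_flatMap_le _ _ _ fun c _ => ?_
    simp only [List.length_append, List.length_singleton]
    gcongr
    refine (length_flatMap_le _ _ 3 ?_).trans (by simp)
    simp
  have lX : (progX p).length ≤ 4 ^ p * (1 + 4 ^ p * 2 + 4) := by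
    rw [← ha]
    refine length_flatMap_le _ _ _ fun c _ => ?_
    simp only [List.length_append, List.length_cons, List.length_nil]
    gcongr
    refine (length_flatMap_le _ _ 2 ?_).trans (by gcongr; rw [ha]; exact hs)
    simp
  have lR : (progR D).length ≤ 4 ^ p + 4 ^ p * (4 ^ p * 7) := by
    rw [progR, List.length_append, List.length_map]
    refine add_le_add hd ?_
    refine (length_flatMap_le _ _ (4 ^ p * 7) fun s _ => ?_).trans ?_
    · refine (length_flatMap_le _ _ 7 ?_).trans (by gcongr)
      simp [progRK]
    · gcongr
      simpa using (Nat.sub_le _ _).trans hd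
  have lW : (progW D).length ≤ 4 ^ p + 4 ^ p * (1 + 4 ^ p * 6 + 3) := by
    rw [progW, List.length_append, List.length_map]
    refine add_le_add hs ?_
    refine (length_flatMap_le _ _ (1 + 4 ^ p * 6 + 3) fun s _ => ?_).trans (by gcongr)
    simp only [List.length_append, List.length_cons, List.length_nil]
    gcongr
    refine (length_flatMap_le _ _ 6 ?_).trans (by gcongr)
    simp [progRK]
  have lV : (progV p).length ≤ 1 + p * (2 + 4 ^ p * 6 + 3) + 4 := by
    simp only [progV, List.length_append, List.length_cons, List.length_nil]
    gcongr
    refine (length_flatMap_le _ _ (2 + 4 ^ p * 6 + 3) fun r _ => ?_).trans (by simp)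
    simp only [List.length_append, List.length_cons, List.length_nil]
    gcongr
    refine (length_flatMap_le _ _ 6 ?_).trans (by rw [ha])
    simp
  simp only [procedure, List.length_append]
  rw [h16]
  generalize 4 ^ p = M at *
  nlinarith [Nat.mul_le_mul h1 h1, Nat.mul_le_mul hp (le_refl M), Nat.mul_le_mul h1 (le_refl M)]

end OperationCount

/-! ### Straight-line programs -/

section Programs

variable {ι : Type} [DecidableEq ι]

set_option linter.unusedSectionVars false

/-- The register that an instruction overwrites. -/
def Instr.dest : Instr ι → ι
  | .rat d _ => d
  | .imag d => d
  | .copy d _ => d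
  | .neg d _ => d
  | .add d _ _ => d
  | .sub d _ _ => d
  | .mul d _ _ => d
  | .exp d _ => d
  | .cos d _ => d
  | .sin d _ => d

lemma exec_nil (m : ι → ℂ) : exec [] m = m := rfl

lemma exec_cons (i : Instr ι) (l : List (Instr ι)) (m : ι → ℂ) :
    exec (i :: l) m = exec l (i.run m) := rfl

lemma exec_append (l l' : List (Instr ι)) (m : ι → ℂ) :
    exec (l ++ l') m = exec l' (exec l m) := List.foldl_append

lemma exec_of_forall_dest_ne {prog : List (Instr ι)} {x : ι} (h : ∀ i ∈ prog, i.dest ≠ x)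
    (m : ι → ℂ) : exec prog m x = m x := by
  induction prog generalizing m with
  | nil => rfl
  | cons i l ih =>
    rw [exec_cons, ih fun j hj => h j (by simp [hj])]
    have hx : x ≠ i.dest := (h i (by simp)).symm
    cases i <;> simp only [Instr.dest] at hx <;> simp [Instr.run, Function.update_of_ne hx]

/-- The program writes to no register of `S`. -/
def Avoids (S : Set ι) (prog : List (Instr ι)) : Prop := ∀ i ∈ prog, i.dest ∉ S

lemma avoids_nil (S : Set ι) : Avoids S [] := by simp [Avoids]

lemma avoids_cons {S : Set ι} {i : Instr ι} {l : List (Instr ι)} :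
    Avoids S (i :: l) ↔ i.dest ∉ S ∧ Avoids S l := by simp [Avoids]

lemma avoids_append {S : Set ι} {l l' : List (Instr ι)} :
    Avoids S (l ++ l') ↔ Avoids S l ∧ Avoids S l' := by
  simp only [Avoids, List.mem_append]
  exact ⟨fun h => ⟨fun i hi => h i (Or.inl hi), fun i hi => h i (Or.inr hi)⟩,
    fun h i hi => hi.elim (h.1 i) (h.2 i)⟩

lemma avoids_flatMap {α : Type*} {S : Set ι} {l : List α} {f : α → List (Instr ι)} :
    Avoids S (l.flatMap f) ↔ ∀ a ∈ l, Avoids S (f a) := by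
  simp only [Avoids, List.mem_flatMap]
  exact ⟨fun h a ha i hi => h i ⟨a, ha, hi⟩, fun h i ⟨a, ha, hi⟩ => h a ha i hi⟩

lemma avoids_map {α : Type*} {S : Set ι} {l : List α} {f : α → Instr ι} :
    Avoids S (l.map f) ↔ ∀ a ∈ l, (f a).dest ∉ S := by
  simp [Avoids]

/-- A frame rule: values established on `S` persist through any code that does not write there. -/
lemma Avoids.eqOn {S : Set ι} {prog : List (Instr ι)} (h : Avoids S prog) {m spec : ι → ℂ}
    (hm : Set.EqOn m spec S) : Set.EqOn (exec prog m) spec S := fun x hx => by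
  rw [exec_of_forall_dest_ne (fun i hi he => h i hi (he ▸ hx)), hm hx]

lemma Avoids.exec_apply {S : Set ι} {prog : List (Instr ι)} (h : Avoids S prog) {x : ι}
    (hx : x ∈ S) (m : ι → ℂ) : exec prog m x = m x :=
  exec_of_forall_dest_ne (fun i hi he => h i hi (he ▸ hx)) m

/-- A loop that adds up the values `v a` in the register `c`. -/
lemma exec_flatMap_add {α : Type*} {S : Set ι} {spec : ι → ℂ} (c : ι) {l : List α}
    {f : α → List (Instr ι)} (v : α → ℂ) (hav : ∀ a ∈ l, Avoids S (f a))
    (hstep : ∀ a ∈ l, ∀ m, Set.EqOn m spec S → exec (f a) m c = m c + v a) {m : ι → ℂ}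
    (hm : Set.EqOn m spec S) : exec (l.flatMap f) m c = m c + (l.map v).sum := by
  induction l generalizing m with
  | nil => simp [exec_nil]
  | cons a l ih =>
    rw [List.flatMap_cons, exec_append, ih (fun b hb => hav b (by simp [hb]))
      (fun b hb => hstep b (by simp [hb])) ((hav a (by simp)).eqOn hm),
      hstep a (by simp) m hm, List.map_cons, List.sum_cons, add_assoc]

/-- A loop that multiplies the values `v a` in the register `c`. -/
lemma exec_flatMap_mul {α : Type*} {S : Set ι} {spec : ι → ℂ} (c : ι) {l : List α}
    {f : α → List (Instr ι)} (v : α → ℂ) (hav : ∀ a ∈ l, Avoids S (f a))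
    (hstep : ∀ a ∈ l, ∀ m, Set.EqOn m spec S → exec (f a) m c = m c * v a) {m : ι → ℂ}
    (hm : Set.EqOn m spec S) : exec (l.flatMap f) m c = m c * (l.map v).prod := by
  induction l generalizing m with
  | nil => simp [exec_nil]
  | cons a l ih =>
    rw [List.flatMap_cons, exec_append, ih (fun b hb => hav b (by simp [hb]))
      (fun b hb => hstep b (by simp [hb])) ((hav a (by simp)).eqOn hm),
      hstep a (by simp) m hm, List.map_cons, List.prod_cons, mul_assoc]

/-- A loop whose body `f a` fills the registers `T a`. -/
lemma eqOn_exec_flatMap {α : Type*} {S : Set ι} {spec : ι → ℂ} {l : List α}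
    {f : α → List (Instr ι)} (T : α → Set ι) (hav : ∀ a ∈ l, Avoids S (f a))
    (hdisj : ∀ a ∈ l, ∀ b ∈ l, a ≠ b → Avoids (T b) (f a))
    (hval : ∀ a ∈ l, ∀ m, Set.EqOn m spec S → Set.EqOn (exec (f a) m) spec (T a)) {m : ι → ℂ}
    (hm : Set.EqOn m spec S) :
    Set.EqOn (exec (l.flatMap f) m) spec (S ∪ {x | ∃ a ∈ l, x ∈ T a}) := by
  induction l using List.reverseRecOn generalizing m with
  | nil => simpa [exec_nil] using hm
  | append_singleton l a ih =>
    rw [List.flatMap_append, exec_append, List.flatMap_singleton]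
    have h := ih (fun b hb => hav b (by simp [hb]))
      (fun b hb c hc => hdisj b (by simp [hb]) c (by simp [hc]))
      (fun b hb => hval b (by simp [hb])) hm
    have hS : Set.EqOn (exec (l.flatMap f) m) spec S := fun x hx => h (Or.inl hx)
    rintro x (hx | ⟨b, hb, hx⟩)
    · exact (hav a (by simp)).eqOn hS hx
    -- A repeated index is simply computed again, so `l` may have duplicates.
    · by_cases hab : a = b
      · subst hab; exact hval a (by simp) _ hS hx
      · have hbl : b ∈ l := by
          rcases List.mem_append.1 hb with h' | h'
          · exact h'
          · exact absurd (List.mem_singleton.1 h').symm hab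
        exact (hdisj a (by simp) b hb hab).eqOn (fun y hy => h (Or.inr ⟨b, hbl, hy⟩)) hx

end Programs

/-! ### The procedure computes `W` and `V` -/

section Correctness

open Instr Reg

/-- The values that the registers hold in the end (the scratch registers are immaterial). -/
def target (γ β : Fin p → ℝ) (D : List (Config p)) : Reg p → ℂ
  | .gamma k => γ k
  | .beta k => β k
  | .cosBeta k => Real.cos (β k)
  | .sinBeta k => Real.sin (β k)
  | .phiSq c => (Phi γ c : ℂ) ^ 2
  | .q a => Q β a
  | .x b => X γ β b
  | .r j => R γ β D j
  | .w u => W γ β D u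
  | .v => V γ β D
  | .tmp => 0
  | .acc => 0
  | .acc' => 0

/-- The phase of the procedure in which a register gets its final value. -/
def stage (D : List (Config p)) : Reg p → ℕ
  | .gamma _ => 0
  | .beta _ => 0
  | .cosBeta _ => 1
  | .sinBeta _ => 1
  | .q _ => 2
  | .phiSq _ => 3
  | .x _ => 4
  -- Entries of `R` outside `D` are never computed, so they are classed with the scratch registers,
  -- after the last phase.
  | .r j => if j ∈ D then 5 else 8
  | .w _ => 6
  | .v => 7
  | .tmp => 8
  | .acc => 8
  | .acc' => 8

/-- The registers that are final after the phase `k`. -/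
def ready (D : List (Config p)) (k : ℕ) : Set (Reg p) := {y | stage D y ≤ k}

lemma mem_ready {D : List (Config p)} {k : ℕ} {y : Reg p} : y ∈ ready D k ↔ stage D y ≤ k :=
  Iff.rfl

lemma avoids_progFactor {S : Set (Reg p)} (h1 : acc ∉ S) (h2 : tmp ∉ S) (r : Fin p) (b : ℤˣ)
    (c : Bool) : Avoids S (progFactor r b c) := by
  unfold progFactor
  split_ifs <;> simp [avoids_cons, avoids_nil, Instr.dest, h1, h2]

lemma avoids_progRK {S : Set (Reg p)} (h1 : acc' ∉ S) (h2 : tmp ∉ S) (b c : Config p) :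
    Avoids S (progRK b c) := by
  simp [progRK, avoids_cons, avoids_nil, Instr.dest, h1, h2]

variable (γ β : Fin p → ℝ) (D : List (Config p)) {m : Reg p → ℂ}

lemma eqOn_progTrig (hm : Set.EqOn m (target γ β D) (ready D 0)) :
    Set.EqOn (exec (progTrig p) m) (target γ β D) (ready D 1) := by
  refine (eqOn_exec_flatMap (S := ready D 0) (spec := target γ β D)
    (fun r => {cosBeta r, sinBeta r}) ?_ ?_ ?_ hm).mono ?_
  · intro r _
    simp [avoids_cons, avoids_nil, Instr.dest, mem_ready, stage]
  · intro r _ s _ hrs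
    simp [avoids_cons, avoids_nil, Instr.dest, hrs]
  · intro r _ m hm
    have hb : m (beta r) = β r := hm (by simp [mem_ready, stage])
    rintro y (rfl | rfl) <;> simp [exec_cons, exec_nil, Instr.run, hb, target]
  · intro y hy
    rw [mem_ready] at hy
    cases y <;> simp [stage, mem_ready] at hy ⊢
    split_ifs at hy <;> omega

lemma exec_progFactor (r : Fin p) (b : ℤˣ) (c : Bool) (m : Reg p → ℂ) :
    exec (progFactor r b c) m acc = m acc * (m (cosBeta r) ^ theta b * m (sinBeta r) ^ theta (-b) *
      (if c then -Complex.I else Complex.I) ^ theta (-b)) := by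
  have h1 : (-1 : ℤˣ) ≠ 1 := by decide
  rcases Int.units_eq_one_or b with rfl | rfl <;> cases c <;>
    simp [progFactor, exec_cons, exec_nil, Instr.run, theta, h1, mul_assoc]

lemma I_pow_theta (b c : ℤˣ) :
    Complex.I ^ theta (-b) * (-Complex.I) ^ theta (-c) =
      Complex.I ^ ((theta (-b) : ℤ) - (theta (-c) : ℤ)) := by
  rw [zpow_sub₀ Complex.I_ne_zero, zpow_natCast, zpow_natCast, div_eq_mul_inv, ← inv_pow,
    Complex.inv_I]

lemma eqOn_progQ (hm : Set.EqOn m (target γ β D) (ready D 1)) :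
    Set.EqOn (exec (progQ p) m) (target γ β D) (ready D 2) := by
  have hF : ∀ r b c, Avoids (ready D 1) (progFactor r b c) :=
    fun r b c => avoids_progFactor (by simp [mem_ready, stage]) (by simp [mem_ready, stage]) r b c
  refine (eqOn_exec_flatMap (S := ready D 1) (spec := target γ β D) (fun a => {q a})
    ?_ ?_ ?_ hm).mono ?_
  · intro a _
    simp [avoids_cons, avoids_nil, avoids_append, avoids_flatMap, Instr.dest, mem_ready, stage, hF]
  · intro a _ b _ hab
    simp [avoids_cons, avoids_nil, avoids_append, avoids_flatMap, Instr.dest, hab,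
      avoids_progFactor]
  · intro a _ m hm
    rintro y rfl
    rw [exec_append, exec_append]
    have h0 : Avoids (ready D 1) [rat acc 1] := by
      simp [avoids_cons, avoids_nil, Instr.dest, mem_ready, stage]
    have h := exec_flatMap_mul (S := ready D 1) (spec := target γ β D) acc (l := List.finRange p)
      (f := fun r => progFactor r (a.1 r) false ++ progFactor r (a.2 r) true)
      (fun j => (Real.cos (β j) : ℂ) ^ (theta (a.1 j) + theta (a.2 j)) *
        (Real.sin (β j) : ℂ) ^ (theta (-a.1 j) + theta (-a.2 j)) *
        Complex.I ^ ((theta (-a.1 j) : ℤ) - (theta (-a.2 j) : ℤ)))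
      (fun r _ => avoids_append.2 ⟨hF _ _ _, hF _ _ _⟩) (fun r _ m hm => by
        have hm' := (hF r (a.1 r) false).eqOn hm
        have e1 : m (cosBeta r) = Real.cos (β r) := hm (by simp [mem_ready, stage])
        have e2 : m (sinBeta r) = Real.sin (β r) := hm (by simp [mem_ready, stage])
        have e3 : exec (progFactor r (a.1 r) false) m (cosBeta r) = Real.cos (β r) :=
          hm' (by simp [mem_ready, stage])
        have e4 : exec (progFactor r (a.1 r) false) m (sinBeta r) = Real.sin (β r) :=
          hm' (by simp [mem_ready, stage])
        rw [exec_append, exec_progFactor, e3, e4, exec_progFactor, e1, e2, ← I_pow_theta]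
        simp only [if_true, Bool.false_eq_true, if_false, pow_add]
        ring) (h0.eqOn hm)
    simp only [exec_cons, exec_nil] at h ⊢
    simp only [Instr.run, Function.update_self] at h ⊢
    rw [h]
    simp [target, Q, Fin.prod_univ_def]
  · intro y hy
    rw [mem_ready] at hy
    cases y <;> simp [stage, mem_ready, mem_allConfigs, -Prod.exists] at hy ⊢
    split_ifs at hy <;> omega

lemma eqOn_progPhi (hm : Set.EqOn m (target γ β D) (ready D 2)) :
    Set.EqOn (exec (progPhi p) m) (target γ β D) (ready D 3) := by
  refine (eqOn_exec_flatMap (S := ready D 2) (spec := target γ β D) (fun a => {phiSq a})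
    ?_ ?_ ?_ hm).mono ?_
  · intro a _
    simp [avoids_cons, avoids_nil, avoids_append, avoids_flatMap, Instr.dest, mem_ready, stage]
  · intro a _ b _ hab
    simp [avoids_cons, avoids_nil, avoids_append, avoids_flatMap, Instr.dest, hab]
  · intro c _ m hm
    rintro y rfl
    rw [exec_append, exec_append]
    have h0 : Avoids (ready D 2) [rat acc 0] := by
      simp [avoids_cons, avoids_nil, Instr.dest, mem_ready, stage]
    have h := exec_flatMap_add (S := ready D 2) (spec := target γ β D) acc (l := List.finRange p)
      (f := fun r => [rat tmp (starDiff c r), mul tmp (gamma r) tmp, add acc acc tmp])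
      (fun r => (γ r : ℂ) * starDiff c r)
      (fun r _ => by simp [avoids_cons, avoids_nil, Instr.dest, mem_ready, stage])
      (fun r _ m hm => by
        have e1 : m (gamma r) = γ r := hm (by simp [mem_ready, stage])
        simp [exec_cons, exec_nil, Instr.run, e1]) (h0.eqOn hm)
    simp only [exec_cons, exec_nil] at h ⊢
    simp only [Instr.run, Function.update_self] at h ⊢
    rw [h, ← Fin.sum_univ_def]
    simp [target, Phi, pow_two]
  · intro y hy
    rw [mem_ready] at hy
    cases y <;> simp [stage, mem_ready, mem_allConfigs, -Prod.exists] at hy ⊢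
    split_ifs at hy <;> omega

lemma sum_map_symmConfigs (f : Config p → ℂ) :
    ((symmConfigs p).map f).sum = ∑ a : Config p with IsMirror a, f a := by
  have hn : (symmConfigs p).Nodup := (Finset.nodup_toList _).filter _
  rw [← List.sum_toFinset f hn]
  refine Finset.sum_congr ?_ fun _ _ => rfl
  ext a
  simp [symmConfigs, mem_allConfigs]

lemma eqOn_progX (hm : Set.EqOn m (target γ β D) (ready D 3)) :
    Set.EqOn (exec (progX p) m) (target γ β D) (ready D 4) := by
  refine (eqOn_exec_flatMap (S := ready D 3) (spec := target γ β D) (fun a => {Reg.x a})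
    ?_ ?_ ?_ hm).mono ?_
  · intro a _
    simp [avoids_cons, avoids_nil, avoids_append, avoids_flatMap, Instr.dest, mem_ready, stage]
  · intro a _ b _ hab
    simp [avoids_cons, avoids_nil, avoids_append, avoids_flatMap, Instr.dest, hab]
  · intro b _ m hm
    rintro y rfl
    rw [exec_append, exec_append]
    have h0 : Avoids (ready D 3) [rat acc 0] := by
      simp [avoids_cons, avoids_nil, Instr.dest, mem_ready, stage]
    have h1 : Avoids (ready D 3) ((symmConfigs p).flatMap fun a =>
        [mul tmp (q a) (phiSq (a * b)), add acc acc tmp]) := by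
      simp [avoids_cons, avoids_nil, avoids_flatMap, Instr.dest, mem_ready, stage]
    have h := exec_flatMap_add (S := ready D 3) (spec := target γ β D) acc (l := symmConfigs p)
      (f := fun a => [mul tmp (q a) (phiSq (a * b)), add acc acc tmp])
      (fun a => Q β a * (Phi γ (a * b) : ℂ) ^ 2)
      (fun r _ => by simp [avoids_cons, avoids_nil, Instr.dest, mem_ready, stage])
      (fun a _ m hm => by
        have e1 : m (q a) = Q β a := hm (by simp [mem_ready, stage])
        have e2 : m (phiSq (a * b)) = (Phi γ (a * b) : ℂ) ^ 2 := hm (by simp [mem_ready, stage])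
        simp [exec_cons, exec_nil, Instr.run, e1, e2]) (h0.eqOn hm)
    have hq := h1.eqOn (h0.eqOn hm) (x := q b) (by simp [mem_ready, stage])
    generalize exec ((symmConfigs p).flatMap fun a =>
      [mul tmp (q a) (phiSq (a * b)), add acc acc tmp]) (exec [rat acc 0] m) = m' at h hq ⊢
    simp only [exec_cons, exec_nil] at h ⊢
    simp only [Instr.run, Function.update_self] at h
    rw [sum_map_symmConfigs] at h
    simp [Instr.run, h, hq, target, X, F]
    norm_num
  · intro y hy
    rw [mem_ready] at hy
    cases y <;> simp [stage, mem_ready, mem_allConfigs, -Prod.exists] at hy ⊢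
    split_ifs at hy <;> omega

/-- The register of `R` enters with its current value, so the statement serves both the sweeps,
where `R` is still changing, and the later computation of `Y`. -/
lemma exec_progRK {m : Reg p → ℂ} (hm : Set.EqOn m (target γ β D) (ready D 4)) (b c : Config p) :
    exec (progRK b c) m tmp = m (Reg.r b) * K γ β b c := by
  have e1 : m (phiSq (bar b * c)) = (Phi γ (bar b * c) : ℂ) ^ 2 :=
    hm (by simp [mem_ready, stage])
  have e2 : m (phiSq (b * c)) = (Phi γ (b * c) : ℂ) ^ 2 := hm (by simp [mem_ready, stage])
  have e3 : m (Reg.x b) = X γ β b := hm (by simp [mem_ready, stage])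
  rw [show m (Reg.r b) * K γ β b c = m (Reg.r b) * (1 / 2 * (X γ β b *
    ((Phi γ (bar b * c) : ℂ) ^ 2 - (Phi γ (b * c) : ℂ) ^ 2))) by rw [K]; ring]
  simp [progRK, exec_cons, exec_nil, Instr.run, e1, e2, e3]

/-- One sweep over the array `R`, with the source `s`. -/
lemma exec_sweep (s : Config p) {l : List (Config p)} (hl : l.Nodup) {m : Reg p → ℂ}
    (hm : Set.EqOn m (target γ β D) (ready D 4)) (j : Config p) :
    exec (l.flatMap fun j => progRK s j ++ [exp tmp tmp, mul (Reg.r j) (Reg.r j) tmp]) m (Reg.r j) =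
      if j ∈ l then m (Reg.r j) * Complex.exp (m (Reg.r s) * K γ β s j) else m (Reg.r j) := by
  induction l generalizing m with
  | nil => simp [exec_nil]
  | cons a l ih =>
    have hav : Avoids (ready D 4)
        (progRK s a ++ [exp tmp tmp, mul (Reg.r a) (Reg.r a) tmp]) := by
      simp only [avoids_append, avoids_cons, avoids_nil, Instr.dest, mem_ready, stage]
      refine ⟨avoids_progRK (by simp [mem_ready, stage]) (by simp [mem_ready, stage]) s a, ?_⟩
      split_ifs <;> simp
    have hr : ∀ k, exec (progRK s a) m (Reg.r k) = m (Reg.r k) := fun k =>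
      (avoids_progRK (S := Set.range Reg.r) (by simp) (by simp) s a).exec_apply ⟨k, rfl⟩ m
    have hblock : ∀ k, exec (progRK s a ++ [exp tmp tmp, mul (Reg.r a) (Reg.r a) tmp]) m
        (Reg.r k) = if k = a then m (Reg.r a) * Complex.exp (m (Reg.r s) * K γ β s a)
          else m (Reg.r k) := by
      intro k
      rw [exec_append]
      have hRK := exec_progRK γ β D hm s a
      by_cases hk : k = a
      · subst hk; simp [exec_cons, exec_nil, Instr.run, hRK, hr]
      · simp [exec_cons, exec_nil, Instr.run, hr, hk]
    rw [List.flatMap_cons, exec_append, ih (List.nodup_cons.1 hl).2 (hav.eqOn hm), hblock, hblock]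
    -- The sweep works in place, and `j = s` may be reached before other entries. The vanishing
    -- diagonal of `K` leaves the source unchanged.
    have hK : K γ β s s = 0 := (playsWell_self γ s).K_eq_zero β
    have hal := (List.nodup_cons.1 hl).1
    have hs : (if s = a then m (Reg.r a) * Complex.exp (m (Reg.r s) * K γ β s a)
        else m (Reg.r s)) = m (Reg.r s) := by
      split_ifs with h
      · rw [← h, hK]; simp
      · rfl
    rw [hs]
    by_cases hj : j = a
    · subst hj; simp [hal]
    · simp [hj]

/-- The intermediate arrays differ from the target, so the induction carries an arbitrary current
array `ρ` alongside the registers that are already final. -/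
lemma exec_sweeps (hD : D.Nodup) {L : List (Config p)} (hL : ∀ s ∈ L, s ∈ D) {m : Reg p → ℂ}
    (hm : Set.EqOn m (target γ β D) (ready D 4)) (ρ : Config p → ℂ)
    (hρ : ∀ j ∈ D, m (Reg.r j) = ρ j) :
    Set.EqOn (exec (L.flatMap fun s => D.flatMap fun j =>
      progRK s j ++ [exp tmp tmp, mul (Reg.r j) (Reg.r j) tmp]) m) (target γ β D) (ready D 4) ∧
    ∀ j ∈ D, exec (L.flatMap fun s => D.flatMap fun j =>
      progRK s j ++ [exp tmp tmp, mul (Reg.r j) (Reg.r j) tmp]) m (Reg.r j) =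
        L.foldl (sweepStep (K γ β)) ρ j := by
  induction L generalizing m ρ with
  | nil => exact ⟨hm, hρ⟩
  | cons s L ih =>
    rw [List.flatMap_cons, exec_append, List.foldl_cons]
    refine ih (fun t ht => hL t (by simp [ht])) ?_ _ fun j hj => ?_
    · refine Avoids.eqOn ?_ hm
      simp only [avoids_flatMap, avoids_append, avoids_cons, avoids_nil, Instr.dest, mem_ready,
        stage]
      intro j hj
      refine ⟨avoids_progRK (by simp [mem_ready, stage]) (by simp [mem_ready, stage]) s j, ?_⟩
      simp [hj]
    · rw [exec_sweep γ β D s hD hm, if_pos hj, hρ j hj, hρ s (hL s (by simp)), sweepStep]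

lemma eqOn_progR (hD : D.Nodup) (hm : Set.EqOn m (target γ β D) (ready D 4)) :
    Set.EqOn (exec (progR D) m) (target γ β D) (ready D 5) := by
  rw [progR, exec_append]
  have hav : Avoids (ready D 4) (D.map fun j => rat (Reg.r j) 1) := by
    simp +contextual [avoids_map, Instr.dest, mem_ready, stage]
  have h1 : ∀ l : List (Config p), ∀ m : Reg p → ℂ, ∀ j ∈ l,
      exec (l.map fun j => rat (Reg.r j) 1) m (Reg.r j) = 1 := by
    intro l
    induction l with
    | nil => simp
    | cons a l ih =>
      intro m j hj
      rw [List.map_cons, exec_cons]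
      by_cases hjl : j ∈ l
      · exact ih _ j hjl
      · have hja : j = a := by simpa [hjl] using hj
        subst hja
        rw [exec_of_forall_dest_ne]
        · simp [Instr.run]
        · intro i hi
          obtain ⟨k, hk, rfl⟩ := List.mem_map.1 hi
          simp only [Instr.dest, ne_eq, Reg.r.injEq]
          rintro rfl
          exact hjl hk
  obtain ⟨h2, h3⟩ := exec_sweeps γ β D hD (L := D.tail.reverse)
    (fun s hs => List.mem_of_mem_tail (List.mem_reverse.1 hs)) (hav.eqOn hm) (fun _ => 1)
    (h1 D m)
  intro y hy
  by_cases hy4 : y ∈ ready D 4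
  · exact h2 hy4
  · rw [mem_ready] at hy hy4
    cases y <;> simp [stage] at hy hy4
    rename_i j
    by_cases hj : j ∈ D
    · exact h3 j hj
    · simp [hj] at hy

lemma eqOn_progW (hD : IsHalf D) (hm : Set.EqOn m (target γ β D) (ready D 5)) :
    Set.EqOn (exec (progW D) m) (target γ β D) (ready D 6) := by
  rw [progW, exec_append, List.map_eq_flatMap]
  have h1 : Set.EqOn (exec ((symmConfigs p).flatMap fun u => [copy (w u) (Reg.x u)]) m)
      (target γ β D) (ready D 5 ∪ {y | ∃ u ∈ symmConfigs p, y ∈ ({w u} : Set (Reg p))}) := by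
    refine eqOn_exec_flatMap (fun u => {w u}) ?_ ?_ ?_ hm
    · intro a _
      simp [avoids_cons, avoids_nil, Instr.dest, mem_ready, stage]
    · intro a _ b _ hab
      simp [avoids_cons, avoids_nil, Instr.dest, hab]
    · intro u hu m hm
      rintro y rfl
      have hu : IsMirror u := by simpa [symmConfigs, mem_allConfigs] using hu
      have e1 : m (Reg.x u) = X γ β u := hm (by simp [mem_ready, stage])
      simp [exec_cons, exec_nil, Instr.run, e1, target, W_of_isMirror γ β D hu]
  set S : Set (Reg p) := ready D 5 ∪ {y | ∃ u ∈ symmConfigs p, y ∈ ({w u} : Set (Reg p))} with hS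
  have hacc : acc ∉ S := by simp [hS, mem_ready, stage]
  have hacc' : acc' ∉ S := by simp [hS, mem_ready, stage]
  have htmp : tmp ∉ S := by simp [hS, mem_ready, stage]
  have hw : ∀ u, ¬ IsMirror u → w u ∉ S := by
    intro u hu
    have : u ∉ symmConfigs p := by simpa [symmConfigs, mem_allConfigs] using hu
    rintro (h | ⟨u', hu', h⟩)
    · simp [mem_ready, stage] at h
    · exact this (Reg.w.inj (Set.mem_singleton_iff.1 h) ▸ hu')
  refine (eqOn_exec_flatMap (S := S) (spec := target γ β D) (fun u => {w u, w (bar u)})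
    ?_ ?_ ?_ h1).mono ?_
  · intro u hu
    have hu := hD.2.1 u hu
    simp [avoids_cons, avoids_nil, avoids_append, avoids_flatMap, Instr.dest, hacc, htmp,
      avoids_progRK hacc' htmp, hw u hu, hw (bar u) (not_isMirror_bar hu)]
  -- The set `D` holds only one member of each pair, so different loop bodies write to disjoint
  -- pairs of registers.
  · intro u hu u' hu' hne
    have e1 : u ≠ bar u' := by
      rintro rfl
      exact (hD.2.2 u' (hD.2.1 u' hu')).1 hu' hu
    have e2 : bar u ≠ u' := by
      rintro rfl
      exact (hD.2.2 u (hD.2.1 u hu)).1 hu hu'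
    have e3 : bar u ≠ bar u' := fun h => hne (by rw [← bar_bar u, h, bar_bar])
    simp [avoids_cons, avoids_nil, avoids_append, avoids_flatMap, Instr.dest, hne, e1, e2, e3,
      avoids_progRK]
  · intro u hu m hm
    have hum := hD.2.1 u hu
    have hsub : ready D 5 ⊆ S := Set.subset_union_left
    have h0 : Avoids (ready D 5) [rat acc 0] := by
      simp [avoids_cons, avoids_nil, Instr.dest, mem_ready, stage]
    have hav : ∀ j, Avoids (ready D 5) (progRK j u ++ [add acc acc tmp]) := by
      intro j
      simp [avoids_cons, avoids_nil, avoids_append, Instr.dest, mem_ready, stage, avoids_progRK]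
    have hm5 := h0.eqOn (hm.mono hsub)
    have h := exec_flatMap_add (S := ready D 5) (spec := target γ β D) acc (l := D)
      (f := fun j => progRK j u ++ [add acc acc tmp])
      (fun j => R γ β D j * K γ β j u) (fun j _ => hav j) (fun j hj m hm => by
        have e1 : m (Reg.r j) = R γ β D j := hm (by simp [mem_ready, stage, hj])
        have e2 : exec (progRK j u) m acc = m acc :=
          (avoids_progRK (S := {acc}) (by simp) (by simp) j u).exec_apply rfl m
        have e3 := exec_progRK γ β D
          (hm.mono fun y hy => (mem_ready.1 hy).trans (by norm_num)) j u
        rw [exec_append]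
        simp [exec_cons, exec_nil, Instr.run, e1, e2, e3]) hm5
    have hx := (avoids_flatMap.2 fun j (_ : j ∈ D) => hav j).eqOn hm5 (x := Reg.x u)
      (by simp [mem_ready, stage])
    rw [exec_append, exec_append]
    generalize exec (D.flatMap fun j => progRK j u ++ [add acc acc tmp])
      (exec [rat acc 0] m) = m' at h hx ⊢
    simp only [exec_cons, exec_nil] at h
    simp only [Instr.run, Function.update_self] at h
    have hb : u ≠ bar u := (bar_ne_self hum).symm
    rintro y (rfl | rfl)
    · simp [exec_cons, exec_nil, Instr.run, h, hx, target, W, Y, hb]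
    · rw [show target γ β D (w (bar u)) = -(X γ β u * Y γ β D u) from W_bar γ β D hum]
      simp [exec_cons, exec_nil, Instr.run, h, hx, target, Y]
  · intro y hy
    by_cases hy5 : y ∈ ready D 5
    · exact Or.inl (Or.inl hy5)
    · rw [mem_ready] at hy hy5
      cases y <;> simp [stage] at hy hy5
      · split_ifs at hy hy5 <;> omega
      · rename_i u
        by_cases hu : IsMirror u
        · exact Or.inl (Or.inr ⟨u, by simp [symmConfigs, mem_allConfigs, hu], rfl⟩)
        · right
          by_cases huD : u ∈ D
          · exact ⟨u, huD, Or.inl rfl⟩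
          · refine ⟨bar u, by_contra fun h => huD ((hD.2.2 u hu).2 h), Or.inr ?_⟩
            rw [bar_bar]; rfl

lemma eqOn_progV (hm : Set.EqOn m (target γ β D) (ready D 6)) :
    Set.EqOn (exec (progV p) m) (target γ β D) (ready D 7) := by
  have hav : Avoids (ready D 6) (progV p) := by
    simp [progV, avoids_cons, avoids_nil, avoids_append, avoids_flatMap, Instr.dest, mem_ready,
      stage]
  intro y hy
  by_cases hy6 : y ∈ ready D 6
  · exact hav.eqOn hm hy6
  have hyv : y = .v := by
    rw [mem_ready] at hy hy6
    cases y <;> simp [stage] at hy hy6 ⊢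
    split_ifs at hy hy6 <;> omega
  subst hyv
  have h0 : Avoids (ready D 6) [rat v 0] := by
    simp [avoids_cons, avoids_nil, Instr.dest, mem_ready, stage]
  have hsum : ∀ f : Config p → ℂ, ((allConfigs p).map f).sum = ∑ u, f u := fun f =>
    Finset.sum_map_toList _ f
  have h := exec_flatMap_add (S := ready D 6) (spec := target γ β D) v (l := List.finRange p)
    (f := fun r => [rat acc 0, rat acc' 0] ++
      ((allConfigs p).flatMap fun u =>
        [rat tmp (starSum u r), mul tmp tmp (w u), add acc acc tmp,
          rat tmp (starDiff u r), mul tmp tmp (w u), add acc' acc' tmp]) ++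
      [mul tmp acc acc', mul tmp (gamma r) tmp, add v v tmp])
    (fun r => (γ r : ℂ) * ((∑ u, (starSum u r : ℂ) * W γ β D u) *
      (∑ v, (starDiff v r : ℂ) * W γ β D v)))
    (fun r _ => by
      simp [avoids_cons, avoids_nil, avoids_append, avoids_flatMap, Instr.dest, mem_ready, stage])
    (fun r _ m hm => by
      have hav0 : ∀ u : Config p, Avoids (ready D 6) [rat tmp (starSum u r), mul tmp tmp (w u),
          add acc acc tmp, rat tmp (starDiff u r), mul tmp tmp (w u), add acc' acc' tmp] := by
        intro u
        simp [avoids_cons, avoids_nil, Instr.dest, mem_ready, stage]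
      have hm0 : Set.EqOn (exec [rat acc 0, rat acc' 0] m) (target γ β D) (ready D 6) := by
        refine Avoids.eqOn ?_ hm
        simp [avoids_cons, avoids_nil, Instr.dest, mem_ready, stage]
      -- A single loop accumulates both sums; it is analysed once for `acc` and once for `acc'`.
      have e1 := exec_flatMap_add (S := ready D 6) (spec := target γ β D) acc (l := allConfigs p)
        (f := fun u => [rat tmp (starSum u r), mul tmp tmp (w u), add acc acc tmp,
          rat tmp (starDiff u r), mul tmp tmp (w u), add acc' acc' tmp])
        (fun u => (starSum u r : ℂ) * W γ β D u) (fun u _ => hav0 u) (fun u _ m hm => by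
          have e : m (w u) = W γ β D u := hm (by simp [mem_ready, stage])
          simp [exec_cons, exec_nil, Instr.run, e]) hm0
      have e2 := exec_flatMap_add (S := ready D 6) (spec := target γ β D) acc' (l := allConfigs p)
        (f := fun u => [rat tmp (starSum u r), mul tmp tmp (w u), add acc acc tmp,
          rat tmp (starDiff u r), mul tmp tmp (w u), add acc' acc' tmp])
        (fun u => (starDiff u r : ℂ) * W γ β D u) (fun u _ => hav0 u) (fun u _ m hm => by
          have e : m (w u) = W γ β D u := hm (by simp [mem_ready, stage])
          simp [exec_cons, exec_nil, Instr.run, e]) hm0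
      have e3 := (avoids_flatMap.2 fun u (_ : u ∈ allConfigs p) => hav0 u).eqOn hm0
        (x := gamma r) (by simp [mem_ready, stage])
      have e4 : exec ((allConfigs p).flatMap fun u =>
          [rat tmp (starSum u r), mul tmp tmp (w u), add acc acc tmp,
          rat tmp (starDiff u r), mul tmp tmp (w u), add acc' acc' tmp])
          (exec [rat acc 0, rat acc' 0] m) v = m v := by
        rw [Avoids.exec_apply (S := {v}) _ rfl]
        · simp [exec_cons, exec_nil, Instr.run]
        · simp [avoids_cons, avoids_nil, avoids_flatMap, Instr.dest]
      rw [exec_append, exec_append]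
      generalize exec ((allConfigs p).flatMap fun u =>
          [rat tmp (starSum u r), mul tmp tmp (w u), add acc acc tmp,
          rat tmp (starDiff u r), mul tmp tmp (w u), add acc' acc' tmp])
          (exec [rat acc 0, rat acc' 0] m) = m' at e1 e2 e3 e4 ⊢
      rw [hsum] at e1 e2
      simp [exec_cons, exec_nil, Instr.run] at e1 e2
      simp [exec_cons, exec_nil, Instr.run, e1, e2, e3, e4, target]) (h0.eqOn hm)
  rw [progV, exec_append, exec_append]
  generalize exec ((List.finRange p).flatMap fun r => [rat acc 0, rat acc' 0] ++
      ((allConfigs p).flatMap fun u =>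
        [rat tmp (starSum u r), mul tmp tmp (w u), add acc acc tmp,
          rat tmp (starDiff u r), mul tmp tmp (w u), add acc' acc' tmp]) ++
      [mul tmp acc acc', mul tmp (gamma r) tmp, add v v tmp]) (exec [rat v 0] m) = m' at h ⊢
  rw [← Fin.sum_univ_def] at h
  simp only [exec_cons, exec_nil] at h ⊢
  simp only [Instr.run, Function.update_self] at h
  simp only [target, V, mul_assoc]
  simp [Instr.run, h]
  ring

/-- Only the input registers are constrained at the start, since every other register that is read
has been written earlier by the procedure. -/
theorem eqOn_procedure (hD : IsHalf D) (hγ : ∀ r, m (.gamma r) = (γ r : ℂ))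
    (hβ : ∀ r, m (.beta r) = (β r : ℂ)) :
    Set.EqOn (exec (procedure D) m) (target γ β D) (ready D 7) := by
  have h0 : Set.EqOn m (target γ β D) (ready D 0) := by
    intro y hy
    rw [mem_ready] at hy
    cases y <;> simp [stage] at hy
    · exact hγ _
    · exact hβ _
    · split_ifs at hy
  simp only [procedure, exec_append]
  exact eqOn_progV γ β D (eqOn_progW γ β D hD (eqOn_progR γ β D hD.1 (eqOn_progX γ β D
    (eqOn_progPhi γ β D (eqOn_progQ γ β D (eqOn_progTrig γ β D h0))))))

end Correctness

end QAOASK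
end

theorem mainTheorem1 :
    -- the procedure takes at most `O(16^p)` elementary operations
    (∃ c : ℕ, ∀ (p : ℕ) (D : List (QAOASK.Config p)), QAOASK.IsHalf D →
      (QAOASK.procedure D).length ≤ c * 16 ^ p) ∧
    -- admissible indexings exist, independently of the parameters
    (∀ p : ℕ, ∃ D : List (QAOASK.Config p), ∀ γ : Fin p → ℝ, QAOASK.IsIndexing γ D) ∧
    ∀ (p : ℕ) (γ β : Fin p → ℝ) (D : List (QAOASK.Config p)), QAOASK.IsIndexing γ D →
      -- the procedure computes the `W_u` and `V`
      (∀ m : QAOASK.Reg p → ℂ,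
        (∀ r, m (.gamma r) = (γ r : ℂ)) → (∀ r, m (.beta r) = (β r : ℂ)) →
        (∀ u, QAOASK.exec (QAOASK.procedure D) m (.w u) = QAOASK.W γ β D u) ∧
        QAOASK.exec (QAOASK.procedure D) m .v = QAOASK.V γ β D) ∧
      -- the limits of the sums in the configuration basis
      (∀ u v : QAOASK.Config p, Filter.Tendsto (QAOASK.S₂ γ β u v) Filter.atTop
        (nhds (QAOASK.W γ β D u * QAOASK.W γ β D v))) ∧
      (∀ u v x y : QAOASK.Config p, Filter.Tendsto (QAOASK.S₄ γ β u v x y) Filter.atTop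
        (nhds (QAOASK.W γ β D u * QAOASK.W γ β D v * QAOASK.W γ β D x * QAOASK.W γ β D y))) ∧
      -- the limit of the expected energy density
      (∀ n : ℕ, MeasureTheory.Integrable (QAOASK.energyDensity (n := n) γ β)
        (QAOASK.couplingLaw n)) ∧
      Filter.Tendsto
        (fun n : ℕ => ∫ J, QAOASK.energyDensity (n := n) γ β J ∂(QAOASK.couplingLaw n))
        Filter.atTop (nhds (QAOASK.V γ β D)) := by
  refine ⟨⟨64, fun p D hD => QAOASK.length_procedure_le D hD.1⟩,
    fun p => ⟨QAOASK.pivotIndexing p, fun γ => QAOASK.isIndexing_pivotIndexing γ⟩,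
    fun p γ β D hD => ⟨fun m hγ hβ => ?_, fun u v => QAOASK.tendsto_S₂ β hD u v,
      fun u v x y => QAOASK.tendsto_S₄ β hD u v x y,
      fun n => QAOASK.integrable_energyDensity γ β, QAOASK.tendsto_integral_energyDensity β hD⟩⟩
  have h := QAOASK.eqOn_procedure γ β D hD.1 hγ hβ
  exact ⟨fun u => h (x := .w u) (by simp [QAOASK.mem_ready, QAOASK.stage]),
    h (x := .v) (by simp [QAOASK.mem_ready, QAOASK.stage])⟩
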